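/- Let $d\ge 2$ be an integer and $\alpha\in\mathbb{R}$. Let $\kappa_k$ be the volume of the unit ball of $\mathbb{R}^k$, let $\sigma_{d-1}$ be the surface measure on the unit sphere $\mathbb{S}^{d-1}\subset\mathbb{R}^d$ (of total mass $d\kappa_d$), and put $\mathbf{u}_0=(0,\dots,0,1)\in\mathbb{R}^d$. **The processes.** For $n\ge 1$ let $X_1,\dots,X_n$ be uniform on $\mathbb{S}^{d-1}$ and $e_1,\dots,e_n$ uniform on the ball of radius $n^{\alpha}$ centered at the origin of $\mathbb{R}^d$, all independent. The perturbed binomial process is $\tilde{\mathcal X}_{n,\alpha}=\{X_i+e_i\}_{i=1}^n$. For real $\lambda>0$ let $\mathcal{P}_\lambda=\{x_i\}_{i=1}^{N(\lambda)}$ be a Poisson point process on $\mathbb{S}^{d-1}$ with intensity measure $\frac{\lambda}{d\kappa_d}\sigma_{d-1}$, and let $e_1,e_2,\dots$ be i.i.d. uniform on the ball of radius $\lambda^\alpha$ centered at the origin and independent of $\mathcal{P}_\lambda$ (and of its enumeration). The perturbed Poisson process is $\tilde{\mathcal P}_{\lambda,\alpha}=\{x_i+e_i\}_{i=1}^{N(\lambda)}$.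 **The transform.** With $C_d:=\frac{2^{(d-1)/2}\kappa_{d-1}}{d\kappa_d^2}$ let $$u_{\lambda,\alpha}=\begin{cases}\kappa_d^{-\frac1{d+1}}\lambda^{\frac1{d+1}}, & \alpha\ge\frac2{d+1},\\ C_d^{\frac1{2d}}\lambda^{\frac{2+\alpha(d-1)}{4d}}, & 0<\alpha<\frac2{d+1},\\ \sqrt2\,C_d^{\frac1{2d}}\lambda^{\frac1{2d}}, & \alpha=0,\\ C_d^{\frac1{2d}}\lambda^{\frac{2-\alpha(d+1)}{4d}}, & -\frac2{d-1}<\alpha<0,\\ \kappa_d^{-\frac1{d+1}}\lambda^{\frac1{d-1}}, & \alpha=-\frac2{d-1},\\ (d\kappa_d)^{-\frac1{d-1}}\lambda^{\frac1{d-1}}, & \alpha<-\frac2{d-1},\end{cases}$$ and define, for $x$ in the ball of radius $1+\lambda^\alpha$ centered at the origin, $$T^{(\lambda,\alpha)}(x)=\Big(u_{\lambda,\alpha}\exp_{d-1}^{-1}\tfrac{x}{|x|},\ u_{\lambda,\alpha}^2\big(1-\tfrac{|x|}{1+\lambda^\alpha}\big)\Big)\in\mathbb{R}^{d-1}\times\mathbb{R}^+,\qquad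 \mathbb{R}^+=[0,\infty),$$ where $\exp_{d-1}$ is the exponential map of $\mathbb{S}^{d-1}$ at $\mathbf{u}_0$, inverted on the vectors of norm less than $\pi$ (the values of the transform at $0$ and on the half-line through $-\mathbf{u}_0$ are immaterial). **The limit.** For $h\ge0$ let $s_1(h)=\frac{1}{d\kappa_d}\sigma_{d-1}(\{y\in\mathbb{S}^{d-1}:1+y_d\le h\})$ be the normalized area of a spherical cap of height $h$ (so $s_1(h)=1$ for $h\ge2$), and let $s_2(h)=\frac{\kappa_{d-1}}{d\kappa_d}(h(2-h))^{\frac{d-1}2}$ for $h\in[0,2]$ and $s_2(h)=0$ for $h>2$. Let $\mathcal{P}^{(\infty,\alpha)}$ be the Poisson point process on $\mathbb{R}^{d-1}\times\mathbb{R}^+$ with intensity measure $\mathrm{d}v\times\nu^{(\infty,\alpha)}(\mathrm{d}h)$, where $$\nu^{(\infty,\alpha)}(\mathrm{d}h)=\begin{cases}\mathrm{d}h, & \alpha>\frac2{d+1},\\ s_1(\kappa_d^{\frac2{d+1}}h)\,\mathrm{d}h, & \alpha=\frac2{d+1},\\ h^{\frac{d-1}2}\,\mathrm{d}h, & -\frac2{d-1}<\alpha<\frac2{d+1},\\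 s_2(\kappa_d^{\frac2{d+1}}h)\,\mathrm{d}h, & \alpha=-\frac2{d-1},\\ \delta_0(\mathrm{d}h), & \alpha<-\frac2{d-1}.\end{cases}$$ **Claim.** As $n\to\infty$, $T^{(n,\alpha)}(\tilde{\mathcal X}_{n,\alpha})\to\mathcal{P}^{(\infty,\alpha)}$ in distribution, and, as $\lambda\to\infty$ (through the positive reals), $T^{(\lambda,\alpha)}(\tilde{\mathcal P}_{\lambda,\alpha})\to\mathcal{P}^{(\infty,\alpha)}$ in distribution. Here a point process is a random element of the space of locally finite counting measures on $\mathbb{R}^{d-1}\times\mathbb{R}^+$ with the vague topology, and convergence in distribution is weak convergence of the laws on that space. -/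

import Mathlib

open MeasureTheory ProbabilityTheory Filter Topology
open scoped NNReal ENNReal CompactlySupported

noncomputable section

namespace PerturbedHull

/-! ### Point configurations, the vague topology, Poisson processes -/

/-- A point configuration on `S`: a measure that is finite on compact sets and takes values in
`{0, 1, 2, …} ∪ {∞}`, i.e. a locally finite counting measure (points with multiplicity). -/
structure PointConfig (S : Type*) [TopologicalSpace S] [MeasurableSpace S] where
  toMeasure : Measure S
  finite_on_compacts : ∀ K : Set S, IsCompact K → toMeasure K < ∞
  integer_valued : ∀ B : Set S, MeasurableSet B → toMeasure B = ∞ ∨ ∃ k : ℕ, toMeasure B = k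

namespace PointConfig

variable {S : Type*} [TopologicalSpace S] [MeasurableSpace S]

/-- The vague topology: the coarsest topology for which `ξ ↦ ∫ f dξ` is continuous for every
continuous, compactly supported `f : S → ℝ`. -/
instance : TopologicalSpace (PointConfig S) :=
  TopologicalSpace.induced
    (fun (ξ : PointConfig S) (f : C_c(S, ℝ)) => ∫ x, f x ∂ξ.toMeasure) inferInstance

instance : MeasurableSpace (PointConfig S) := borel (PointConfig S)

instance : BorelSpace (PointConfig S) := ⟨rfl⟩

/-- The counting measure `∑ i ∈ s, δ_{x i}` of a finite family of points. -/
def ofFamily {ι : Type*} (s : Finset ι) (x : ι → S) : PointConfig S where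
  toMeasure := ∑ i ∈ s, Measure.dirac (x i)
  finite_on_compacts := fun K _ => measure_lt_top _ K
  integer_valued := by
    classical
    intro B hB
    refine Or.inr ⟨(s.filter fun i => x i ∈ B).card, ?_⟩
    rw [Measure.finsetSum_apply, Finset.card_filter, Nat.cast_sum]
    refine Finset.sum_congr rfl fun i _ => ?_
    rw [Measure.dirac_apply' _ hB]
    by_cases h : x i ∈ B <;> simp [h]

end PointConfig

/-- `η` is a Poisson point process on `S` with intensity measure `μ`: it is a random point
configuration, the number of points in a measurable set `B` with `μ B < ∞` has the Poisson
distribution with parameter `μ B`, and the numbers of points in pairwise disjoint measurable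
sets are independent. -/
structure IsPoissonProcess {S : Type*} [TopologicalSpace S] [MeasurableSpace S]
    {Ω : Type*} [MeasurableSpace Ω] (P : Measure Ω) (η : Ω → PointConfig S)
    (μ : Measure S) : Prop where
  aemeasurable : AEMeasurable (fun ω => (η ω).toMeasure) P
  law_count : ∀ B : Set S, MeasurableSet B → μ B < ∞ →
    HasLaw (fun ω => (η ω).toMeasure B)
      ((poissonMeasure (μ B).toNNReal).map (fun k : ℕ => (k : ℝ≥0∞))) P
  indep_count : ∀ (n : ℕ) (B : Fin n → Set S), (∀ i, MeasurableSet (B i)) →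
    Pairwise (fun i j => Disjoint (B i) (B j)) →
    iIndepFun (fun i ω => (η ω).toMeasure (B i)) P

/-! ### Sphere and exponential map

Throughout, the ambient dimension is `d = m + 1`, so that the tangent plane `ℝ^{d-1}` is
`EuclideanSpace ℝ (Fin m)`; the north pole `u₀ = (0, …, 0, 1)` is the last basis vector. -/

/-- Euclidean space `ℝ^k`. -/
abbrev E (k : ℕ) : Type := EuclideanSpace ℝ (Fin k)

/-- The unit sphere `𝕊^m` of `ℝ^{m+1}`. -/
abbrev Sph (m : ℕ) : Type := Metric.sphere (0 : E (m + 1)) 1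

/-- The first `m` coordinates of a point of `ℝ^{m+1}`. -/
def horizontal {m : ℕ} (x : E (m + 1)) : E m := WithLp.toLp 2 (fun i => x i.castSucc)

/-- The volume `κ_k` of the unit ball of `ℝ^k`. -/
def kappa (k : ℕ) : ℝ := (volume : Measure (E k)).real (Metric.ball 0 1)

/-- The uniform probability measure on the unit sphere: the normalized surface measure. -/
def sphereUniform (m : ℕ) : Measure (Sph m) :=
  cond ((volume : Measure (E (m + 1))).toSphere) Set.univ

/-- The uniform probability measure on the ball of radius `r` centered at the origin. -/
def ballUniform (k : ℕ) (r : ℝ) : Measure (E k) :=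
  cond (volume : Measure (E k)) (Metric.closedBall 0 r)

/-- The exponential map at the north pole: `v` goes to the point of the sphere at geodesic
distance `‖v‖` from `u₀` in the direction `v`. -/
def sphereExp {m : ℕ} (v : E m) : E (m + 1) :=
  WithLp.toLp 2 (Fin.snoc (fun i => Real.sin ‖v‖ / ‖v‖ * v i) (Real.cos ‖v‖))

/-- The inverse of the exponential map at the north pole, see `sphereLog_sphereExp` and
`sphereExp_sphereLog`. At the south pole, where it is not determined, the value is `0`. -/
def sphereLog {m : ℕ} (y : E (m + 1)) : E m :=
  (Real.arccos (y (Fin.last m)) / ‖horizontal y‖) • horizontal y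

theorem norm_sq_eq {m : ℕ} (y : E (m + 1)) :
    ‖y‖ ^ 2 = ‖horizontal y‖ ^ 2 + y (Fin.last m) ^ 2 := by
  rw [EuclideanSpace.norm_sq_eq, EuclideanSpace.norm_sq_eq, Fin.sum_univ_castSucc]
  simp [horizontal]

theorem horizontal_sphereExp {m : ℕ} (v : E m) :
    horizontal (sphereExp v) = (Real.sin ‖v‖ / ‖v‖) • v := by
  ext i
  simp [horizontal, sphereExp]

theorem sphereExp_last {m : ℕ} (v : E m) :
    sphereExp v (Fin.last m) = Real.cos ‖v‖ := by
  simp [sphereExp]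

theorem norm_sphereExp {m : ℕ} (v : E m) : ‖sphereExp v‖ = 1 := by
  have h : ‖sphereExp v‖ ^ 2 = 1 := by
    rw [norm_sq_eq, horizontal_sphereExp, sphereExp_last, norm_smul, mul_pow,
      Real.norm_eq_abs, sq_abs]
    by_cases hv : ‖v‖ = 0
    · simp [hv]
    · field_simp
      exact Real.sin_sq_add_cos_sq _
  nlinarith [norm_nonneg (sphereExp v)]

theorem sphereLog_sphereExp {m : ℕ} (v : E m) (hv : ‖v‖ < Real.pi) :
    sphereLog (sphereExp v) = v := by
  rw [sphereLog, sphereExp_last, horizontal_sphereExp,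
    Real.arccos_cos (norm_nonneg v) hv.le, norm_smul]
  rcases eq_or_ne v 0 with rfl | h0
  · simp
  have hn : 0 < ‖v‖ := norm_pos_iff.2 h0
  have hs : 0 < Real.sin ‖v‖ := Real.sin_pos_of_pos_of_lt_pi hn hv
  rw [Real.norm_of_nonneg (by positivity), smul_smul]
  have : ‖v‖ / (Real.sin ‖v‖ / ‖v‖ * ‖v‖) * (Real.sin ‖v‖ / ‖v‖) = 1 := by
    field_simp
  rw [this, one_smul]

theorem sphereExp_sphereLog {m : ℕ} (y : E (m + 1)) (hy : ‖y‖ = 1)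
    (hs : y (Fin.last m) ≠ -1) : sphereExp (sphereLog y) = y := by
  have h1 := norm_sq_eq y
  rw [hy] at h1
  have hle : y (Fin.last m) ≤ 1 := by nlinarith [sq_nonneg ‖horizontal y‖]
  have hge : -1 ≤ y (Fin.last m) := by nlinarith [sq_nonneg ‖horizontal y‖]
  have key : horizontal (sphereExp (sphereLog y)) = horizontal y ∧
      sphereExp (sphereLog y) (Fin.last m) = y (Fin.last m) := by
    rw [horizontal_sphereExp, sphereExp_last]
    rcases eq_or_ne (horizontal y) 0 with h0 | h0
    · have : y (Fin.last m) = 1 := by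
        rw [h0, norm_zero] at h1
        have h2 : y (Fin.last m) ^ 2 = 1 := by linarith
        rcases (sq_eq_sq_iff_eq_or_eq_neg.1 (h2.trans (one_pow 2).symm)) with h | h
        · exact h
        · exact absurd h hs
      simp [sphereLog, h0, this]
    · have hn : 0 < ‖horizontal y‖ := norm_pos_iff.2 h0
      have hlog : ‖sphereLog y‖ = Real.arccos (y (Fin.last m)) := by
        rw [sphereLog, norm_smul, Real.norm_of_nonneg
          (div_nonneg (Real.arccos_nonneg _) hn.le)]
        field_simp
      have hlt : y (Fin.last m) < 1 := by nlinarith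
      have hpos : 0 < Real.arccos (y (Fin.last m)) := Real.arccos_pos.2 hlt
      have hsin : Real.sin (Real.arccos (y (Fin.last m))) = ‖horizontal y‖ := by
        rw [Real.sin_arccos, show 1 - y (Fin.last m) ^ 2 = ‖horizontal y‖ ^ 2 by linarith,
          Real.sqrt_sq hn.le]
      rw [hlog, hsin, Real.cos_arccos hge hle]
      refine ⟨?_, rfl⟩
      rw [sphereLog, smul_smul]
      have : ‖horizontal y‖ / Real.arccos (y (Fin.last m)) *
          (Real.arccos (y (Fin.last m)) / ‖horizontal y‖) = 1 := by
        field_simp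
      rw [this, one_smul]
  ext i
  refine Fin.lastCases key.2 (fun j => ?_) i
  have := congrArg (fun z : E m => z j) key.1
  simpa [horizontal] using this

/-! ### Scaling factors, scaling transforms and limiting intensity measures -/

/-- The constant `2^{(d-1)/2} κ_{d-1} / (d κ_d²)`. -/
def scalingConst (d : ℕ) : ℝ :=
  2 ^ (((d : ℝ) - 1) / 2) * kappa (d - 1) / (d * kappa d ^ 2)

/-- The scaling factor `u_{λ,α}` in dimension `d`. -/
def scalingFactor (d : ℕ) (lam α : ℝ) : ℝ :=
  if 2 / ((d : ℝ) + 1) ≤ α then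
    kappa d ^ (-1 / ((d : ℝ) + 1)) * lam ^ (1 / ((d : ℝ) + 1))
  else if 0 < α then
    scalingConst d ^ (1 / (2 * (d : ℝ))) * lam ^ ((2 + α * ((d : ℝ) - 1)) / (4 * (d : ℝ)))
  else if α = 0 then
    Real.sqrt 2 * scalingConst d ^ (1 / (2 * (d : ℝ))) * lam ^ (1 / (2 * (d : ℝ)))
  else if -2 / ((d : ℝ) - 1) < α then
    scalingConst d ^ (1 / (2 * (d : ℝ))) * lam ^ ((2 - α * ((d : ℝ) + 1)) / (4 * (d : ℝ)))
  else if α = -2 / ((d : ℝ) - 1) then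
    kappa d ^ (-1 / ((d : ℝ) + 1)) * lam ^ (1 / ((d : ℝ) - 1))
  else
    ((d : ℝ) * kappa d) ^ (-1 / ((d : ℝ) - 1)) * lam ^ (1 / ((d : ℝ) - 1))

/-- The parabolic scaling transform
`x ↦ (u exp⁻¹ (x / |x|), u² (1 - |x| / (1 + λ^α)))`, `u = u_{λ,α}`, from `ℝ^d` to
`ℝ^{d-1} × [0, ∞)`, where `d = m + 1`. On the ball of radius `1 + λ^α` the height is nonnegative,
so that the truncation `Real.toNNReal` only plays a role outside of this ball. -/
def scalingTransform (m : ℕ) (lam α : ℝ) (x : E (m + 1)) : E m × ℝ≥0 :=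
  (scalingFactor (m + 1) lam α • sphereLog (‖x‖⁻¹ • x),
    Real.toNNReal (scalingFactor (m + 1) lam α ^ 2 * (1 - ‖x‖ / (1 + lam ^ α))))

/-- `s₁(h)`: the normalized surface area of the cap of height `h` of the unit sphere, i.e. of the
part of the unit sphere centered at `u₀` on which the last coordinate is at most `h`. -/
def capArea (m : ℕ) (h : ℝ) : ℝ :=
  (sphereUniform m).real {y : Sph m | 1 + (y : E (m + 1)) (Fin.last m) ≤ h}

/-- `s₂(h)`: the `(d-1)`-dimensional volume of the section at height `h` of the unit ball centered
at `u₀`, divided by the surface area `d κ_d` of the unit sphere. -/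
def sectionArea (d : ℕ) (h : ℝ) : ℝ :=
  if h ≤ 2 then
    kappa (d - 1) / (d * kappa d) * (h * (2 - h)) ^ (((d : ℝ) - 1) / 2)
  else 0

/-- Lebesgue measure on `[0, ∞)`. -/
def lebesgueHalfLine : Measure ℝ≥0 := (volume : Measure ℝ).comap ((↑) : ℝ≥0 → ℝ)

/-- The measure `ν^{(∞,α)}` on `[0, ∞)`, in dimension `d = m + 1`. -/
def heightMeasure (m : ℕ) (α : ℝ) : Measure ℝ≥0 :=
  let d : ℕ := m + 1
  if 2 / ((d : ℝ) + 1) < α then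
    lebesgueHalfLine
  else if α = 2 / ((d : ℝ) + 1) then
    lebesgueHalfLine.withDensity fun h : ℝ≥0 =>
      ENNReal.ofReal (capArea m (kappa d ^ (2 / ((d : ℝ) + 1)) * h))
  else if -2 / ((d : ℝ) - 1) < α then
    lebesgueHalfLine.withDensity fun h : ℝ≥0 => ENNReal.ofReal ((h : ℝ) ^ (((d : ℝ) - 1) / 2))
  else if α = -2 / ((d : ℝ) - 1) then
    lebesgueHalfLine.withDensity fun h : ℝ≥0 =>
      ENNReal.ofReal (sectionArea d (kappa d ^ (2 / ((d : ℝ) + 1)) * h))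
  else
    Measure.dirac 0

/-- The limiting intensity measure `μ^{(∞,α)}(dv, dh) = dv × ν^{(∞,α)}(dh)` on
`ℝ^{d-1} × [0, ∞)`, in dimension `d = m + 1`. -/
def limitIntensity (m : ℕ) (α : ℝ) : Measure (E m × ℝ≥0) :=
  (volume : Measure (E m)).prod (heightMeasure m α)

/-! ### The two models -/

/-- Binomial input of size `n`: the `X i` are uniform on the unit sphere, the perturbations `e i`
are uniform on the ball of radius `n^α`, and all these variables are independent. -/
structure IsBinomialInput {m : ℕ} (n : ℕ) (α : ℝ) {Ω : Type*} [MeasurableSpace Ω]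
    (P : Measure Ω) (X : Fin n → Ω → Sph m) (e : Fin n → Ω → E (m + 1)) : Prop where
  law_point : ∀ i, HasLaw (X i) (sphereUniform m) P
  law_noise : ∀ i, HasLaw (e i) (ballUniform (m + 1) ((n : ℝ) ^ α)) P
  indep : iIndepFun
    (Sum.elim (fun i ω => (X i ω : E (m + 1))) e : Fin n ⊕ Fin n → Ω → E (m + 1)) P

/-- The rescaled perturbed binomial process: the image under the transform with parameter `n` of
the points `X i + e i`, `i < n`. -/
def rescaledBinomial {m : ℕ} (n : ℕ) (α : ℝ) {Ω : Type*}
    (X : Fin n → Ω → Sph m) (e : Fin n → Ω → E (m + 1)) (ω : Ω) : PointConfig (E m × ℝ≥0) :=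
  PointConfig.ofFamily Finset.univ
    fun i => scalingTransform m n α ((X i ω : E (m + 1)) + e i ω)

/-- Poisson input of intensity `lam`: the points `x i`, `i < N`, form a Poisson point process on
the unit sphere whose intensity measure is `lam / (d κ_d)` times the surface measure, i.e. `lam`
times the uniform probability measure; the perturbations `e i` are uniform on the ball of radius
`lam^α`, independent, and independent of the points. -/
structure IsPoissonInput {m : ℕ} (lam α : ℝ) {Ω : Type*} [MeasurableSpace Ω]
    (P : Measure Ω) (N : Ω → ℕ) (x : ℕ → Ω → Sph m) (e : ℕ → Ω → E (m + 1)) : Prop where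
  aemeasurable_card : AEMeasurable N P
  aemeasurable_point : ∀ i, AEMeasurable (x i) P
  poisson : IsPoissonProcess P
    (fun ω => PointConfig.ofFamily (Finset.range (N ω)) fun i => x i ω)
    (ENNReal.ofReal (lam / (((m + 1 : ℕ) : ℝ) * kappa (m + 1))) •
      (volume : Measure (E (m + 1))).toSphere)
  law_noise : ∀ i, HasLaw (e i) (ballUniform (m + 1) (lam ^ α)) P
  indep_noise : iIndepFun e P
  indep : IndepFun (fun ω => (N ω, fun i => x i ω)) (fun ω i => e i ω) P

/-- The rescaled perturbed Poisson process: the image under the transform with parameter `lam` of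
the points `x i + e i`, `i < N`. -/
def rescaledPoisson {m : ℕ} (lam α : ℝ) {Ω : Type*}
    (N : Ω → ℕ) (x : ℕ → Ω → Sph m) (e : ℕ → Ω → E (m + 1)) (ω : Ω) :
    PointConfig (E m × ℝ≥0) :=
  PointConfig.ofFamily (Finset.range (N ω))
    fun i => scalingTransform m lam α ((x i ω : E (m + 1)) + e i ω)

end PerturbedHull

end

open MeasureTheory ProbabilityTheory Filter Topology
open scoped NNReal ENNReal CompactlySupported

noncomputable section

namespace PerturbedHull

/-! ### The vague topology and convergence in distribution. -/

namespace PointConfig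

variable {S : Type*} [TopologicalSpace S] [MeasurableSpace S]

/-! For the vague topology, convergence in distribution follows from convergence of the
characteristic functionals `E exp(i ∫ f dξ)` over test functions `f`. Countably many integrals
generate the topology, so an open set is an increasing union of finite-dimensional cylinders, and on
each cylinder Lévy's continuity theorem in `ℝ^k` and the portmanteau bound for open sets apply
(`tendstoInDistribution_of_charFunctional`). No tightness argument is needed, since the limit law is
given.

Put `g = exp(i f) - 1` and let `t` be the mean of `g` at one rescaled perturbed point
(`transformMean`). The binomial functional is `(1 + t)^n`, the perturbed Poisson functional is
`exp(λ t)`, and the functional of the limit is `exp(∫ g dμ)`, with `μ` the limiting intensity. Both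
claims thus reduce to one deterministic limit, `λ t → ∫ g dμ` for continuous compactly supported `g`
(`tendsto_mul_transformMean`).

Write `r = λ^α`. The points of the sphere within distance `r` of a point of norm `ρ` form a cap of
height `(r² - (1 - ρ)²) / (2ρ)`, so by Fubini the density of `X + e` there is the normalized area of
this cap divided by `κ_d r^d` (`integral_perturbed`). This law is rotation invariant, so direction
and norm decouple. At scale `u` the directions contribute `u^{-(d-1)}` times Lebesgue measure on the
tangent space (`tendsto_pow_smul_sphereIntegral`), and substituting `ρ = (1 + r)(1 - h/u²)` gives an
explicit density of heights (`mul_transformMean_eq`).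

Up to terms that vanish as `u → ∞`, the cap seen at height `h` has height `(r/u²) h (1 - h/(2u²r))`.
If `r/u² → ∞`, the cap is the whole sphere and the density is `1`; if `r/u²` is constant, `s₁`
appears. If `r/u² → 0`, the cap area is asymptotic to a constant times the power `(d-1)/2` of its
height, which gives `h^{(d-1)/2}` when `u²r → ∞` and the section area `s₂` when `u²r` is constant.
In these cases dominated convergence concludes. If `u²r → 0`, all heights collapse and `δ₀` appears
(`tendsto_mul_transformMean_of_degenerate`).

The remaining prefactor contains `((1 + r)/r)^d`, which tends to `1`, equals `2^d`, or grows like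
`r^{-d}` according to the sign of `α`. Hence the three formulas for `u` in the middle range. -/

instance (ξ : PointConfig S) : IsFiniteMeasureOnCompacts ξ.toMeasure :=
  ⟨fun K hK => ξ.finite_on_compacts K hK⟩

theorem integrable_compactlySupported [OpensMeasurableSpace S] (ξ : PointConfig S)
    (f : C_c(S, ℝ)) : Integrable f ξ.toMeasure :=
  f.continuous.integrable_of_hasCompactSupport f.hasCompactSupport

theorem continuous_integral (f : C_c(S, ℝ)) :
    Continuous fun ξ : PointConfig S => ∫ x, f x ∂ξ.toMeasure := by
  have h : Continuous fun (ξ : PointConfig S) (f : C_c(S, ℝ)) => ∫ x, f x ∂ξ.toMeasure :=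
    continuous_induced_dom
  exact (continuous_apply f).comp h

section SecondCountable

variable [T2Space S] [LocallyCompactSpace S] [SecondCountableTopology S]

omit [MeasurableSpace S] in
/-- A countable family of test functions that approximates every test function uniformly, on a
compact set that carries both. -/
theorem exists_countable_approx : ∃ D : Set C_c(S, ℝ), D.Countable ∧ D.Nonempty ∧
    ∀ f : C_c(S, ℝ), ∃ φ ∈ D, ∀ ε > 0, ∃ g ∈ D, ∀ x, |f x - g x| ≤ ε * φ x := by
  let K := CompactExhaustion.choice S
  have hφ : ∀ n, ∃ φ : C_c(S, ℝ), (∀ x ∈ K n, φ x = 1) ∧ ∀ x, 0 ≤ φ x := by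
    intro n
    obtain ⟨φ, h1, -, h2, h3⟩ := exists_continuous_one_zero_of_isCompact (K.isCompact n)
      isClosed_empty (Set.disjoint_empty _)
    exact ⟨⟨φ, h2⟩, fun x hx => h1 hx, fun x => (h3 x).1⟩
  choose φ hφ1 hφ0 using hφ
  -- The compact-open topology on `C(S, ℝ)` is second countable here, so each of these subspaces is
  -- separable; on functions carried by `K n` it is the topology of uniform convergence.
  let A : ℕ → Set C(S, ℝ) := fun n => {f | ∀ x ∉ K n, f x = 0}
  have hs : ∀ n, ∃ s : Set (A n), s.Countable ∧ Dense s :=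
    fun n => TopologicalSpace.exists_countable_dense _
  choose s hsc hsd using hs
  let toCc : ∀ n, A n → C_c(S, ℝ) := fun n f =>
    ⟨f.1, HasCompactSupport.intro (K.isCompact n) f.2⟩
  refine ⟨Set.range φ ∪ ⋃ n, toCc n '' s n,
    (Set.countable_range φ).union (Set.countable_iUnion fun n => (hsc n).image _),
    ⟨φ 0, Or.inl ⟨0, rfl⟩⟩, fun f => ?_⟩
  obtain ⟨n, hn⟩ := K.exists_superset_of_isCompact f.hasCompactSupport
  have hf0 : ∀ x ∉ K n, f x = 0 := fun x hx =>
    image_eq_zero_of_notMem_tsupport fun h => hx (hn h)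
  let f' : A n := ⟨f.toContinuousMap, hf0⟩
  refine ⟨φ n, Or.inl ⟨n, rfl⟩, fun ε hε => ?_⟩
  have hcont : Tendsto (fun g : A n => (g : C(S, ℝ))) (𝓝 f') (𝓝 f'.1) :=
    continuous_subtype_val.tendsto f'
  have hev := Metric.tendstoUniformlyOn_iff.1
    (ContinuousMap.tendsto_iff_forall_isCompact_tendstoUniformlyOn.1 hcont _ (K.isCompact n)) ε hε
  obtain ⟨g, hg, hgs⟩ := mem_closure_iff_nhds.1 (hsd n f') _ hev
  refine ⟨toCc n g, Or.inr (Set.mem_iUnion.2 ⟨n, g, hgs, rfl⟩), fun x => ?_⟩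
  by_cases hx : x ∈ K n
  · rw [hφ1 n x hx, mul_one]
    exact (hg x hx).le
  · have : toCc n g x = 0 := g.2 x hx
    rw [hf0 x hx, this, sub_zero, abs_zero]
    exact mul_nonneg hε.le (hφ0 n x)

/-- The vague topology is generated by countably many test functions. -/
theorem exists_seq_topology_eq_induced [OpensMeasurableSpace S] : ∃ F : ℕ → C_c(S, ℝ),
    (instTopologicalSpace : TopologicalSpace (PointConfig S)) = TopologicalSpace.induced
      (fun (ξ : PointConfig S) (k : ℕ) => ∫ x, F k x ∂ξ.toMeasure) inferInstance := by
  obtain ⟨D, hDc, hDn, hD⟩ := exists_countable_approx (S := S)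
  obtain ⟨F, rfl⟩ := hDc.exists_eq_range hDn
  refine ⟨F, le_antisymm (continuous_iff_le_induced.1
    (continuous_pi fun k => continuous_integral (F k))) ?_⟩
  refine continuous_iff_le_induced.1 ((@continuous_pi_iff _ _ _ (_) _ _).2 fun f => ?_)
  let τ : TopologicalSpace (PointConfig S) := TopologicalSpace.induced
      (fun (ξ : PointConfig S) (k : ℕ) => ∫ x, F k x ∂ξ.toMeasure) inferInstance
  change Continuous[τ, _] _
  have hF : ∀ k, Continuous[τ, _] fun ξ : PointConfig S => ∫ x, F k x ∂ξ.toMeasure := by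
    have h : Continuous[τ, _] fun (ξ : PointConfig S) (k : ℕ) => ∫ x, F k x ∂ξ.toMeasure :=
      continuous_iff_le_induced.2 le_rfl
    exact fun k => @Continuous.comp _ _ _ τ _ _ _ _ (continuous_apply k) h
  obtain ⟨_, ⟨a, rfl⟩, ha⟩ := hD f
  refine (@continuous_iff_continuousAt _ _ τ _ _).2 fun ξ₀ => ?_
  refine Metric.tendsto_nhds.2 ?_
  intro ε hε
  set M := |∫ x, F a x ∂ξ₀.toMeasure| + 1
  have hM : 0 < M := by positivity
  -- With this tolerance, replacing `f` by `F b` costs at most `ε / 4` wherever `|∫ F a| ≤ M`, which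
  -- holds on a `τ`-neighbourhood of `ξ₀`. The errors at `ξ` and `ξ₀` and the variation of `∫ F b`
  -- then sum to less than `ε`.
  obtain ⟨_, ⟨b, rfl⟩, hb⟩ := ha (ε / (4 * M)) (by positivity)
  have key : ∀ ξ : PointConfig S, |∫ x, F a x ∂ξ.toMeasure| ≤ M →
      |∫ x, f x ∂ξ.toMeasure - ∫ x, F b x ∂ξ.toMeasure| ≤ ε / 4 := by
    intro ξ hξ
    rw [← integral_sub (ξ.integrable_compactlySupported f) (ξ.integrable_compactlySupported (F b))]
    calc |∫ x, (f x - F b x) ∂ξ.toMeasure| ≤ ∫ x, |f x - F b x| ∂ξ.toMeasure :=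
          abs_integral_le_integral_abs
      _ ≤ ∫ x, ε / (4 * M) * F a x ∂ξ.toMeasure :=
          integral_mono ((ξ.integrable_compactlySupported f).sub
            (ξ.integrable_compactlySupported (F b))).abs
            ((ξ.integrable_compactlySupported (F a)).const_mul _) hb
      _ = ε / (4 * M) * ∫ x, F a x ∂ξ.toMeasure := integral_const_mul _ _
      _ ≤ ε / (4 * M) * M := by gcongr; exact (le_abs_self _).trans hξ
      _ = ε / 4 := by field_simp
  have e1 : ∀ᶠ ξ in @nhds _ τ ξ₀, |∫ x, F a x ∂ξ.toMeasure| ≤ M := by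
    have := ((hF a).abs.continuousAt (x := ξ₀)).eventually_lt_const
      (show |∫ x, F a x ∂ξ₀.toMeasure| < M by simp [M])
    exact this.mono fun _ h => h.le
  have e2 := Metric.tendsto_nhds.1 ((hF b).continuousAt (x := ξ₀)) (ε / 4) (by positivity)
  filter_upwards [e1, e2] with ξ h1 h2
  have h3 := key ξ h1
  have h4 := key ξ₀ (by simp [M])
  rw [Real.dist_eq, abs_lt] at *
  rw [abs_le] at h3 h4
  constructor <;> linarith [h3.1, h3.2, h4.1, h4.2, h2.1, h2.2]

instance [OpensMeasurableSpace S] : SecondCountableTopology (PointConfig S) := by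
  obtain ⟨F, hF⟩ := exists_seq_topology_eq_induced (S := S)
  have := TopologicalSpace.secondCountableTopology_induced (PointConfig S) (ℕ → ℝ)
    (fun ξ k => ∫ x, F k x ∂ξ.toMeasure)
  rwa [← hF] at this

/-- The integrals of the first `k` test functions of a sequence. -/
def integralVector (F : ℕ → C_c(S, ℝ)) (k : ℕ) (ξ : PointConfig S) : EuclideanSpace ℝ (Fin k) :=
  WithLp.toLp 2 fun i => ∫ x, F i x ∂ξ.toMeasure

omit [T2Space S] [LocallyCompactSpace S] [SecondCountableTopology S] in
theorem continuous_integralVector (F : ℕ → C_c(S, ℝ)) (k : ℕ) :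
    Continuous (integralVector F k) :=
  (PiLp.continuous_toLp 2 _).comp (continuous_pi fun i => continuous_integral (F i))

/-- Every vaguely open set is an increasing union of cylinder sets. -/
theorem exists_cylinder_exhaustion [OpensMeasurableSpace S] : ∃ F : ℕ → C_c(S, ℝ),
    ∀ U : Set (PointConfig S), IsOpen U → ∃ W : ∀ k, Set (EuclideanSpace ℝ (Fin k)),
      (∀ k, IsOpen (W k)) ∧ Monotone (fun k => integralVector F k ⁻¹' W k) ∧
        U = ⋃ k, integralVector F k ⁻¹' W k := by
  obtain ⟨F, hF⟩ := exists_seq_topology_eq_induced (S := S)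
  refine ⟨F, fun U hU => ?_⟩
  -- Taking the largest admissible open base makes monotonicity automatic: a cylinder over `k`
  -- integrals is also one over `l ≥ k` integrals.
  let W : ∀ k, Set (EuclideanSpace ℝ (Fin k)) := fun k =>
    ⋃₀ {V | IsOpen V ∧ integralVector F k ⁻¹' V ⊆ U}
  have hWU : ∀ k, integralVector F k ⁻¹' W k ⊆ U := by
    rintro k ξ ⟨V, ⟨-, hV⟩, hξ⟩
    exact hV hξ
  refine ⟨W, fun k => isOpen_sUnion fun V hV => hV.1, ?_, ?_⟩
  · intro k l hkl ξ ⟨V, ⟨hVo, hV⟩, hξ⟩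
    have hc : Continuous fun y : EuclideanSpace ℝ (Fin l) =>
        (WithLp.toLp 2 fun i : Fin k => y (Fin.castLE hkl i) : EuclideanSpace ℝ (Fin k)) :=
      (PiLp.continuous_toLp 2 _).comp (by fun_prop)
    exact ⟨_, ⟨hVo.preimage hc, fun ζ hζ => hV hζ⟩, hξ⟩
  · refine Set.Subset.antisymm (fun ξ hξ => ?_) (Set.iUnion_subset hWU)
    rw [hF] at hU
    obtain ⟨V, hV, rfl⟩ := isOpen_induced_iff.1 hU
    obtain ⟨I, u, hu, hI⟩ := isOpen_pi_iff.1 hV _ hξ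
    obtain ⟨k, hk⟩ : ∃ k, ∀ i ∈ I, i < k :=
      ⟨I.sup id + 1, fun i hi => Nat.lt_succ_of_le (Finset.le_sup (f := id) hi)⟩
    refine Set.mem_iUnion.2 ⟨k, ⋂ i ∈ I.attach, {y | y ⟨i, hk i i.2⟩ ∈ u i}, ⟨?_, ?_⟩, ?_⟩
    · refine isOpen_biInter_finset fun i _ => (hu i i.2).1.preimage ?_
      fun_prop
    · intro ζ hζ
      refine hI fun i hi => ?_
      simpa [integralVector] using Set.mem_iInter₂.1 hζ ⟨i, hi⟩ (Finset.mem_attach _ _)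
    · exact Set.mem_iInter₂.2 fun i _ => by simpa [integralVector] using (hu i i.2).2

/-- Open sets are countable unions of cylinders, so their preimages are null measurable, and they
generate the σ-algebra. Second countability of the vague topology upgrades null measurability to
almost everywhere measurability. -/
theorem aemeasurable_of_integral [OpensMeasurableSpace S] {Ω : Type*} [MeasurableSpace Ω]
    {P : Measure Ω} {ξ : Ω → PointConfig S}
    (h : ∀ f : C_c(S, ℝ), AEMeasurable (fun ω => ∫ x, f x ∂(ξ ω).toMeasure) P) :
    AEMeasurable ξ P := by
  obtain ⟨F, hF⟩ := exists_cylinder_exhaustion (S := S)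
  have hopen : ∀ U : Set (PointConfig S), IsOpen U → NullMeasurableSet (ξ ⁻¹' U) P := by
    intro U hU
    obtain ⟨W, hW, -, rfl⟩ := hF U hU
    rw [Set.preimage_iUnion]
    refine NullMeasurableSet.iUnion fun k => ?_
    have : AEMeasurable (fun ω => integralVector F k (ξ ω)) P :=
      (PiLp.continuous_toLp 2 _).measurable.comp_aemeasurable
        (aemeasurable_pi_lambda _ fun i => h (F i))
    exact this.nullMeasurable (hW k).measurableSet
  have : NullMeasurable ξ P := by
    have hm : @Measurable (NullMeasurableSpace Ω P) _ _ (borel (PointConfig S)) ξ :=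
      measurable_generateFrom fun U hU => hopen U hU
    exact fun U hU => hm hU
  exact this.aemeasurable

-- The Cramér–Wold device: a linear combination of test functions is a test function, so the
-- characteristic functional determines the joint characteristic functions of finitely many
-- integrals.
omit [T2Space S] [LocallyCompactSpace S] [SecondCountableTopology S] in
theorem inner_integralVector [OpensMeasurableSpace S] (F : ℕ → C_c(S, ℝ)) (k : ℕ)
    (ξ : PointConfig S) (t : EuclideanSpace ℝ (Fin k)) :
    inner ℝ (integralVector F k ξ) t = ∫ x, (∑ i, t i • F i : C_c(S, ℝ)) x ∂ξ.toMeasure := by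
  have : ∀ x, (∑ i, t i • F i : C_c(S, ℝ)) x = ∑ i, t i * F i x := by
    intro x
    simp [CompactlySupportedContinuousMap.coe_sum]
  rw [integral_congr_ae (.of_forall this),
    integral_finsetSum (f := fun (i : Fin k) x => t i * F i x) _
      fun i _ => (ξ.integrable_compactlySupported (F i)).const_mul _, PiLp.inner_apply]
  simp [integralVector, integral_const_mul]

omit [T2Space S] [LocallyCompactSpace S] [SecondCountableTopology S] in
theorem charFun_map_integralVector [OpensMeasurableSpace S] {Ω : Type*} [MeasurableSpace Ω]
    {P : Measure Ω} {ξ : Ω → PointConfig S} (hξ : AEMeasurable ξ P) (F : ℕ → C_c(S, ℝ)) (k : ℕ)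
    (t : EuclideanSpace ℝ (Fin k)) :
    charFun ((P.map ξ).map (integralVector F k)) t = ∫ ω, Complex.exp
      ((∫ x, (∑ i, t i • F i : C_c(S, ℝ)) x ∂(ξ ω).toMeasure : ℝ) * Complex.I) ∂P := by
  have hc := continuous_integralVector F k
  rw [charFun_apply, integral_map hc.measurable.aemeasurable (by fun_prop), integral_map hξ]
  · simp_rw [inner_integralVector]
  · have : Continuous fun ξ : PointConfig S =>
      Complex.exp ((inner ℝ (integralVector F k ξ) t : ℝ) * Complex.I) := by fun_prop
    exact this.measurable.aestronglyMeasurable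

/-- Convergence of the characteristic functionals on test functions implies convergence in
distribution for the vague topology. -/
theorem tendstoInDistribution_of_charFunctional [OpensMeasurableSpace S] {ι : Type*}
    {l : Filter ι} [l.IsCountablyGenerated]
    {Ω : ι → Type*} [∀ i, MeasurableSpace (Ω i)] {P : ∀ i, Measure (Ω i)}
    [∀ i, IsProbabilityMeasure (P i)] {ξ : ∀ i, Ω i → PointConfig S}
    {Ω' : Type*} [MeasurableSpace Ω'] {P' : Measure Ω'} [IsProbabilityMeasure P']
    {ζ : Ω' → PointConfig S}
    (hξ : ∀ i (f : C_c(S, ℝ)), AEMeasurable (fun ω => ∫ x, f x ∂(ξ i ω).toMeasure) (P i))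
    (hζ : ∀ f : C_c(S, ℝ), AEMeasurable (fun ω => ∫ x, f x ∂(ζ ω).toMeasure) P')
    (h : ∀ f : C_c(S, ℝ), Tendsto
      (fun i => ∫ ω, Complex.exp ((∫ x, f x ∂(ξ i ω).toMeasure : ℝ) * Complex.I) ∂P i) l
      (𝓝 (∫ ω, Complex.exp ((∫ x, f x ∂(ζ ω).toMeasure : ℝ) * Complex.I) ∂P'))) :
    TendstoInDistribution ξ l ζ P P' := by
  have hξm := fun i => aemeasurable_of_integral (hξ i)
  have hζm := aemeasurable_of_integral hζ
  -- A countably generated filter allows restriction to sequences, where the liminf criterion and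
  -- Lévy's theorem apply.
  refine ⟨hξm, hζm, tendsto_of_seq_tendsto fun u hu =>
    tendsto_of_forall_isOpen_le_liminf' fun U hU => ?_⟩
  obtain ⟨F, hF⟩ := exists_cylinder_exhaustion (S := S)
  obtain ⟨W, hWo, hWm, rfl⟩ := hF U hU
  simp only [ProbabilityMeasure.coe_mk]
  -- The limit mass of `U` is the supremum over the cylinders, so a lower bound for each cylinder
  -- suffices.
  rw [hWm.measure_iUnion]
  refine iSup_le fun k => le_trans ?_ (liminf_le_liminf
    (.of_forall fun n => measure_mono (Set.subset_iUnion _ k)))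
  have hc := (continuous_integralVector F k).measurable
  have : ∀ n, IsProbabilityMeasure ((P n).map (ξ n)) := fun n =>
    Measure.isProbabilityMeasure_map (hξm n)
  have : IsProbabilityMeasure (P'.map ζ) := Measure.isProbabilityMeasure_map hζm
  have key : Tendsto (β := ProbabilityMeasure (EuclideanSpace ℝ (Fin k)))
      (fun n => ⟨((P (u n)).map (ξ (u n))).map (integralVector F k),
        Measure.isProbabilityMeasure_map hc.aemeasurable⟩) atTop
      (𝓝 ⟨(P'.map ζ).map (integralVector F k),
        Measure.isProbabilityMeasure_map hc.aemeasurable⟩) := by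
    refine ProbabilityMeasure.tendsto_of_tendsto_charFun fun t => ?_
    simp only [ProbabilityMeasure.coe_mk]
    simp_rw [charFun_map_integralVector (hξm _), charFun_map_integralVector hζm]
    exact (h _).comp hu
  have := ProbabilityMeasure.le_liminf_measure_open_of_tendsto key (hWo k)
  simp only [ProbabilityMeasure.coe_mk, Measure.map_apply hc (hWo k).measurableSet] at this
  exact this

end SecondCountable

end PointConfig

/-! ### Counting points and generating functionals of Poisson processes. -/

namespace PointConfig

variable {S : Type*} [TopologicalSpace S] [MeasurableSpace S]

/-- The number of points of a configuration in a set. -/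
def count (ξ : PointConfig S) (B : Set S) : ℕ := ⌊(ξ.toMeasure B).toReal⌋₊

theorem cast_count (ξ : PointConfig S) {B : Set S} (hB : MeasurableSet B)
    (h : ξ.toMeasure B < ∞) : (ξ.count B : ℝ) = (ξ.toMeasure B).toReal := by
  rcases ξ.integer_valued B hB with h' | ⟨k, hk⟩
  · exact absurd h' h.ne
  · simp [count, hk]

theorem toMeasure_ofFamily_apply {ι : Type*} (s : Finset ι) (x : ι → S) {B : Set S}
    (hB : MeasurableSet B) [DecidablePred (· ∈ B)] :
    (ofFamily s x).toMeasure B = (s.filter fun i => x i ∈ B).card := by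
  change (∑ i ∈ s, Measure.dirac (x i)) B = _
  rw [Measure.finsetSum_apply, Finset.card_filter, Nat.cast_sum]
  refine Finset.sum_congr rfl fun i _ => ?_
  rw [Measure.dirac_apply' _ hB]
  by_cases h : x i ∈ B <;> simp [h]

theorem count_ofFamily {ι : Type*} (s : Finset ι) (x : ι → S) {B : Set S}
    (hB : MeasurableSet B) [DecidablePred (· ∈ B)] :
    (ofFamily s x).count B = (s.filter fun i => x i ∈ B).card := by
  simp [count, toMeasure_ofFamily_apply s x hB]

theorem integral_ofFamily {ι : Type*} (s : Finset ι) (x : ι → S) {f : S → ℝ}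
    (hf : StronglyMeasurable f) : ∫ y, f y ∂(ofFamily s x).toMeasure = ∑ i ∈ s, f (x i) := by
  change ∫ y, f y ∂(∑ i ∈ s, Measure.dirac (x i)) = _
  rw [integral_finsetSum_measure fun i _ => integrable_dirac' hf (by simp)]
  exact Finset.sum_congr rfl fun i _ => integral_dirac' _ _ hf

end PointConfig

theorem integral_pow_poissonMeasure (r : ℝ≥0) (c : ℂ) :
    ∫ k : ℕ, c ^ k ∂poissonMeasure r = Complex.exp (r * (c - 1)) := by
  rw [integral_poissonMeasure]
  have h := (NormedSpace.expSeries_div_hasSum_exp (𝔸 := ℂ) (r * c)).mul_left (Complex.exp (-r))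
  rw [← Complex.exp_eq_exp_ℂ, ← Complex.exp_add] at h
  have h' := h.tsum_eq
  rw [show -(r : ℂ) + r * c = r * (c - 1) by ring] at h'
  rw [← h']
  refine tsum_congr fun k => ?_
  simp only [Complex.real_smul]
  push_cast
  rw [mul_pow]
  ring

/-- The transformation `Φ` is kept apart from `g` so that the level sets of one simple function
serve both the random exponent (`Φ c = c`) and the intensity integral of `Φ c - 1`. -/
theorem setIntegral_comp_simpleFunc {S T : Type*} [MeasurableSpace S] {μ : Measure S} {K : Set S}
    (hμK : μ K < ∞) (g : SimpleFunc S T) {V : Type*} [NormedAddCommGroup V] [NormedSpace ℝ V]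
    [CompleteSpace V] (Φ : T → V) :
    ∫ x in K, Φ (g x) ∂μ = ∑ c ∈ g.range, (μ (g ⁻¹' {c} ∩ K)).toReal • Φ c := by
  have : IsFiniteMeasure (μ.restrict K) := ⟨by simpa using hμK⟩
  have h : ∀ x, Φ (g x) = ∑ c ∈ g.range, (g ⁻¹' {c}).indicator (fun _ => Φ c) x := by
    intro x
    rw [Finset.sum_eq_single (g x)]
    · simp
    · intro c _ hc
      exact Set.indicator_of_notMem (fun hx => hc hx.symm) _
    · exact fun hx => absurd (g.mem_range_self x) hx
  simp_rw [h]
  rw [integral_finsetSum]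
  · refine Finset.sum_congr rfl fun c _ => ?_
    rw [integral_indicator_const _ (g.measurableSet_preimage _), measureReal_def,
      Measure.restrict_apply (g.measurableSet_preimage _)]
  · exact fun c _ => (integrable_const _).indicator (g.measurableSet_preimage _)

namespace IsPoissonProcess

variable {S : Type*} [TopologicalSpace S] [MeasurableSpace S] {Ω : Type*} [MeasurableSpace Ω]
  {P : Measure Ω} {η : Ω → PointConfig S} {μ : Measure S}

theorem aemeasurable_pow_count (h : IsPoissonProcess P η μ) {B : Set S} (hB : MeasurableSet B)
    (hμ : μ B < ∞) (c : ℂ) : AEMeasurable (fun ω => c ^ (η ω).count B) P := by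
  have hm : Measurable fun x : ℝ≥0∞ => c ^ ⌊x.toReal⌋₊ :=
    (measurable_from_nat (f := fun k => c ^ k)).comp
      (Nat.measurable_floor.comp ENNReal.measurable_toReal)
  exact hm.comp_aemeasurable (h.law_count B hB hμ).aemeasurable

theorem integral_pow_count (h : IsPoissonProcess P η μ) {B : Set S} (hB : MeasurableSet B)
    (hμ : μ B < ∞) (c : ℂ) :
    ∫ ω, c ^ (η ω).count B ∂P = Complex.exp ((μ B).toReal * (c - 1)) := by
  have hm : Measurable fun x : ℝ≥0∞ => c ^ ⌊x.toReal⌋₊ :=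
    (measurable_from_nat (f := fun k => c ^ k)).comp
      (Nat.measurable_floor.comp ENNReal.measurable_toReal)
  have hl := h.law_count B hB hμ
  have := integral_map (f := fun x : ℝ≥0∞ => c ^ ⌊x.toReal⌋₊) hl.aemeasurable
    hm.aestronglyMeasurable
  rw [hl.map_eq, integral_map measurable_from_nat.aemeasurable hm.aestronglyMeasurable] at this
  simp only [PointConfig.count]
  rw [← this]
  simpa [ENNReal.toReal] using integral_pow_poissonMeasure (μ B).toNNReal c

/-- The generating functional of a Poisson process at a simple function. -/
theorem integral_prod_pow_count (h : IsPoissonProcess P η μ) {K : Set S} (hK : MeasurableSet K)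
    (hμK : μ K < ∞) {T : Type*} (g : SimpleFunc S T) (Φ : T → ℂ) :
    ∫ ω, ∏ c ∈ g.range, Φ c ^ (η ω).count (g ⁻¹' {c} ∩ K) ∂P
      = Complex.exp (∫ x in K, (Φ (g x) - 1) ∂μ) := by
  classical
  rw [setIntegral_comp_simpleFunc hμK g (fun c => Φ c - 1)]
  -- Independence of counts is postulated for families indexed by `Fin n`, so the level sets are
  -- enumerated.
  let e := g.range.equivFin.symm
  let B : Fin g.range.card → Set S := fun i => g ⁻¹' {(e i : T)} ∩ K
  have hB : ∀ i, MeasurableSet (B i) := fun i => (g.measurableSet_preimage _).inter hK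
  have hBK : ∀ i, μ (B i) < ∞ := fun i => (measure_mono Set.inter_subset_right).trans_lt hμK
  have hd : Pairwise fun i j => Disjoint (B i) (B j) := by
    intro i j hij
    refine Set.disjoint_left.2 fun x hx hx' => hij (e.injective (Subtype.ext ?_))
    exact hx.1.symm.trans hx'.1
  have hi := h.indep_count _ B hB hd
  have hm : ∀ c : ℂ, Measurable fun x : ℝ≥0∞ => c ^ ⌊x.toReal⌋₊ := fun c =>
    (measurable_from_nat (f := fun k => c ^ k)).comp
      (Nat.measurable_floor.comp ENNReal.measurable_toReal)
  have key := hi.integral_fun_prod_comp (f := fun i x => Φ (e i) ^ ⌊x.toReal⌋₊)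
    (fun i => (h.law_count (B i) (hB i) (hBK i)).aemeasurable)
    (fun i => (hm _).aestronglyMeasurable)
  have h1 : ∀ ω, ∏ c ∈ g.range, Φ c ^ (η ω).count (g ⁻¹' {c} ∩ K)
      = ∏ i, Φ (e i) ^ ⌊((η ω).toMeasure (B i)).toReal⌋₊ := by
    intro ω
    rw [← Finset.prod_coe_sort]
    exact (Fintype.prod_equiv e _ _ fun i => rfl).symm
  have h2 : ∑ c ∈ g.range, (μ (g ⁻¹' {c} ∩ K)).toReal • (Φ c - 1)
      = ∑ i, ((μ (B i)).toReal * (Φ (e i) - 1) : ℂ) := by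
    rw [← Finset.sum_coe_sort]
    exact (Fintype.sum_equiv e _ _ fun i => by simp [B]).symm
  simp_rw [h1]
  rw [key, h2, Complex.exp_sum]
  exact Finset.prod_congr rfl fun i _ => h.integral_pow_count (hB i) (hBK i) _

theorem aemeasurable_prod_pow_count (h : IsPoissonProcess P η μ) {K : Set S}
    (hK : MeasurableSet K) (hμK : μ K < ∞) {T : Type*} (g : SimpleFunc S T) (Φ : T → ℂ) :
    AEMeasurable (fun ω => ∏ c ∈ g.range, Φ c ^ (η ω).count (g ⁻¹' {c} ∩ K)) P :=
  Finset.aemeasurable_fun_prod _ fun _ _ =>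
    h.aemeasurable_pow_count ((g.measurableSet_preimage _).inter hK)
      ((measure_mono Set.inter_subset_right).trans_lt hμK) _

/-- Passage to the limit in the generating functional of a Poisson process. -/
theorem integral_eq_exp_of_tendsto [IsProbabilityMeasure P] (h : IsPoissonProcess P η μ)
    {K : Set S} (hK : MeasurableSet K) (hμK : μ K < ∞) {T : Type*} (g : ℕ → SimpleFunc S T)
    (Φ : T → ℂ) (hΦ : ∀ k x, ‖Φ (g k x)‖ ≤ 1) (hΦm : ∀ k, Measurable fun x => Φ (g k x))
    {φ : S → ℂ} (hφ : ∀ x, Tendsto (fun k => Φ (g k x)) atTop (𝓝 (φ x)))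
    {G : Ω → ℂ} (hG : ∀ ω, Tendsto
      (fun k => ∏ c ∈ (g k).range, Φ c ^ (η ω).count (g k ⁻¹' {c} ∩ K)) atTop (𝓝 (G ω))) :
    ∫ ω, G ω ∂P = Complex.exp (∫ x in K, (φ x - 1) ∂μ) := by
  have : IsFiniteMeasure (μ.restrict K) := ⟨by simpa using hμK⟩
  have h1 : Tendsto (fun k => ∫ ω, ∏ c ∈ (g k).range, Φ c ^ (η ω).count (g k ⁻¹' {c} ∩ K) ∂P)
      atTop (𝓝 (∫ ω, G ω ∂P)) := by
    refine tendsto_integral_of_dominated_convergence (fun _ => 1)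
      (fun k => (h.aemeasurable_prod_pow_count hK hμK (g k) Φ).aestronglyMeasurable)
      (integrable_const _) (fun k => .of_forall fun ω => ?_) (.of_forall hG)
    rw [norm_prod]
    refine Finset.prod_le_one (fun c _ => norm_nonneg _) fun c hc => ?_
    obtain ⟨x, rfl⟩ := SimpleFunc.mem_range.1 hc
    rw [norm_pow]
    exact pow_le_one₀ (norm_nonneg _) (hΦ k x)
  have h2 : Tendsto (fun k => Complex.exp (∫ x in K, (Φ (g k x) - 1) ∂μ)) atTop
      (𝓝 (Complex.exp (∫ x in K, (φ x - 1) ∂μ))) := by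
    refine (Complex.continuous_exp.tendsto _).comp ?_
    refine tendsto_integral_of_dominated_convergence (fun _ => 2)
      (fun k => ((hΦm k).sub_const 1).aestronglyMeasurable)
      (integrable_const _) (fun k => .of_forall fun x => ?_)
      (.of_forall fun x => (hφ x).sub_const 1)
    calc ‖Φ (g k x) - 1‖ ≤ ‖Φ (g k x)‖ + ‖(1 : ℂ)‖ := norm_sub_le _ _
      _ ≤ 2 := by rw [norm_one]; linarith [hΦ k x]
  refine tendsto_nhds_unique h1 (h2.congr fun k => ?_)
  exact (h.integral_prod_pow_count hK hμK (g k) Φ).symm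

/-- The generating functional of a finite Poisson process given by a finite family of points. -/
theorem integral_prod_ofFamily [IsProbabilityMeasure P] {N : Ω → ℕ} {x : ℕ → Ω → S}
    (h : IsPoissonProcess P
      (fun ω => PointConfig.ofFamily (Finset.range (N ω)) fun i => x i ω) μ)
    [IsFiniteMeasure μ] {φ : S → ℂ} (hφ : Measurable φ) (hφ1 : ∀ y, ‖φ y‖ ≤ 1) :
    ∫ ω, ∏ i ∈ Finset.range (N ω), φ (x i ω) ∂P = Complex.exp (∫ y, (φ y - 1) ∂μ) := by
  classical
  -- Approximating inside the closed unit ball keeps all products bounded by `1`. General complex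
  -- values are needed because `φ` will be an average of `exp(i f)` over the noise.
  have h0 : (0 : ℂ) ∈ Metric.closedBall (0 : ℂ) 1 := by simp
  have hlim : ∀ y, Tendsto (fun k => SimpleFunc.approxOn φ hφ _ 0 h0 k y) atTop (𝓝 (φ y)) :=
    fun y => SimpleFunc.tendsto_approxOn hφ h0 (subset_closure (by simpa using hφ1 y))
  have := h.integral_eq_exp_of_tendsto (K := Set.univ) .univ (measure_lt_top _ _)
    (fun k => SimpleFunc.approxOn φ hφ _ 0 h0 k) id
    (fun k y => by simpa using SimpleFunc.approxOn_mem hφ h0 k y)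
    (fun k => (SimpleFunc.approxOn φ hφ _ 0 h0 k).measurable) hlim
    (G := fun ω => ∏ i ∈ Finset.range (N ω), φ (x i ω)) ?_
  · simpa using this
  · intro ω
    refine (tendsto_finsetProd _ fun i _ => hlim (x i ω)).congr fun k => ?_
    set g := SimpleFunc.approxOn φ hφ _ 0 h0 k
    -- Grouping the points by the value of `g` turns the product over points into a product of
    -- powers of counts.
    rw [← Finset.prod_fiberwise_of_maps_to (t := g.range) (g := fun i => g (x i ω))
      (fun i _ => g.mem_range_self _)]
    refine Finset.prod_congr rfl fun c _ => ?_
    rw [PointConfig.count_ofFamily _ _ ((g.measurableSet_preimage _).inter .univ),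
      Finset.prod_congr rfl (g := fun _ => c) fun i hi => (Finset.mem_filter.1 hi).2,
      Finset.prod_const]
    simp

/-- The characteristic functional of a Poisson process. -/
theorem integral_exp_integral [OpensMeasurableSpace S] [T2Space S]
    [IsProbabilityMeasure P] [IsFiniteMeasureOnCompacts μ] (h : IsPoissonProcess P η μ)
    (f : C_c(S, ℝ)) :
    ∫ ω, Complex.exp ((∫ x, f x ∂(η ω).toMeasure : ℝ) * Complex.I) ∂P
      = Complex.exp (∫ x, (Complex.exp (f x * Complex.I) - 1) ∂μ) := by
  have hf : Measurable f := f.continuous.measurable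
  set K := tsupport f
  have hKc : IsCompact K := f.hasCompactSupport
  have hf0 : ∀ x ∉ K, f x = 0 := fun x hx => image_eq_zero_of_notMem_tsupport hx
  have hlim : ∀ y, Tendsto
      (fun k => SimpleFunc.approxOn f hf Set.univ 0 (Set.mem_univ _) k y) atTop (𝓝 (f y)) :=
    fun y => SimpleFunc.tendsto_approxOn hf _ (by simp)
  have hexp : Continuous fun c : ℝ => Complex.exp (c * Complex.I) := by fun_prop
  rw [← setIntegral_eq_integral_of_forall_compl_eq_zero (s := K) (f := fun x =>
    Complex.exp (f x * Complex.I) - 1) fun x hx => by simp [hf0 x hx]]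
  -- The simple functions approximate `f` rather than `exp(i f)`: for each `ω` the exponent then
  -- converges by dominated convergence against `η ω`, which is finite on the support of `f`.
  refine h.integral_eq_exp_of_tendsto hKc.measurableSet hKc.measure_lt_top
    (fun k => SimpleFunc.approxOn f hf Set.univ 0 (Set.mem_univ _) k)
    (fun c => Complex.exp (c * Complex.I)) (fun k x => (Complex.norm_exp_ofReal_mul_I _).le)
    (fun k => hexp.measurable.comp (SimpleFunc.measurable _))
    (fun x => (hexp.tendsto _).comp (hlim x)) fun ω => ?_
  have hηK : (η ω).toMeasure K < ∞ := (η ω).finite_on_compacts K hKc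
  have key : Tendsto (fun k => ∫ x in K,
      SimpleFunc.approxOn f hf Set.univ 0 (Set.mem_univ _) k x ∂(η ω).toMeasure) atTop
      (𝓝 (∫ x, f x ∂(η ω).toMeasure)) := by
    rw [← setIntegral_eq_integral_of_forall_compl_eq_zero (s := K) hf0]
    have hint := ((η ω).integrable_compactlySupported f).restrict (s := K)
    refine tendsto_integral_of_dominated_convergence (fun x => ‖f x‖ + ‖f x‖)
      (fun k => (SimpleFunc.measurable _).aestronglyMeasurable)
      (hint.norm.add hint.norm) (fun k => .of_forall fun x => ?_) (.of_forall hlim)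
    exact SimpleFunc.norm_approxOn_zero_le hf _ x k
  refine ((hexp.tendsto _).comp key).congr fun k => ?_
  set g := SimpleFunc.approxOn f hf Set.univ 0 (Set.mem_univ _) k
  have := setIntegral_comp_simpleFunc hηK g (fun c => c)
  simp only [Function.comp_apply]
  rw [this, Complex.ofReal_sum, Finset.sum_mul, Complex.exp_sum]
  refine Finset.prod_congr rfl fun c _ => ?_
  have hc := (η ω).cast_count ((g.measurableSet_preimage {c}).inter hKc.measurableSet)
    ((measure_mono Set.inter_subset_right).trans_lt hηK)
  rw [← Complex.exp_nat_mul, ← hc]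
  congr 1
  simp
  ring

theorem aemeasurable_integral [OpensMeasurableSpace S] (h : IsPoissonProcess P η μ)
    (f : C_c(S, ℝ)) : AEMeasurable (fun ω => ∫ x, f x ∂(η ω).toMeasure) P := by
  have hf : Measurable f := f.continuous.measurable
  simp_rw [fun ω => integral_eq_lintegral_pos_part_sub_lintegral_neg_part
    ((η ω).integrable_compactlySupported f)]
  have hm : ∀ g : S → ℝ≥0∞, Measurable g →
      AEMeasurable (fun ω => (∫⁻ x, g x ∂(η ω).toMeasure).toReal) P := fun g hg =>
    ENNReal.measurable_toReal.comp_aemeasurable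
      ((Measure.measurable_lintegral hg).comp_aemeasurable h.aemeasurable)
  exact (hm _ hf.ennreal_ofReal).sub (hm _ hf.neg.ennreal_ofReal)

end IsPoissonProcess

/-! ### Expectations of products over independent points and marks. -/

section Independence

variable {D : Type*} [MeasurableSpace D] {Ω : Type*} [MeasurableSpace Ω] {P : Measure Ω}

/-- The expectation of a product over independent pairs, each with independent components. -/
theorem integral_prod_pair_of_iIndepFun {n : ℕ}
    {Y Z : Fin n → Ω → D} {ρ β : Measure D} [IsProbabilityMeasure ρ] [IsProbabilityMeasure β]
    (hY : ∀ i, HasLaw (Y i) ρ P) (hZ : ∀ i, HasLaw (Z i) β P)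
    (hind : iIndepFun (Sum.elim Y Z : Fin n ⊕ Fin n → Ω → D) P)
    {h : D → D → ℂ} (hm : Measurable (Function.uncurry h)) (hb : ∀ x z, ‖h x z‖ ≤ 1) :
    ∫ ω, ∏ i, h (Y i ω) (Z i ω) ∂P = (∫ x, ∫ z, h x z ∂β ∂ρ) ^ n := by
  have hae : ∀ i, AEMeasurable ((Sum.elim Y Z : Fin n ⊕ Fin n → Ω → D) i) P := by
    rintro (i | i)
    exacts [(hY i).aemeasurable, (hZ i).aemeasurable]
  let M : Fin n ⊕ Fin n → Measure D := Sum.elim (fun _ => ρ) fun _ => β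
  have hM : ∀ i, P.map ((Sum.elim Y Z : Fin n ⊕ Fin n → Ω → D) i) = M i := by
    rintro (i | i)
    exacts [(hY i).map_eq, (hZ i).map_eq]
  have : ∀ i, IsProbabilityMeasure (M i) := by
    rintro (i | i) <;> (simp only [M, Sum.elim_inl, Sum.elim_inr]; infer_instance)
  have hpi := hind.map_fun_eq_pi_map hae
  simp_rw [hM] at hpi
  let F : (Fin n → D) × (Fin n → D) → ℂ := fun p => ∏ i, h (p.1 i) (p.2 i)
  have hF : Measurable F := by
    refine Finset.measurable_fun_prod _ fun i _ => hm.comp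
      (f := fun p : (Fin n → D) × (Fin n → D) => (p.1 i, p.2 i)) ?_
    fun_prop
  have hmp := measurePreserving_sumPiEquivProdPi M
  have h1 : ∫ ω, ∏ i, h (Y i ω) (Z i ω) ∂P
      = ∫ y, F (MeasurableEquiv.sumPiEquivProdPi (fun _ => D) y) ∂Measure.pi M := by
    rw [← hpi, integral_map
      (f := fun y => F (MeasurableEquiv.sumPiEquivProdPi (fun _ => D) y))
      (aemeasurable_pi_lambda _ hae)
      (hF.comp (MeasurableEquiv.measurable _)).aestronglyMeasurable]
    rfl
  rw [h1, hmp.integral_comp (MeasurableEquiv.measurableEmbedding _) F]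
  simp only [M, Sum.elim_inl, Sum.elim_inr]
  rw [integral_prod]
  · have : ∀ x : Fin n → D, ∫ z, F (x, z) ∂Measure.pi (fun _ : Fin n => β)
        = ∏ i, ∫ z, h (x i) z ∂β := fun x =>
      integral_fintype_prod_eq_prod (fun i z => h (x i) z)
    simp_rw [this]
    rw [integral_fintype_prod_eq_prod (fun (_ : Fin n) x => ∫ z, h x z ∂β)]
    simp
  · refine Integrable.of_bound hF.aestronglyMeasurable 1 (.of_forall fun p => ?_)
    rw [norm_prod]
    exact Finset.prod_le_one (fun _ _ => norm_nonneg _) fun i _ => hb _ _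

theorem measurable_comp_nat {α β : Type*} [MeasurableSpace α] [MeasurableSpace β] {N : α → ℕ}
    (hN : Measurable N) {G : ℕ → α → β} (hG : ∀ k, Measurable (G k)) :
    Measurable fun a => G (N a) a :=
  (measurable_from_prod_countable_right (f := fun p : ℕ × α => G p.1 p.2) hG).comp
    (hN.prodMk measurable_id)

/-- The expectation of a product over a random number of points with independent marks. -/
theorem integral_prod_marks {A : Type*} [MeasurableSpace A] [IsProbabilityMeasure P]
    {N : Ω → ℕ} {x : ℕ → Ω → A} {e : ℕ → Ω → D} {β : Measure D}
    (hN : AEMeasurable N P) (hx : ∀ i, AEMeasurable (x i) P)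
    (he : ∀ i, HasLaw (e i) β P) (hie : iIndepFun e P)
    (hind : IndepFun (fun ω => (N ω, fun i => x i ω)) (fun ω i => e i ω) P)
    {h : A → D → ℂ} (hm : Measurable (Function.uncurry h)) (hb : ∀ x z, ‖h x z‖ ≤ 1) :
    ∫ ω, ∏ i ∈ Finset.range (N ω), h (x i ω) (e i ω) ∂P
      = ∫ ω, ∏ i ∈ Finset.range (N ω), ∫ z, h (x i ω) z ∂β ∂P := by
  have : IsProbabilityMeasure β := (he 0).isProbabilityMeasure_iff.1 inferInstance
  have haeN : AEMeasurable (fun ω => (N ω, fun i => x i ω)) P :=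
    hN.prodMk (aemeasurable_pi_lambda _ hx)
  have haee : AEMeasurable (fun ω i => e i ω) P :=
    aemeasurable_pi_lambda _ fun i => (he i).aemeasurable
  let F : (ℕ × (ℕ → A)) × (ℕ → D) → ℂ :=
    fun p => ∏ i ∈ Finset.range p.1.1, h (p.1.2 i) (p.2 i)
  have hF : Measurable F := by
    refine measurable_comp_nat (N := fun p : (ℕ × (ℕ → A)) × (ℕ → D) => p.1.1) (by fun_prop)
      (G := fun k p => ∏ i ∈ Finset.range k, h (p.1.2 i) (p.2 i)) fun k => ?_
    refine Finset.measurable_fun_prod _ fun i _ => hm.comp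
      (f := fun p : (ℕ × (ℕ → A)) × (ℕ → D) => (p.1.2 i, p.2 i)) ?_
    fun_prop
  have hFb : ∀ p, ‖F p‖ ≤ 1 := fun p => by
    rw [norm_prod]
    exact Finset.prod_le_one (fun _ _ => norm_nonneg _) fun i _ => hb _ _
  have : IsProbabilityMeasure (P.map fun ω => (N ω, fun i => x i ω)) :=
    Measure.isProbabilityMeasure_map haeN
  have : IsProbabilityMeasure (P.map fun ω i => e i ω) :=
    Measure.isProbabilityMeasure_map haee
  have hlaw := (indepFun_iff_map_prod_eq_prod_map_map haeN haee).1 hind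
  calc ∫ ω, ∏ i ∈ Finset.range (N ω), h (x i ω) (e i ω) ∂P
      = ∫ p, F p ∂(P.map fun ω => ((N ω, fun i => x i ω), fun i => e i ω)) := by
        rw [integral_map (haeN.prodMk haee) hF.aestronglyMeasurable]
    _ = ∫ p, ∫ q, F (p, q) ∂(P.map fun ω i => e i ω) ∂(P.map fun ω => (N ω, fun i => x i ω)) := by
        rw [hlaw, integral_prod]
        exact Integrable.of_bound hF.aestronglyMeasurable 1 (.of_forall hFb)
    _ = ∫ p : ℕ × (ℕ → A), ∏ i ∈ Finset.range p.1, ∫ z, h (p.2 i) z ∂β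
          ∂(P.map fun ω => (N ω, fun i => x i ω)) := by
        congr 1 with p
        rw [integral_map (f := fun q => F (p, q)) haee (hF.comp measurable_prodMk_left).aestronglyMeasurable]
        -- With the points and their number frozen, only finitely many noises occur, and their
        -- independence factorises the inner integral.
        have hsub := hie.precomp (g := fun i : Finset.range p.1 => (i : ℕ))
          Subtype.val_injective
        have := iIndepFun.integral_fun_prod_comp (ι := Finset.range p.1)
          (X := fun i => e i) (f := fun i z => h (p.2 i) z) hsub
          (fun i => (he i).aemeasurable)
          (fun i => (hm.comp measurable_prodMk_left).aestronglyMeasurable)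
        simp only [F]
        rw [← Finset.prod_coe_sort]
        simp_rw [← Finset.prod_coe_sort (Finset.range p.1) (fun i => h (p.2 i) (e i _))]
        rw [this]
        refine Finset.prod_congr rfl fun i _ => ?_
        exact (he i).integral_comp
          (hm.comp (measurable_prodMk_left (x := p.2 i))).aestronglyMeasurable
    _ = _ := by
        rw [integral_map haeN]
        have hφ : Measurable fun y => ∫ z, h y z ∂β :=
          hm.stronglyMeasurable.integral_prod_right.measurable
        refine (measurable_comp_nat (N := fun p : ℕ × (ℕ → A) => p.1) (by fun_prop)
          (G := fun k p => ∏ i ∈ Finset.range k, ∫ z, h (p.2 i) z ∂β)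
            fun k => ?_).aestronglyMeasurable
        exact Finset.measurable_fun_prod _ fun i _ => hφ.comp (by fun_prop)

end Independence

/-! ### Reduction to the mean at a single rescaled point. -/

theorem continuous_horizontal {m : ℕ} : Continuous (horizontal : E (m + 1) → E m) :=
  (PiLp.continuous_toLp 2 _).comp (by fun_prop)

theorem measurable_sphereLog {m : ℕ} : Measurable (sphereLog : E (m + 1) → E m) := by
  have h := (continuous_horizontal (m := m)).measurable
  have h2 : Measurable fun y : E (m + 1) => y (Fin.last m) := by fun_prop
  exact ((Real.continuous_arccos.measurable.comp h2).div h.norm).smul h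

theorem measurable_scalingTransform {m : ℕ} (lam α : ℝ) :
    Measurable (scalingTransform m lam α) := by
  have h : Measurable fun x : E (m + 1) => ‖x‖⁻¹ • x := by fun_prop
  refine ((measurable_sphereLog.comp h).const_smul (scalingFactor (m + 1) lam α)).prodMk ?_
  exact measurable_real_toNNReal.comp (by fun_prop)

theorem kappa_pos (k : ℕ) : 0 < kappa k := by
  rw [kappa, measureReal_def]
  exact ENNReal.toReal_pos (Metric.measure_ball_pos _ _ one_pos).ne' measure_ball_lt_top.ne

theorem isProbabilityMeasure_ballUniform (k : ℕ) {r : ℝ} (hr : 0 < r) :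
    IsProbabilityMeasure (ballUniform k r) :=
  cond_isProbabilityMeasure_of_finite
    (Metric.measure_closedBall_pos volume (0 : E k) hr).ne' measure_closedBall_lt_top.ne

instance (m : ℕ) : IsProbabilityMeasure (sphereUniform m) :=
  cond_isProbabilityMeasure (Measure.measure_univ_ne_zero.2 (Measure.toSphere_ne_zero _))

theorem integral_sphereUniform (m : ℕ) {V : Type*} [NormedAddCommGroup V] [NormedSpace ℝ V]
    (f : Sph m → V) : ∫ y, f y ∂sphereUniform m
      = (((m + 1 : ℕ) : ℝ) * kappa (m + 1))⁻¹ •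
        ∫ y, f y ∂(volume : Measure (E (m + 1))).toSphere := by
  rw [sphereUniform, ProbabilityTheory.cond, Measure.restrict_univ, integral_smul_measure]
  congr 1
  have := Measure.toSphere_real_apply_univ (volume : Measure (E (m + 1)))
  rw [measureReal_def, finrank_euclideanSpace_fin] at this
  rw [ENNReal.toReal_inv, this, kappa]

/-- The mean of `g` at the rescaled perturbed point. -/
def transformMean (m : ℕ) (lam α : ℝ) (g : E m × ℝ≥0 → ℂ) : ℂ :=
  ∫ x : Sph m, ∫ z, g (scalingTransform m lam α ((x : E (m + 1)) + z))
    ∂ballUniform (m + 1) (lam ^ α) ∂sphereUniform m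

theorem transformMean_sub_one (m : ℕ) {lam : ℝ} (hlam : 0 < lam) (α : ℝ) {g : E m × ℝ≥0 → ℂ}
    (hg : Measurable g) (hb : ∀ p, ‖g p‖ ≤ 1) :
    transformMean m lam α (fun p => g p - 1) = transformMean m lam α g - 1 := by
  have := isProbabilityMeasure_ballUniform (m + 1) (Real.rpow_pos_of_pos hlam α)
  have hm : Measurable fun p : Sph m × E (m + 1) =>
      g (scalingTransform m lam α ((p.1 : E (m + 1)) + p.2)) :=
    hg.comp ((measurable_scalingTransform lam α).comp (by fun_prop))
  have h1 : ∀ x : Sph m, ∫ z, (g (scalingTransform m lam α ((x : E (m + 1)) + z)) - 1)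
      ∂ballUniform (m + 1) (lam ^ α) = ∫ z, g (scalingTransform m lam α ((x : E (m + 1)) + z))
      ∂ballUniform (m + 1) (lam ^ α) - 1 := by
    intro x
    rw [integral_sub _ (integrable_const _)]
    · simp
    · exact Integrable.of_bound (hm.comp measurable_prodMk_left).aestronglyMeasurable 1
        (.of_forall fun _ => hb _)
  simp only [transformMean, h1]
  rw [integral_sub _ (integrable_const _)]
  · simp
  · refine Integrable.of_bound
      hm.stronglyMeasurable.integral_prod_right.aestronglyMeasurable 1 (.of_forall fun x => ?_)
    refine (norm_integral_le_of_norm_le_const (.of_forall fun _ => hb _)).trans ?_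
    simp

theorem integral_ofFamily_compactlySupported {m : ℕ} {ι : Type*} (s : Finset ι)
    (x : ι → E m × ℝ≥0) (f : C_c(E m × ℝ≥0, ℝ)) :
    ∫ p, f p ∂(PointConfig.ofFamily s x).toMeasure = ∑ i ∈ s, f (x i) :=
  PointConfig.integral_ofFamily s x f.continuous.stronglyMeasurable

section Reduction

variable {m : ℕ} {Ω : Type*} [MeasurableSpace Ω] {P : Measure Ω}

/-- Independence makes the functional the `n`-th power of a one-point mean. Splitting off `1` leaves
a compactly supported integrand and prepares the limit `(1 + a_n)^n → e^a` for `n a_n → a`. -/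
theorem integral_exp_rescaledBinomial [IsProbabilityMeasure P] {n : ℕ} (hn : 0 < n) {α : ℝ}
    {X : Fin n → Ω → Sph m} {e : Fin n → Ω → E (m + 1)} (h : IsBinomialInput n α P X e)
    (f : C_c(E m × ℝ≥0, ℝ)) :
    ∫ ω, Complex.exp
        ((∫ p, f p ∂(rescaledBinomial n α X e ω).toMeasure : ℝ) * Complex.I) ∂P
      = (1 + transformMean m n α fun p => Complex.exp (f p * Complex.I) - 1) ^ n := by
  have hn' : (0 : ℝ) < n := by exact_mod_cast hn
  have hβ := isProbabilityMeasure_ballUniform (m + 1) (Real.rpow_pos_of_pos hn' α)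
  have hgm : Measurable fun p => Complex.exp (f p * Complex.I) := by
    have := f.continuous
    exact (by fun_prop : Continuous fun p => Complex.exp (f p * Complex.I)).measurable
  rw [transformMean_sub_one m hn' α hgm fun p => (Complex.norm_exp_ofReal_mul_I _).le,
    add_sub_cancel]
  let k : E (m + 1) → E (m + 1) → ℂ :=
    fun x z => Complex.exp (f (scalingTransform m n α (x + z)) * Complex.I)
  have hkm : Measurable (Function.uncurry k) :=
    hgm.comp ((measurable_scalingTransform n α).comp
      (by fun_prop : Measurable fun p : E (m + 1) × E (m + 1) => p.1 + p.2))
  have hval : Measurable (Subtype.val : Sph m → E (m + 1)) := measurable_subtype_coe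
  have : IsProbabilityMeasure ((sphereUniform m).map Subtype.val) :=
    Measure.isProbabilityMeasure_map hval.aemeasurable
  have hX : ∀ i, HasLaw (fun ω => (X i ω : E (m + 1))) ((sphereUniform m).map Subtype.val) P :=
    fun i => ⟨hval.comp_aemeasurable (h.law_point i).aemeasurable, by
      rw [← (h.law_point i).map_eq, AEMeasurable.map_map_of_aemeasurable hval.aemeasurable
        (h.law_point i).aemeasurable]; rfl⟩
  have key := integral_prod_pair_of_iIndepFun hX h.law_noise h.indep hkm
    fun _ _ => (Complex.norm_exp_ofReal_mul_I _).le
  rw [integral_map hval.aemeasurable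
    hkm.stronglyMeasurable.integral_prod_right.aestronglyMeasurable] at key
  rw [transformMean, ← key]
  refine integral_congr_ae (.of_forall fun ω => ?_)
  simp only [k]
  rw [rescaledBinomial, integral_ofFamily_compactlySupported,
    Complex.ofReal_sum, Finset.sum_mul, Complex.exp_sum]

theorem aemeasurable_integral_rescaledBinomial {n : ℕ} {α : ℝ}
    {X : Fin n → Ω → Sph m} {e : Fin n → Ω → E (m + 1)} (h : IsBinomialInput n α P X e)
    (f : C_c(E m × ℝ≥0, ℝ)) :
    AEMeasurable (fun ω => ∫ p, f p ∂(rescaledBinomial n α X e ω).toMeasure) P := by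
  simp_rw [rescaledBinomial, integral_ofFamily_compactlySupported]
  refine Finset.aemeasurable_fun_sum _ fun i _ => ?_
  exact (f.continuous.measurable.comp (measurable_scalingTransform n α)).comp_aemeasurable
    ((measurable_subtype_coe.comp_aemeasurable (h.law_point i).aemeasurable).add
      (h.law_noise i).aemeasurable)

/-- Averaging over the noise first leaves a product over the Poisson points of a function of modulus
at most `1` on the sphere, to which the generating functional applies. -/
theorem integral_exp_rescaledPoisson [IsProbabilityMeasure P] {lam : ℝ} (hlam : 0 < lam) {α : ℝ}
    {N : Ω → ℕ} {x : ℕ → Ω → Sph m} {e : ℕ → Ω → E (m + 1)} (h : IsPoissonInput lam α P N x e)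
    (f : C_c(E m × ℝ≥0, ℝ)) :
    ∫ ω, Complex.exp
        ((∫ p, f p ∂(rescaledPoisson lam α N x e ω).toMeasure : ℝ) * Complex.I) ∂P
      = Complex.exp (lam * transformMean m lam α fun p => Complex.exp (f p * Complex.I) - 1) := by
  have hβ := isProbabilityMeasure_ballUniform (m + 1) (Real.rpow_pos_of_pos hlam α)
  have hgm : Measurable fun p => Complex.exp (f p * Complex.I) := by
    have := f.continuous
    exact (by fun_prop : Continuous fun p => Complex.exp (f p * Complex.I)).measurable
  let k : Sph m → E (m + 1) → ℂ :=
    fun x z => Complex.exp (f (scalingTransform m lam α ((x : E (m + 1)) + z)) * Complex.I)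
  have hkm : Measurable (Function.uncurry k) :=
    hgm.comp ((measurable_scalingTransform lam α).comp
      (by fun_prop : Measurable fun p : Sph m × E (m + 1) => (p.1 : E (m + 1)) + p.2))
  have hkb : ∀ x z, ‖k x z‖ ≤ 1 := fun _ _ => (Complex.norm_exp_ofReal_mul_I _).le
  have h1 := integral_prod_marks h.aemeasurable_card h.aemeasurable_point h.law_noise
    h.indep_noise h.indep hkm hkb
  have : IsFiniteMeasure (ENNReal.ofReal (lam / (((m + 1 : ℕ) : ℝ) * kappa (m + 1))) •
      (volume : Measure (E (m + 1))).toSphere) := Measure.smul_finite _ ENNReal.ofReal_ne_top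
  have hφm : Measurable fun y => ∫ z, k y z ∂ballUniform (m + 1) (lam ^ α) :=
    hkm.stronglyMeasurable.integral_prod_right.measurable
  have hφb : ∀ y, ‖∫ z, k y z ∂ballUniform (m + 1) (lam ^ α)‖ ≤ 1 := fun y => by
    refine (norm_integral_le_of_norm_le_const (.of_forall fun _ => hkb _ _)).trans ?_
    simp
  rw [h.poisson.integral_prod_ofFamily hφm hφb] at h1
  have hκ := kappa_pos (m + 1)
  have h2 : ∫ y, (∫ z, k y z ∂ballUniform (m + 1) (lam ^ α) - 1)
      ∂(ENNReal.ofReal (lam / (((m + 1 : ℕ) : ℝ) * kappa (m + 1))) •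
      (volume : Measure (E (m + 1))).toSphere)
      = lam * transformMean m lam α fun p => Complex.exp (f p * Complex.I) - 1 := by
    rw [transformMean_sub_one m hlam α hgm fun p => (Complex.norm_exp_ofReal_mul_I _).le,
      integral_smul_measure, ENNReal.toReal_ofReal (by positivity), transformMean]
    have h3 : ∫ y : Sph m, (∫ z, k y z ∂ballUniform (m + 1) (lam ^ α) - 1) ∂sphereUniform m
        = ∫ y : Sph m, ∫ z, k y z ∂ballUniform (m + 1) (lam ^ α) ∂sphereUniform m - 1 := by
      rw [integral_sub _ (integrable_const _)]
      · simp
      · exact Integrable.of_bound hφm.aestronglyMeasurable 1 (.of_forall hφb)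
    rw [← h3, integral_sphereUniform, div_eq_mul_inv, mul_smul, Complex.real_smul]
  rw [← h2, ← h1]
  refine integral_congr_ae (.of_forall fun ω => ?_)
  simp only [k]
  rw [rescaledPoisson, integral_ofFamily_compactlySupported,
    Complex.ofReal_sum, Finset.sum_mul, Complex.exp_sum]

theorem aemeasurable_integral_rescaledPoisson {lam : ℝ} {α : ℝ}
    {N : Ω → ℕ} {x : ℕ → Ω → Sph m} {e : ℕ → Ω → E (m + 1)} (h : IsPoissonInput lam α P N x e)
    (f : C_c(E m × ℝ≥0, ℝ)) :
    AEMeasurable (fun ω => ∫ p, f p ∂(rescaledPoisson lam α N x e ω).toMeasure) P := by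
  have h1 : Measurable fun p : Sph m × E (m + 1) =>
      f (scalingTransform m lam α ((p.1 : E (m + 1)) + p.2)) :=
    f.continuous.measurable.comp ((measurable_scalingTransform lam α).comp (by fun_prop))
  have hF : Measurable fun p : (ℕ × (ℕ → Sph m)) × (ℕ → E (m + 1)) =>
      ∑ i ∈ Finset.range p.1.1,
        f (scalingTransform m lam α ((p.1.2 i : E (m + 1)) + p.2 i)) := by
    refine measurable_comp_nat (N := fun p : (ℕ × (ℕ → Sph m)) × (ℕ → E (m + 1)) => p.1.1)
      (by fun_prop) (G := fun k p => ∑ i ∈ Finset.range k,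
        f (scalingTransform m lam α ((p.1.2 i : E (m + 1)) + p.2 i))) fun k => ?_
    exact Finset.measurable_fun_sum _ fun i _ => h1.comp
      (f := fun p : (ℕ × (ℕ → Sph m)) × (ℕ → E (m + 1)) => (p.1.2 i, p.2 i)) (by fun_prop)
  have hA : AEMeasurable (fun ω => ((N ω, fun i => x i ω), fun i => e i ω)) P :=
    (h.aemeasurable_card.prodMk (aemeasurable_pi_lambda _ h.aemeasurable_point)).prodMk
      (aemeasurable_pi_lambda _ fun i => (h.law_noise i).aemeasurable)
  refine (hF.comp_aemeasurable hA).congr (.of_forall fun ω => ?_)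
  exact (integral_ofFamily_compactlySupported _ _ f).symm

end Reduction

theorem hasCompactSupport_exp_sub_one {S : Type*} [TopologicalSpace S] (f : C_c(S, ℝ)) :
    HasCompactSupport fun p => Complex.exp (f p * Complex.I) - 1 :=
  f.hasCompactSupport.comp_left (g := fun c : ℝ => Complex.exp (c * Complex.I) - 1) (by simp)

theorem continuous_exp_sub_one {S : Type*} [TopologicalSpace S] (f : C_c(S, ℝ)) :
    Continuous fun p => Complex.exp (f p * Complex.I) - 1 := by
  have := f.continuous
  fun_prop

/-! ### Polar coordinates and the gnomonic chart of the sphere. -/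

section Polar

variable {m : ℕ}

/-- The surface measure on the unit sphere of `ℝ^{m+1}`. -/
abbrev surface (m : ℕ) : Measure (Sph m) := (volume : Measure (E (m + 1))).toSphere

theorem measurePreserving_polar (m : ℕ) :
    MeasurePreserving (homeomorphUnitSphereProd (E (m + 1)))
      ((volume : Measure (E (m + 1))).comap (↑)) ((surface m).prod (Measure.volumeIoiPow m)) := by
  have := (volume : Measure (E (m + 1))).measurePreserving_homeomorphUnitSphereProd
  rwa [finrank_euclideanSpace_fin, Nat.add_sub_cancel] at this

theorem polar_symm_apply (z : ({0}ᶜ : Set (E (m + 1)))) :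
    ((homeomorphUnitSphereProd (E (m + 1)) z).2 : ℝ) •
      ((homeomorphUnitSphereProd (E (m + 1)) z).1 : E (m + 1)) = z := by
  have hz : ‖(z : E (m + 1))‖ ≠ 0 := norm_ne_zero_iff.2 z.2
  simp [smul_smul, hz]

theorem lintegral_polar {F : E (m + 1) → ℝ≥0∞} (hF : Measurable F) :
    ∫⁻ z, F z = ∫⁻ y : Sph m, (∫⁻ ρ in Set.Ioi (0 : ℝ),
      ENNReal.ofReal (ρ ^ m) * F (ρ • (y : E (m + 1)))) ∂surface m := by
  have hG : Measurable fun p : Sph m × Set.Ioi (0 : ℝ) => F ((p.2 : ℝ) • (p.1 : E (m + 1))) :=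
    hF.comp (by fun_prop)
  calc ∫⁻ z, F z = ∫⁻ z : ({0}ᶜ : Set (E (m + 1))), F z
          ∂((volume : Measure (E (m + 1))).comap Subtype.val) := by
        rw [lintegral_subtype_comap (measurableSet_singleton _).compl,
          restrict_compl_singleton]
    _ = ∫⁻ p, F ((p.2 : ℝ) • (p.1 : E (m + 1))) ∂((surface m).prod (Measure.volumeIoiPow m)) := by
        rw [← (measurePreserving_polar m).lintegral_comp hG]
        exact lintegral_congr fun z => by rw [polar_symm_apply]
    _ = _ := by
        rw [lintegral_prod _ hG.aemeasurable]
        refine lintegral_congr fun y => ?_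
        have hGy : Measurable fun ρ : Set.Ioi (0 : ℝ) => F ((ρ : ℝ) • (y : E (m + 1))) :=
          hG.comp measurable_prodMk_left
        rw [Measure.volumeIoiPow, lintegral_withDensity_eq_lintegral_mul _ (by fun_prop) hGy]
        exact lintegral_subtype_comap measurableSet_Ioi
          (fun ρ : ℝ => ENNReal.ofReal (ρ ^ m) * F (ρ • (y : E (m + 1))))

/-- Unlike in `lintegral_polar`, the radius is the outer variable, because the weights met later
depend on the norm alone. -/
theorem integral_polar {F : E (m + 1) → ℂ} (hF : Integrable F) :
    ∫ z, F z = ∫ ρ in Set.Ioi (0 : ℝ), ρ ^ m • ∫ y : Sph m, F (ρ • (y : E (m + 1))) ∂surface m := by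
  let G : Sph m × Set.Ioi (0 : ℝ) → ℂ := fun p => F ((p.2 : ℝ) • (p.1 : E (m + 1)))
  have hcomp : ∀ z : ({0}ᶜ : Set (E (m + 1))), G (homeomorphUnitSphereProd _ z) = F z :=
    fun z => by simp only [G]; rw [polar_symm_apply]
  have hG : Integrable G ((surface m).prod (Measure.volumeIoiPow m)) := by
    rw [← (measurePreserving_polar m).integrable_comp_emb (Homeomorph.measurableEmbedding _)]
    have h : Integrable (fun z : ({0}ᶜ : Set (E (m + 1))) => F z)
        ((volume : Measure (E (m + 1))).comap Subtype.val) :=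
      (integrableOn_iff_comap_subtypeVal (measurableSet_singleton _).compl).1 hF.integrableOn
    exact h.congr (.of_forall fun z => (hcomp z).symm)
  calc ∫ z, F z = ∫ z : ({0}ᶜ : Set (E (m + 1))), F z
          ∂((volume : Measure (E (m + 1))).comap Subtype.val) := by
        rw [integral_subtype_comap (measurableSet_singleton _).compl,
          restrict_compl_singleton]
    _ = ∫ p, G p ∂((surface m).prod (Measure.volumeIoiPow m)) := by
        rw [← (measurePreserving_polar m).integral_comp (Homeomorph.measurableEmbedding _) G]
        exact integral_congr_ae (.of_forall fun z => (hcomp z).symm)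
    _ = ∫ ρ : Set.Ioi (0 : ℝ), ∫ y : Sph m, F ((ρ : ℝ) • (y : E (m + 1))) ∂surface m
          ∂Measure.volumeIoiPow m := integral_prod_symm _ hG
    _ = _ := by
        simp only [Measure.volumeIoiPow, ENNReal.ofReal]
        rw [integral_withDensity_eq_integral_smul,
          integral_subtype_comap measurableSet_Ioi fun a : ℝ => Real.toNNReal (a ^ m) •
            ∫ y : Sph m, F (a • (y : E (m + 1))) ∂surface m,
          setIntegral_congr_fun measurableSet_Ioi fun x hx => ?_]
        · rw [NNReal.smul_def, Real.coe_toNNReal _ (pow_nonneg hx.out.le _)]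
        · exact (measurable_subtype_coe.pow_const _).real_toNNReal

theorem lintegral_Ioo_pow (m : ℕ) {b : ℝ} (hb : 0 ≤ b) :
    ∫⁻ ρ in Set.Ioo 0 b, ENNReal.ofReal (ρ ^ m) = ENNReal.ofReal (b ^ (m + 1) / (m + 1)) := by
  rw [Measure.restrict_congr_set Ioo_ae_eq_Ioc,
    ← ofReal_integral_eq_lintegral_ofReal (intervalIntegral.intervalIntegrable_pow _).1,
    ← intervalIntegral.integral_of_le hb]
  · simp
  · filter_upwards [ae_restrict_mem measurableSet_Ioc] with y hy
    exact pow_nonneg hy.1.le _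

theorem lintegral_eq_pow_mul_lintegral_smul {t : ℝ} (ht : 0 < t) {f : E m → ℝ≥0∞}
    (hf : Measurable f) : ∫⁻ w, f w = ENNReal.ofReal (t ^ m) * ∫⁻ w, f (t • w) := by
  have h := lintegral_map (μ := (volume : Measure (E m))) (f := f) (g := (t • ·)) hf
    (measurable_const_smul t)
  rw [Measure.map_addHaar_smul _ ht.ne', lintegral_smul_measure, finrank_euclideanSpace_fin] at h
  rw [← h, smul_eq_mul, ← mul_assoc, ← ENNReal.ofReal_mul (by positivity),
    abs_of_pos (by positivity), mul_inv_cancel₀ (by positivity), ENNReal.ofReal_one, one_mul]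

/-- The point `(w, t)` of `ℝ^{m+1}`. -/
def appendLast (w : E m) (t : ℝ) : E (m + 1) := WithLp.toLp 2 (Fin.snoc w t)

@[simp]
theorem appendLast_last (w : E m) (t : ℝ) : appendLast w t (Fin.last m) = t := by
  simp [appendLast]

@[simp]
theorem horizontal_appendLast (w : E m) (t : ℝ) : horizontal (appendLast w t) = w := by
  ext i
  simp [appendLast, horizontal]

theorem eq_of_horizontal_of_last {x y : E (m + 1)} (h : horizontal x = horizontal y)
    (hl : x (Fin.last m) = y (Fin.last m)) : x = y := by
  ext i
  refine Fin.lastCases hl (fun j => ?_) i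
  have := congrArg (fun z : E m => z j) h
  simpa [horizontal] using this

theorem appendLast_horizontal (z : E (m + 1)) :
    appendLast (horizontal z) (z (Fin.last m)) = z :=
  eq_of_horizontal_of_last (by simp) (by simp)

theorem horizontal_smul (c : ℝ) (z : E (m + 1)) : horizontal (c • z) = c • horizontal z := by
  ext i
  simp [horizontal]

theorem smul_appendLast (c : ℝ) (w : E m) (t : ℝ) :
    c • appendLast w t = appendLast (c • w) (c * t) :=
  eq_of_horizontal_of_last (by simp [horizontal_smul]) (by simp)

theorem norm_appendLast (w : E m) (t : ℝ) : ‖appendLast w t‖ = Real.sqrt (‖w‖ ^ 2 + t ^ 2) := by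
  rw [← Real.sqrt_sq (norm_nonneg (appendLast w t)), norm_sq_eq]
  simp

theorem measurable_appendLast : Measurable fun p : E m × ℝ => appendLast p.1 p.2 := by
  have h : Measurable fun p : E m × ℝ => (Fin.snoc p.1 p.2 : Fin (m + 1) → ℝ) := by
    refine measurable_pi_lambda _ fun i => ?_
    refine Fin.lastCases ?_ (fun j => ?_) i
    · simpa using measurable_snd
    · simp only [Fin.snoc_castSucc]
      fun_prop
  exact (PiLp.continuous_toLp 2 _).measurable.comp h

theorem measurePreserving_split (m : ℕ) :
    MeasurePreserving (fun z : E (m + 1) => (z (Fin.last m), horizontal z))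
      volume ((volume : Measure ℝ).prod (volume : Measure (E m))) := by
  have h1 := PiLp.volume_preserving_ofLp (Fin (m + 1))
  have h2 := volume_preserving_piFinSuccAbove (fun _ : Fin (m + 1) => ℝ) (Fin.last m)
  have h3 := (MeasurePreserving.id (volume : Measure ℝ)).prod (PiLp.volume_preserving_toLp (Fin m))
  have h : (fun z : E (m + 1) => (z (Fin.last m), horizontal z)) =
      (Prod.map id (WithLp.toLp 2) ∘ MeasurableEquiv.piFinSuccAbove (fun _ => ℝ) (Fin.last m)) ∘
        WithLp.ofLp := by
    funext z
    refine Prod.ext (by simp) ?_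
    ext i
    simp [horizontal, Fin.init]
  rw [h]
  exact (h3.comp h2).comp h1

theorem lintegral_split {F : E (m + 1) → ℝ≥0∞} (hF : Measurable F) :
    ∫⁻ z, F z = ∫⁻ t, ∫⁻ w, F (appendLast w t) := by
  have hG : Measurable fun p : ℝ × E m => F (appendLast p.2 p.1) :=
    hF.comp (measurable_appendLast.comp measurable_swap)
  rw [← lintegral_prod _ hG.aemeasurable, ← (measurePreserving_split m).lintegral_comp hG]
  exact lintegral_congr fun z => by rw [appendLast_horizontal]

/-- The last coordinate of the central projection of `(w, 1)` to the unit sphere. -/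
def gnomonicHeight (w : E m) : ℝ := (Real.sqrt (1 + ‖w‖ ^ 2))⁻¹

/-- The central projection of `(w, 1)` to the unit sphere. -/
def gnomonic (w : E m) : E (m + 1) := gnomonicHeight w • appendLast w 1

theorem gnomonicHeight_pos (w : E m) : 0 < gnomonicHeight w := by
  unfold gnomonicHeight
  positivity

theorem gnomonicHeight_le_one (w : E m) : gnomonicHeight w ≤ 1 := by
  refine inv_le_one_of_one_le₀ ?_
  rw [Real.one_le_sqrt]
  nlinarith [sq_nonneg ‖w‖]

theorem continuous_gnomonicHeight : Continuous (gnomonicHeight : E m → ℝ) := by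
  unfold gnomonicHeight
  exact Continuous.inv₀ (by fun_prop) fun w => by positivity

@[simp]
theorem gnomonic_last (w : E m) : gnomonic w (Fin.last m) = gnomonicHeight w := by
  simp [gnomonic]

theorem horizontal_gnomonic (w : E m) : horizontal (gnomonic w) = gnomonicHeight w • w := by
  simp [gnomonic, horizontal_smul]

theorem measurable_gnomonic : Measurable (gnomonic : E m → E (m + 1)) :=
  continuous_gnomonicHeight.measurable.smul
    (measurable_appendLast.comp (measurable_id.prodMk measurable_const))

/-- The ray through `(t w, t)` depends on `w` only, so all horizontal slices carry the same chart
once rescaled by their height. -/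
theorem normalize_appendLast {t : ℝ} (ht : 0 < t) (w : E m) :
    ‖appendLast (t • w) t‖⁻¹ • appendLast (t • w) t = gnomonic w := by
  have h : appendLast (t • w) t = t • appendLast w 1 := by rw [smul_appendLast, mul_one]
  rw [h, norm_smul, Real.norm_of_nonneg ht.le, smul_smul, norm_appendLast, gnomonic,
    gnomonicHeight]
  congr 1
  rw [mul_inv, mul_right_comm, inv_mul_cancel₀ ht.ne', one_mul]
  congr 2
  ring

/-- The surface measure on the upper hemisphere in the gnomonic chart. -/
theorem lintegral_upper_hemisphere {φ : E (m + 1) → ℝ≥0∞} (hφ : Measurable φ) :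
    ∫⁻ y in {y : Sph m | 0 < (y : E (m + 1)) (Fin.last m)}, φ y ∂surface m
      = ∫⁻ w : E m, ENNReal.ofReal (gnomonicHeight w ^ (m + 1)) * φ (gnomonic w) := by
  have hmeas : Measurable fun z : E (m + 1) => z (Fin.last m) := by fun_prop
  have hset : MeasurableSet {y : Sph m | 0 < (y : E (m + 1)) (Fin.last m)} :=
    measurableSet_lt measurable_const (hmeas.comp measurable_subtype_coe)
  -- `F`, the extension of `ψ` by homogeneity of degree `0`, cut off to the slab between heights `0`
  -- and `1`, is integrated in two ways. In polar coordinates the radius runs up to `1 / y_last`,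
  -- which contributes `y_last^{-(m+1)} / (m+1)` and cancels the weight in `ψ`. Slicing by height
  -- `t` gives the factor `∫ t^m dt = 1 / (m+1)` in front of an integral over the chart.
  let ψ : E (m + 1) → ℝ≥0∞ :=
    fun y => ENNReal.ofReal ((m + 1) * y (Fin.last m) ^ (m + 1)) * φ y
  have hψ : Measurable ψ :=
    (((hmeas.pow_const _).const_mul _).ennreal_ofReal).mul hφ
  let F : E (m + 1) → ℝ≥0∞ :=
    fun z => {z : E (m + 1) | z (Fin.last m) ∈ Set.Ioo (0 : ℝ) 1}.indicator
      (fun z => ψ (‖z‖⁻¹ • z)) z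
  have hF : Measurable F := (hψ.comp (by fun_prop)).indicator (hmeas measurableSet_Ioo)
  have h1 : ∫⁻ z, F z = ∫⁻ y in {y : Sph m | 0 < (y : E (m + 1)) (Fin.last m)},
      φ y ∂surface m := by
    rw [lintegral_polar hF, ← lintegral_indicator hset]
    refine lintegral_congr fun y => ?_
    have hy : ‖(y : E (m + 1))‖ = 1 := by simp
    by_cases hpos : 0 < (y : E (m + 1)) (Fin.last m)
    · rw [Set.indicator_of_mem (by exact hpos)]
      have h2 : ∀ ρ ∈ Set.Ioi (0 : ℝ), ENNReal.ofReal (ρ ^ m) * F (ρ • (y : E (m + 1)))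
          = (Set.Ioo 0 ((y : E (m + 1)) (Fin.last m))⁻¹).indicator
            (fun ρ => ENNReal.ofReal (ρ ^ m) * ψ y) ρ := by
        intro ρ (hρ : 0 < ρ)
        have hn : ‖ρ • (y : E (m + 1))‖⁻¹ • ρ • (y : E (m + 1)) = y := by
          rw [norm_smul, hy, mul_one, Real.norm_of_nonneg hρ.le, smul_smul,
            inv_mul_cancel₀ hρ.ne', one_smul]
        have hiff : (ρ • (y : E (m + 1))) (Fin.last m) ∈ Set.Ioo (0 : ℝ) 1 ↔
            ρ ∈ Set.Ioo 0 ((y : E (m + 1)) (Fin.last m))⁻¹ := by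
          simp only [PiLp.smul_apply, smul_eq_mul, Set.mem_Ioo, hρ, true_and, mul_pos hρ hpos]
          rw [← lt_div_iff₀ hpos, one_div]
        by_cases hm : ρ ∈ Set.Ioo 0 ((y : E (m + 1)) (Fin.last m))⁻¹
        · rw [Set.indicator_of_mem hm]
          simp only [F]
          rw [Set.indicator_of_mem (by exact hiff.2 hm), hn]
        · rw [Set.indicator_of_notMem hm]
          simp only [F]
          rw [Set.indicator_of_notMem (by exact fun h => hm (hiff.1 h)), mul_zero]
      rw [setLIntegral_congr_fun measurableSet_Ioi h2,
        setLIntegral_indicator measurableSet_Ioo,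
        Set.inter_eq_left.2 (fun x hx => hx.1), lintegral_mul_const _ (by fun_prop),
        lintegral_Ioo_pow m (by positivity)]
      simp only [ψ]
      rw [← mul_assoc, ← ENNReal.ofReal_mul (by positivity)]
      have : (((y : E (m + 1)) (Fin.last m))⁻¹ ^ (m + 1) / (m + 1)) *
          ((m + 1) * (y : E (m + 1)) (Fin.last m) ^ (m + 1)) = 1 := by
        rw [inv_pow]
        field_simp
      rw [this, ENNReal.ofReal_one, one_mul]
    · rw [Set.indicator_of_notMem (by exact hpos)]
      refine (setLIntegral_congr_fun measurableSet_Ioi (g := fun _ => 0) fun ρ hρ => ?_).trans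
        (by simp)
      simp only [F]
      rw [Set.indicator_of_notMem, mul_zero]
      intro h
      simp only [Set.mem_ofPred_eq, PiLp.smul_apply, smul_eq_mul] at h
      exact hpos (pos_of_mul_pos_right h.1 (le_of_lt hρ))
  rw [← h1, lintegral_split hF]
  have h3 : ∀ t : ℝ, ∫⁻ w, F (appendLast w t) = (Set.Ioo (0 : ℝ) 1).indicator
      (fun t => ENNReal.ofReal (t ^ m) * ∫⁻ w : E m, ψ (gnomonic w)) t := by
    intro t
    by_cases ht : t ∈ Set.Ioo (0 : ℝ) 1
    · have hFt : Measurable fun w => F (appendLast w t) :=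
        hF.comp (measurable_appendLast.comp (measurable_id.prodMk measurable_const))
      rw [Set.indicator_of_mem ht, lintegral_eq_pow_mul_lintegral_smul ht.1 hFt]
      congr 1
      refine lintegral_congr fun w => ?_
      simp only [F]
      rw [Set.indicator_of_mem (by simpa using ht), normalize_appendLast ht.1]
    · rw [Set.indicator_of_notMem ht]
      simp only [F]
      refine (lintegral_congr fun w => ?_).trans lintegral_zero
      rw [Set.indicator_of_notMem (by simpa using ht)]
  simp_rw [h3]
  have hψg : Measurable fun w : E m => ψ (gnomonic w) := hψ.comp measurable_gnomonic
  rw [lintegral_indicator measurableSet_Ioo, lintegral_mul_const _ (by fun_prop),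
    lintegral_Ioo_pow m zero_le_one, ← lintegral_const_mul _ hψg]
  refine lintegral_congr fun w => ?_
  simp only [ψ, gnomonic_last]
  rw [← mul_assoc, ← ENNReal.ofReal_mul (by positivity)]
  congr 2
  field_simp
  simp

/-- The identity for nonnegative functions is an equality of two image measures on `ℝ^{m+1}`, so
complex integrands follow without integrability assumptions. -/
theorem integral_upper_hemisphere {f : E (m + 1) → ℂ} (hf : Measurable f) :
    ∫ y in {y : Sph m | 0 < (y : E (m + 1)) (Fin.last m)}, f y ∂surface m
      = ∫ w : E m, gnomonicHeight w ^ (m + 1) • f (gnomonic w) := by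
  have hd : Measurable fun w : E m => Real.toNNReal (gnomonicHeight w ^ (m + 1)) :=
    (continuous_gnomonicHeight.measurable.pow_const _).real_toNNReal
  have hval : Measurable (Subtype.val : Sph m → E (m + 1)) := measurable_subtype_coe
  have key : ((surface m).restrict {y : Sph m | 0 < (y : E (m + 1)) (Fin.last m)}).map Subtype.val
      = ((volume : Measure (E m)).withDensity fun w =>
        (Real.toNNReal (gnomonicHeight w ^ (m + 1)) : ℝ≥0∞)).map gnomonic := by
    ext A hA
    have hφ : Measurable (A.indicator fun _ => (1 : ℝ≥0∞)) := measurable_const.indicator hA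
    have := lintegral_upper_hemisphere hφ
    rw [← lintegral_map hφ hval, lintegral_indicator_const hA, one_mul] at this
    rw [this, Measure.map_apply measurable_gnomonic hA, withDensity_apply _ (measurable_gnomonic hA),
      ← lintegral_indicator (measurable_gnomonic hA)]
    refine lintegral_congr fun w => ?_
    by_cases hw : gnomonic w ∈ A
    · simp [Set.indicator, hw, ENNReal.ofReal]
    · simp [Set.indicator, hw]
  rw [← integral_map (f := f) hval.aemeasurable hf.aestronglyMeasurable, key,
    integral_map measurable_gnomonic.aemeasurable hf.aestronglyMeasurable,
    integral_withDensity_eq_integral_smul hd]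
  refine integral_congr_ae (.of_forall fun w => ?_)
  simp only [NNReal.smul_def]
  rw [Real.coe_toNNReal _ (pow_nonneg (gnomonicHeight_pos w).le _)]

end Polar

/-! ### Areas of spherical caps. -/

section Caps

variable {m : ℕ}

-- The reflection exchanging `a` and `b` preserves Lebesgue measure and maps the truncated cone over
-- one cap to that over the other; the volumes of these cones define the surface measure.
open scoped Pointwise in
theorem surface_cap_eq {a b : E (m + 1)} (hab : ‖a‖ = ‖b‖) (c : ℝ) :
    surface m {y : Sph m | c ≤ inner ℝ (y : E (m + 1)) a}
      = surface m {y : Sph m | c ≤ inner ℝ (y : E (m + 1)) b} := by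
  have hs : ∀ a : E (m + 1), MeasurableSet {y : Sph m | c ≤ inner ℝ (y : E (m + 1)) a} :=
    fun a => measurableSet_le measurable_const (by fun_prop)
  let L : E (m + 1) ≃ₗᵢ[ℝ] E (m + 1) := (ℝ ∙ (a - b))ᗮ.reflection
  have hL : L a = b := Submodule.reflection_sub hab
  have hpre : L ⁻¹' (Set.Ioo (0 : ℝ) 1 •
        ((Subtype.val : Sph m → E (m + 1)) '' {y : Sph m | c ≤ inner ℝ (y : E (m + 1)) b}))
      = Set.Ioo (0 : ℝ) 1 •
        ((Subtype.val : Sph m → E (m + 1)) '' {y : Sph m | c ≤ inner ℝ (y : E (m + 1)) a}) := by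
    ext z
    simp only [Set.mem_preimage, Set.mem_smul, Set.mem_image]
    constructor
    · rintro ⟨t, ht, _, ⟨y, hy, rfl⟩, hz⟩
      refine ⟨t, ht, _, ⟨⟨L.symm y, by simp⟩, ?_, rfl⟩, ?_⟩
      · change c ≤ inner ℝ (L.symm y) a
        rw [← L.inner_map_map, hL, L.apply_symm_apply]
        exact hy
      · apply L.injective
        rw [map_smul, L.apply_symm_apply, hz]
    · rintro ⟨t, ht, _, ⟨y, hy, rfl⟩, rfl⟩
      refine ⟨t, ht, _, ⟨⟨L y, by simp⟩, ?_, rfl⟩, by simp⟩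
      change c ≤ inner ℝ (L y) b
      rw [← hL, L.inner_map_map]
      exact hy
  rw [Measure.toSphere_apply' _ (hs a), Measure.toSphere_apply' _ (hs b), ← hpre,
    L.measurePreserving.measure_preimage_emb L.toHomeomorph.measurableEmbedding]

theorem sphereUniform_real (s : Set (Sph m)) :
    (sphereUniform m).real s = (((m + 1 : ℕ) : ℝ) * kappa (m + 1))⁻¹ * (surface m).real s := by
  have := Measure.toSphere_real_apply_univ (volume : Measure (E (m + 1)))
  rw [measureReal_def, finrank_euclideanSpace_fin] at this
  rw [sphereUniform, ProbabilityTheory.cond, Measure.restrict_univ, measureReal_def,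
    Measure.smul_apply, smul_eq_mul, ENNReal.toReal_mul, ENNReal.toReal_inv, this]
  rfl

/-- The north pole. -/
def northPole (m : ℕ) : E (m + 1) := EuclideanSpace.single (Fin.last m) 1

theorem norm_northPole : ‖northPole m‖ = 1 := by simp [northPole]

theorem inner_northPole (y : E (m + 1)) : inner ℝ y (northPole m) = y (Fin.last m) := by
  simp [northPole, EuclideanSpace.inner_single_right]

theorem capArea_eq {a : E (m + 1)} (ha : ‖a‖ = 1) (h : ℝ) :
    capArea m h = (((m + 1 : ℕ) : ℝ) * kappa (m + 1))⁻¹ *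
      (surface m).real {y : Sph m | 1 - h ≤ inner ℝ (y : E (m + 1)) a} := by
  have h1 : {y : Sph m | 1 + (y : E (m + 1)) (Fin.last m) ≤ h}
      = {y : Sph m | 1 - h ≤ inner ℝ (y : E (m + 1)) (-northPole m)} := by
    ext y
    simp only [Set.mem_ofPred_eq, inner_neg_right, inner_northPole]
    constructor <;> intro h <;> linarith
  rw [capArea, sphereUniform_real, h1, measureReal_def, measureReal_def,
    surface_cap_eq (b := a) (by rw [norm_neg, norm_northPole, ha])]

theorem capArea_nonneg (h : ℝ) : 0 ≤ capArea m h := measureReal_nonneg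

theorem capArea_le_one (h : ℝ) : capArea m h ≤ 1 := measureReal_le_one

theorem monotone_capArea : Monotone (capArea m) := fun _ _ h =>
  measureReal_mono fun _ hy => le_trans hy h

theorem capArea_of_two_le {h : ℝ} (hh : 2 ≤ h) : capArea m h = 1 := by
  have : {y : Sph m | 1 + (y : E (m + 1)) (Fin.last m) ≤ h} = Set.univ := by
    refine Set.eq_univ_of_forall fun y => ?_
    have h1 := norm_sq_eq (y : E (m + 1))
    rw [norm_eq_of_mem_sphere y] at h1
    change 1 + (y : E (m + 1)) (Fin.last m) ≤ h
    nlinarith [sq_nonneg ‖horizontal (y : E (m + 1))‖]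
  rw [capArea, this, probReal_univ]

/-- The part of the sphere in a ball is a cap. -/
theorem sphereUniform_real_ball {y : E (m + 1)} (hy : y ≠ 0) {r : ℝ} (hr : 0 ≤ r) :
    (sphereUniform m).real {x : Sph m | ‖y - x‖ ≤ r}
      = capArea m ((r ^ 2 - (1 - ‖y‖) ^ 2) / (2 * ‖y‖)) := by
  have hy' : 0 < ‖y‖ := norm_pos_iff.2 hy
  have ha : ‖‖y‖⁻¹ • y‖ = 1 := by
    rw [norm_smul, norm_inv, norm_norm, inv_mul_cancel₀ hy'.ne']
  rw [capArea_eq ha, sphereUniform_real]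
  congr 2
  ext x
  have h1 : ‖y - x‖ ≤ r ↔ ‖y - x‖ ^ 2 ≤ r ^ 2 := by
    rw [sq_le_sq₀ (norm_nonneg _) hr]
  simp only [Set.mem_ofPred_eq]
  rw [h1, norm_sub_sq_real, norm_eq_of_mem_sphere x, inner_smul_right, real_inner_comm,
    ← div_eq_inv_mul, le_div_iff₀ hy']
  have : (1 - (r ^ 2 - (1 - ‖y‖) ^ 2) / (2 * ‖y‖)) * ‖y‖ = (1 + ‖y‖ ^ 2 - r ^ 2) / 2 := by
    field_simp
    ring
  rw [this]
  constructor <;> intro h <;> linarith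

theorem le_gnomonicHeight_iff {c : ℝ} (hc : 0 < c) (hc1 : c ≤ 1) (w : E m) :
    c ≤ gnomonicHeight w ↔ ‖w‖ ≤ Real.sqrt ((1 - c ^ 2) / c ^ 2) := by
  have h0 : 0 ≤ (1 - c ^ 2) / c ^ 2 := div_nonneg (by nlinarith) (sq_nonneg c)
  rw [gnomonicHeight, le_inv_comm₀ hc (by positivity), Real.sqrt_le_left (by positivity),
    Real.le_sqrt (norm_nonneg w) h0, le_div_iff₀ (by positivity), inv_pow,
    le_inv_comm₀ (by positivity) (by positivity), le_inv_comm₀ (by positivity) (by positivity),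
    ← one_div, le_div_iff₀ (by positivity)]
  constructor <;> intro h <;> linarith

/-- In the gnomonic chart the cap is a ball whose radius is the tangent of the angular radius, with
square `h(2-h)/(1-h)²`. On this ball the chart density lies between `(1-h)^{m+1}` and `1`. -/
theorem capArea_bounds {h : ℝ} (h0 : 0 ≤ h) (h1 : h < 1) :
    (1 - h) ^ (m + 1) * (kappa m / (((m + 1 : ℕ) : ℝ) * kappa (m + 1)) *
        (h * (2 - h) / (1 - h) ^ 2) ^ ((m : ℝ) / 2)) ≤ capArea m h ∧
      capArea m h ≤ kappa m / (((m + 1 : ℕ) : ℝ) * kappa (m + 1)) *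
        (h * (2 - h) / (1 - h) ^ 2) ^ ((m : ℝ) / 2) := by
  have hκ := kappa_pos (m + 1)
  have hc : 0 < 1 - h := by linarith
  set t := Real.sqrt ((1 - (1 - h) ^ 2) / (1 - h) ^ 2) with ht
  have ht0 : 0 ≤ t := Real.sqrt_nonneg _
  have htm : (h * (2 - h) / (1 - h) ^ 2) ^ ((m : ℝ) / 2) = t ^ m := by
    have h2 : h * (2 - h) / (1 - h) ^ 2 = t ^ (2 : ℝ) := by
      rw [Real.rpow_two, ht, Real.sq_sqrt]
      · congr 1; ring
      · exact div_nonneg (by nlinarith) (sq_nonneg _)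
    rw [h2, ← Real.rpow_mul ht0, mul_div_cancel₀ _ two_ne_zero, Real.rpow_natCast]
  have hball : (volume : Measure (E m)) (Metric.closedBall 0 t) = ENNReal.ofReal (t ^ m * kappa m) := by
    rw [Measure.addHaar_closedBall _ _ ht0, finrank_euclideanSpace_fin,
      ENNReal.ofReal_mul (by positivity), kappa, ofReal_measureReal measure_ball_lt_top.ne]
  have hset : MeasurableSet {y : E (m + 1) | 1 - h ≤ y (Fin.last m)} :=
    measurableSet_le measurable_const (by fun_prop)
  have hset' : MeasurableSet {y : Sph m | 1 - h ≤ (y : E (m + 1)) (Fin.last m)} :=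
    measurable_subtype_coe hset
  have hφ : Measurable ({y : E (m + 1) | 1 - h ≤ y (Fin.last m)}.indicator
      fun _ => (1 : ℝ≥0∞)) := measurable_const.indicator hset
  have hS : surface m {y : Sph m | 1 - h ≤ (y : E (m + 1)) (Fin.last m)}
      = ∫⁻ w in Metric.closedBall (0 : E m) t, ENNReal.ofReal (gnomonicHeight w ^ (m + 1)) := by
    have := lintegral_upper_hemisphere hφ
    rw [← lintegral_indicator measurableSet_closedBall]
    have hl : ∫⁻ y in {y : Sph m | 0 < (y : E (m + 1)) (Fin.last m)},
        {y : E (m + 1) | 1 - h ≤ y (Fin.last m)}.indicator (fun _ => (1 : ℝ≥0∞)) y ∂surface m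
        = surface m {y : Sph m | 1 - h ≤ (y : E (m + 1)) (Fin.last m)} := by
      have h3 : ∀ y : Sph m,
          {y : E (m + 1) | 1 - h ≤ y (Fin.last m)}.indicator (fun _ => (1 : ℝ≥0∞)) y
          = {y : Sph m | 1 - h ≤ (y : E (m + 1)) (Fin.last m)}.indicator (fun _ => 1) y :=
        fun y => by simp [Set.indicator]
      simp_rw [h3]
      rw [lintegral_indicator_const hset', one_mul,
        Measure.restrict_apply hset',
        Set.inter_eq_left.2
          (show {y : Sph m | 1 - h ≤ (y : E (m + 1)) (Fin.last m)} ⊆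
            {y : Sph m | 0 < (y : E (m + 1)) (Fin.last m)} from
              fun y hy => lt_of_lt_of_le hc hy)]
    rw [← hl, this]
    refine lintegral_congr fun w => ?_
    have hiff := le_gnomonicHeight_iff hc (by linarith) w
    by_cases hw : w ∈ Metric.closedBall (0 : E m) t
    · rw [Set.indicator_of_mem hw, Set.indicator_of_mem, mul_one]
      simpa using hiff.2 (by simpa using hw)
    · rw [Set.indicator_of_notMem hw, Set.indicator_of_notMem, mul_zero]
      intro hw'
      exact hw (by simpa using hiff.1 (by simpa using hw'))
  have hcap := capArea_eq (norm_northPole (m := m)) h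
  simp_rw [inner_northPole] at hcap
  rw [htm, hcap, measureReal_def, hS]
  have hub : ∫⁻ w in Metric.closedBall (0 : E m) t, ENNReal.ofReal (gnomonicHeight w ^ (m + 1))
      ≤ ENNReal.ofReal (t ^ m * kappa m) := by
    rw [← hball, ← setLIntegral_one]
    refine lintegral_mono fun w => ?_
    exact ENNReal.ofReal_le_one.2
      (pow_le_one₀ (gnomonicHeight_pos w).le (gnomonicHeight_le_one w))
  have hlb : ENNReal.ofReal ((1 - h) ^ (m + 1) * (t ^ m * kappa m)) ≤
      ∫⁻ w in Metric.closedBall (0 : E m) t, ENNReal.ofReal (gnomonicHeight w ^ (m + 1)) := by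
    rw [ENNReal.ofReal_mul (by positivity), ← hball, ← setLIntegral_const]
    refine setLIntegral_mono' measurableSet_closedBall fun w hw => ?_
    refine ENNReal.ofReal_le_ofReal (pow_le_pow_left₀ hc.le ?_ _)
    exact (le_gnomonicHeight_iff hc (by linarith) w).2 (by simpa using hw)
  have hκm := (kappa_pos m).le
  have hub' := ENNReal.toReal_mono ENNReal.ofReal_ne_top hub
  rw [ENNReal.toReal_ofReal (by positivity)] at hub'
  have hlb' := ENNReal.toReal_mono (ne_top_of_le_ne_top ENNReal.ofReal_ne_top hub) hlb
  rw [ENNReal.toReal_ofReal (by positivity)] at hlb'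
  constructor
  · calc _ = (((m + 1 : ℕ) : ℝ) * kappa (m + 1))⁻¹ * ((1 - h) ^ (m + 1) * (t ^ m * kappa m)) := by
          ring
      _ ≤ _ := by gcongr
  · calc _ ≤ (((m + 1 : ℕ) : ℝ) * kappa (m + 1))⁻¹ * (t ^ m * kappa m) := by gcongr
      _ = _ := by ring

/-- Here `m ≥ 1` matters: on the zero-dimensional sphere a single point has positive mass. -/
theorem capArea_of_nonpos (hm : 1 ≤ m) {h : ℝ} (hh : h ≤ 0) : capArea m h = 0 := by
  refine le_antisymm ((monotone_capArea hh).trans ?_) (capArea_nonneg h)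
  refine (capArea_bounds le_rfl zero_lt_one).2.trans ?_
  rw [zero_mul, zero_div, Real.zero_rpow (by positivity), mul_zero]

/-- The limit of `capArea m h / h ^ (m / 2)` at `0`. -/
def capConst (m : ℕ) : ℝ :=
  kappa m / (((m + 1 : ℕ) : ℝ) * kappa (m + 1)) * 2 ^ ((m : ℝ) / 2)

theorem capConst_pos (m : ℕ) : 0 < capConst m := by
  have := kappa_pos m
  have := kappa_pos (m + 1)
  unfold capConst
  positivity

/-- The two sides of `capArea_bounds` differ by the factor `(1-h)^{m+1} → 1`. -/
theorem tendsto_capArea_div (m : ℕ) :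
    Tendsto (fun h => capArea m h / h ^ ((m : ℝ) / 2)) (𝓝[>] 0) (𝓝 (capConst m)) := by
  set c := kappa m / (((m + 1 : ℕ) : ℝ) * kappa (m + 1))
  have hc : 0 < c := div_pos (kappa_pos m) (mul_pos (by positivity) (kappa_pos (m + 1)))
  let G : ℝ → ℝ := fun h => c * ((2 - h) / (1 - h) ^ 2) ^ ((m : ℝ) / 2)
  have hG : Tendsto G (𝓝[>] 0) (𝓝 (capConst m)) := by
    have h1 : ContinuousAt (fun h : ℝ => (2 - h) / (1 - h) ^ 2) 0 :=
      ContinuousAt.div (by fun_prop) (by fun_prop) (by norm_num)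
    have h2 : ContinuousAt G 0 :=
      (h1.rpow_const (Or.inl (by norm_num))).const_mul c
    have h3 : G 0 = capConst m := by simp [G, capConst, c]
    rw [← h3]
    exact h2.tendsto.mono_left nhdsWithin_le_nhds
  have hL : Tendsto (fun h : ℝ => (1 - h) ^ (m + 1) * G h) (𝓝[>] 0) (𝓝 (capConst m)) := by
    have h1 : Tendsto (fun h : ℝ => (1 - h) ^ (m + 1)) (𝓝[>] 0) (𝓝 1) := by
      have : ContinuousAt (fun h : ℝ => (1 - h) ^ (m + 1)) 0 := by fun_prop
      have := this.tendsto
      simp only [sub_zero, one_pow] at this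
      exact this.mono_left nhdsWithin_le_nhds
    simpa using h1.mul hG
  have hev : ∀ᶠ h : ℝ in 𝓝[>] 0, 0 < h ∧ h < 1 := by
    filter_upwards [Ioo_mem_nhdsGT (zero_lt_one' ℝ)] with h hh using hh
  have hfac : ∀ h : ℝ, 0 < h → h < 1 → c * (h * (2 - h) / (1 - h) ^ 2) ^ ((m : ℝ) / 2)
      = G h * h ^ ((m : ℝ) / 2) := by
    intro h h0 h1
    simp only [G]
    rw [mul_assoc, ← Real.mul_rpow (div_nonneg (by linarith) (sq_nonneg _)) h0.le]
    congr 2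
    ring
  refine tendsto_of_tendsto_of_tendsto_of_le_of_le' hL hG ?_ ?_
  · filter_upwards [hev] with h ⟨h0, h1⟩
    rw [le_div_iff₀ (by positivity), mul_assoc, ← hfac h h0 h1]
    exact (capArea_bounds h0.le h1).1
  · filter_upwards [hev] with h ⟨h0, h1⟩
    rw [div_le_iff₀ (by positivity), ← hfac h h0 h1]
    exact (capArea_bounds h0.le h1).2

/-- This supplies the domination in all small-cap regimes. The separate bound `b` admits negative
`h`, where a real power of `h` would be meaningless. -/
theorem exists_capArea_le (hm : 1 ≤ m) :
    ∃ C : ℝ, 0 ≤ C ∧ ∀ h b : ℝ, h ≤ b → 0 ≤ b → capArea m h ≤ C * b ^ ((m : ℝ) / 2) := by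
  set c := kappa m / (((m + 1 : ℕ) : ℝ) * kappa (m + 1))
  have hc : 0 < c := div_pos (kappa_pos m) (mul_pos (by positivity) (kappa_pos (m + 1)))
  refine ⟨c * 8 ^ ((m : ℝ) / 2) + 2 ^ ((m : ℝ) / 2), by positivity, fun h b hhb hb => ?_⟩
  refine (monotone_capArea hhb).trans ?_
  rcases le_or_gt b (1 / 2) with hb2 | hb2
  · refine (capArea_bounds hb (by linarith)).2.trans ?_
    -- For `b ≤ 1/2` the numerator is at most `2b` and the denominator at least `1/4`.
    have h1 : b * (2 - b) / (1 - b) ^ 2 ≤ 8 * b := by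
      rw [div_le_iff₀ (by nlinarith)]
      nlinarith [mul_nonneg hb (by linarith : 0 ≤ 1 / 2 - b),
        mul_nonneg (mul_nonneg hb hb) hb]
    calc c * (b * (2 - b) / (1 - b) ^ 2) ^ ((m : ℝ) / 2) ≤ c * (8 * b) ^ ((m : ℝ) / 2) := by
          gcongr
          exact div_nonneg (mul_nonneg hb (by linarith)) (sq_nonneg _)
      _ = c * 8 ^ ((m : ℝ) / 2) * b ^ ((m : ℝ) / 2) := by
          rw [Real.mul_rpow (by norm_num) hb]; ring
      _ ≤ _ := by
          gcongr
          linarith [show (0 : ℝ) ≤ 2 ^ ((m : ℝ) / 2) by positivity]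
  · calc capArea m b ≤ 1 := capArea_le_one b
      _ ≤ (2 * b) ^ ((m : ℝ) / 2) := Real.one_le_rpow (by linarith) (by positivity)
      _ = 2 ^ ((m : ℝ) / 2) * b ^ ((m : ℝ) / 2) := Real.mul_rpow (by norm_num) hb
      _ ≤ _ := by
          gcongr
          linarith [show (0 : ℝ) ≤ c * 8 ^ ((m : ℝ) / 2) by positivity]

end Caps

/-! ### Directions seen at scale `u`. -/

section Directions

variable {m : ℕ}

theorem arccos_gnomonicHeight (w : E m) : Real.arccos (gnomonicHeight w) = Real.arctan ‖w‖ := by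
  rw [Real.arctan_eq_arccos (norm_nonneg w), gnomonicHeight]

theorem sphereLog_gnomonic (w : E m) :
    sphereLog (gnomonic w) = (Real.arctan ‖w‖ / ‖w‖) • w := by
  have ha := gnomonicHeight_pos w
  rw [sphereLog, gnomonic_last, arccos_gnomonicHeight, horizontal_gnomonic, norm_smul,
    Real.norm_of_nonneg ha.le, smul_smul]
  congr 1
  rcases eq_or_ne ‖w‖ 0 with h | h
  · simp [h]
  · field_simp

/-- The hypothesis excludes the south pole, where `sphereLog` has the default value `0` while the
arccosine is `π`. -/
theorem norm_sphereLog {y : E (m + 1)} (hy : horizontal y ≠ 0) :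
    ‖sphereLog y‖ = Real.arccos (y (Fin.last m)) := by
  have hn : ‖horizontal y‖ ≠ 0 := norm_ne_zero_iff.2 hy
  rw [sphereLog, norm_smul, Real.norm_of_nonneg
    (div_nonneg (Real.arccos_nonneg _) (norm_nonneg _)), div_mul_cancel₀ _ hn]

/-- On angles up to `1` the cosine is at least `1/2`, so the tangent is at most twice the angle. -/
theorem le_two_mul_arctan {t : ℝ} (h : Real.arctan t ≤ 1) (ht : 0 ≤ t) :
    t ≤ 2 * Real.arctan t := by
  set x := Real.arctan t
  have hx : 0 ≤ x := Real.arctan_nonneg.2 ht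
  have hcos : 1 / 2 ≤ Real.cos x := by
    have := Real.one_sub_sq_div_two_le_cos (x := x)
    nlinarith
  have htan : t = Real.sin x / Real.cos x := by
    rw [← Real.tan_eq_sin_div_cos, Real.tan_arctan]
  rw [htan, div_le_iff₀ (by linarith)]
  nlinarith [Real.sin_le hx]

theorem tendsto_arctan_div : Tendsto (fun t : ℝ => Real.arctan t / t) (𝓝[≠] 0) (𝓝 1) := by
  have h := (hasDerivAt_iff_tendsto_slope_zero).1 (Real.hasDerivAt_arctan 0)
  simpa [div_eq_inv_mul] using h

/-- At the south pole the default value of `sphereLog` may fall in the support of a test function,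
so this point has to be discarded as a null set. -/
theorem surface_southPole (hm : 1 ≤ m) :
    surface m {y : Sph m | (y : E (m + 1)) (Fin.last m) ≤ -1} = 0 := by
  have h := capArea_of_nonpos hm (le_refl (0 : ℝ))
  rw [capArea, sphereUniform_real] at h
  have hκ := kappa_pos (m + 1)
  have h2 := (mul_eq_zero.1 h).resolve_left (by positivity)
  rw [measureReal_eq_zero_iff] at h2
  refine measure_mono_null (fun y hy => ?_) h2
  simp only [Set.mem_ofPred_eq] at hy ⊢
  linarith

/-- The integral over the sphere of a test function in normal coordinates, rescaled by `u`. -/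
def sphereIntegral (m : ℕ) (g : E m × ℝ≥0 → ℂ) (u : ℝ) (h : ℝ≥0) : ℂ :=
  ∫ y : Sph m, g (u • sphereLog (y : E (m + 1)), h) ∂surface m

/-- For `u > R` every direction in the lower hemisphere, null set aside, is sent to norm at least `u
π / 2 > R`. Only the upper hemisphere contributes, and the gnomonic chart rescaled by `u` covers it.
-/
theorem pow_smul_sphereIntegral (hm : 1 ≤ m) {g : E m × ℝ≥0 → ℂ} (hg : Measurable g) {R : ℝ}
    {h : ℝ≥0} (hR : ∀ v, R < ‖v‖ → g (v, h) = 0) {u : ℝ} (hu : 0 < u) (huR : R < u) :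
    u ^ m • sphereIntegral m g u h = ∫ w : E m, gnomonicHeight (u⁻¹ • w) ^ (m + 1) •
      g (u • sphereLog (gnomonic (u⁻¹ • w)), h) := by
  have hgm : Measurable fun y : E (m + 1) => g (u • sphereLog y, h) :=
    hg.comp ((measurable_sphereLog.const_smul u).prodMk measurable_const)
  have h1 : sphereIntegral m g u h = ∫ y in {y : Sph m | 0 < (y : E (m + 1)) (Fin.last m)},
      g (u • sphereLog (y : E (m + 1)), h) ∂surface m := by
    refine (setIntegral_eq_integral_of_ae_compl_eq_zero ?_).symm
    have hae : ∀ᵐ y : Sph m ∂surface m, ¬ ((y : E (m + 1)) (Fin.last m) ≤ -1) := by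
      rw [ae_iff]
      simpa using surface_southPole hm
    filter_upwards [hae] with y hy hyn
    have hle : (y : E (m + 1)) (Fin.last m) ≤ 0 := not_lt.1 hyn
    have hhor : horizontal (y : E (m + 1)) ≠ 0 := by
      intro h0
      have h2 := norm_sq_eq (y : E (m + 1))
      rw [norm_eq_of_mem_sphere y, h0, norm_zero] at h2
      exact hy (by nlinarith)
    refine hR _ ?_
    rw [norm_smul, norm_sphereLog hhor, Real.norm_of_nonneg hu.le]
    have h3 : Real.pi / 2 ≤ Real.arccos ((y : E (m + 1)) (Fin.last m)) :=
      Real.arccos_zero ▸ Real.antitone_arccos hle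
    nlinarith [Real.pi_gt_three]
  rw [h1, integral_upper_hemisphere hgm]
  have h4 := Measure.integral_comp_smul (volume : Measure (E m))
    (fun w : E m => gnomonicHeight w ^ (m + 1) • g (u • sphereLog (gnomonic w), h)) u⁻¹
  rw [h4, finrank_euclideanSpace_fin, inv_pow, inv_inv, abs_of_pos (by positivity)]

/-- On the support `u arctan(‖w‖/u) ≤ R ≤ u`, so the angle is at most `1` and `‖w‖ ≤ 2R`. This
dominating function does not depend on `u`. -/
theorem norm_gnomonic_integrand_le {g : E m × ℝ≥0 → ℂ} {R M : ℝ} {h : ℝ≥0}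
    (hR : ∀ v, R < ‖v‖ → g (v, h) = 0) (hM : ∀ p, ‖g p‖ ≤ M) {u : ℝ} (hu : 0 < u) (huR : R ≤ u)
    (w : E m) :
    ‖gnomonicHeight (u⁻¹ • w) ^ (m + 1) • g (u • sphereLog (gnomonic (u⁻¹ • w)), h)‖
      ≤ (Metric.closedBall (0 : E m) (2 * R)).indicator (fun _ => M) w := by
  by_cases hg0 : g (u • sphereLog (gnomonic (u⁻¹ • w)), h) = 0
  · rw [hg0, smul_zero, norm_zero]
    exact Set.indicator_nonneg (fun _ _ => (norm_nonneg _).trans (hM (0, 0))) _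
  have h1 : ‖u • sphereLog (gnomonic (u⁻¹ • w))‖ ≤ R := by
    by_contra hlt
    exact hg0 (hR _ (not_le.1 hlt))
  have h2 : ‖sphereLog (gnomonic (u⁻¹ • w))‖ = Real.arctan ‖u⁻¹ • w‖ := by
    rw [sphereLog_gnomonic, norm_smul, Real.norm_of_nonneg
      (div_nonneg (Real.arctan_nonneg.2 (norm_nonneg _)) (norm_nonneg _))]
    rcases eq_or_ne ‖u⁻¹ • w‖ 0 with h | h
    · simp [h]
    · rw [div_mul_cancel₀ _ h]
  rw [norm_smul, Real.norm_of_nonneg hu.le, h2] at h1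
  have h3 : Real.arctan ‖u⁻¹ • w‖ ≤ 1 := by
    by_contra hlt
    nlinarith [not_le.1 hlt]
  have h4 := le_two_mul_arctan h3 (norm_nonneg _)
  have h5 : ‖u⁻¹ • w‖ = u⁻¹ * ‖w‖ := by
    rw [norm_smul, norm_inv, Real.norm_of_nonneg hu.le]
  have h6 : ‖w‖ ≤ 2 * R := by
    have : ‖w‖ = u * ‖u⁻¹ • w‖ := by rw [h5]; field_simp
    rw [this]
    nlinarith
  rw [Set.indicator_of_mem (by simpa using h6), norm_smul, norm_pow,
    Real.norm_of_nonneg (gnomonicHeight_pos _).le]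
  calc gnomonicHeight (u⁻¹ • w) ^ (m + 1) * _ ≤ 1 * M := by
        gcongr
        · exact pow_le_one₀ (gnomonicHeight_pos _).le (gnomonicHeight_le_one _)
        · exact hM _
    _ = M := one_mul M

theorem integrable_indicator_closedBall (R M : ℝ) :
    Integrable ((Metric.closedBall (0 : E m) R).indicator fun _ => M) :=
  (integrable_indicator_iff measurableSet_closedBall).2
    (integrableOn_const measure_closedBall_lt_top.ne)

theorem norm_pow_smul_sphereIntegral_le (hm : 1 ≤ m) {g : E m × ℝ≥0 → ℂ} (hg : Measurable g)
    {R M : ℝ} {h : ℝ≥0} (hR : ∀ v, R < ‖v‖ → g (v, h) = 0) (hM : ∀ p, ‖g p‖ ≤ M) {u : ℝ}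
    (hu : 0 < u) (huR : R < u) : ‖u ^ m • sphereIntegral m g u h‖
      ≤ ∫ w, (Metric.closedBall (0 : E m) (2 * R)).indicator (fun _ => M) w := by
  rw [pow_smul_sphereIntegral hm hg hR hu huR]
  exact norm_integral_le_of_norm_le (integrable_indicator_closedBall _ _)
    (.of_forall (norm_gnomonic_integrand_le hR hM hu huR.le))

/-- The chart density tends to `1` and the rescaled logarithm to `w`, since `arctan t / t → 1`. The
limit is taken jointly in scale and height because the degenerate regime evaluates it at moving
heights. -/
theorem tendsto_pow_smul_sphereIntegral (hm : 1 ≤ m) {g : E m × ℝ≥0 → ℂ} (hg : Continuous g)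
    {R M : ℝ} (hR : ∀ v h, R < ‖v‖ → g (v, h) = 0) (hM : ∀ p, ‖g p‖ ≤ M) (h₀ : ℝ≥0) :
    Tendsto (fun p : ℝ × ℝ≥0 => p.1 ^ m • sphereIntegral m g p.1 p.2) (atTop ×ˢ 𝓝 h₀)
      (𝓝 (∫ v, g (v, h₀))) := by
  have hu : ∀ᶠ p : ℝ × ℝ≥0 in atTop ×ˢ 𝓝 h₀, 0 < p.1 ∧ R < p.1 :=
    tendsto_fst.eventually ((eventually_gt_atTop 0).and (eventually_gt_atTop R))
  have hlim : Tendsto (fun p : ℝ × ℝ≥0 => ∫ w : E m, gnomonicHeight (p.1⁻¹ • w) ^ (m + 1) •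
      g (p.1 • sphereLog (gnomonic (p.1⁻¹ • w)), p.2)) (atTop ×ˢ 𝓝 h₀) (𝓝 (∫ v, g (v, h₀))) := by
    refine tendsto_integral_filter_of_dominated_convergence
      ((Metric.closedBall (0 : E m) (2 * R)).indicator fun _ => M) (.of_forall fun p => ?_)
      (hu.mono fun p hp => .of_forall
        (norm_gnomonic_integrand_le (fun v => hR v p.2) hM hp.1 hp.2.le))
      (integrable_indicator_closedBall _ _) (.of_forall fun w => ?_)
    · have h1 : Measurable fun w : E m => p.1⁻¹ • w := measurable_const_smul _
      exact (((continuous_gnomonicHeight.measurable.comp h1).pow_const _).smul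
        (hg.measurable.comp ((((measurable_sphereLog.comp measurable_gnomonic).comp h1).const_smul
          p.1).prodMk measurable_const))).aestronglyMeasurable
    · have hinv : Tendsto (fun p : ℝ × ℝ≥0 => p.1⁻¹) (atTop ×ˢ 𝓝 h₀) (𝓝 0) :=
        tendsto_inv_atTop_zero.comp tendsto_fst
      have h1 : Tendsto (fun p : ℝ × ℝ≥0 => p.1⁻¹ • w) (atTop ×ˢ 𝓝 h₀) (𝓝 0) := by
        simpa using hinv.smul_const w
      have h2 : Tendsto (fun p : ℝ × ℝ≥0 => gnomonicHeight (p.1⁻¹ • w) ^ (m + 1))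
          (atTop ×ˢ 𝓝 h₀) (𝓝 1) := by
        have := ((continuous_gnomonicHeight.tendsto _).comp h1).pow (m + 1)
        simpa [gnomonicHeight] using this
      have h3 : Tendsto (fun p : ℝ × ℝ≥0 => p.1 • sphereLog (gnomonic (p.1⁻¹ • w)))
          (atTop ×ˢ 𝓝 h₀) (𝓝 w) := by
        rcases eq_or_ne w 0 with rfl | hw
        · simp [sphereLog_gnomonic]
        have hw' : ‖w‖ ≠ 0 := norm_ne_zero_iff.2 hw
        have hnorm : Tendsto (fun p : ℝ × ℝ≥0 => ‖p.1⁻¹ • w‖) (atTop ×ˢ 𝓝 h₀) (𝓝[≠] 0) := by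
          refine tendsto_nhdsWithin_iff.2 ⟨by simpa using h1.norm, ?_⟩
          filter_upwards [hu] with p hp
          simp [norm_smul, hp.1.ne', hw]
        have := (tendsto_arctan_div.comp hnorm).smul_const w
        rw [one_smul] at this
        refine this.congr' ?_
        filter_upwards [hu] with p hp
        rw [sphereLog_gnomonic, smul_smul, smul_smul]
        congr 1
        simp only [Function.comp_apply]
        rw [mul_right_comm, mul_inv_cancel₀ hp.1.ne', one_mul]
      have h4 := h2.smul ((hg.tendsto (w, h₀)).comp (h3.prodMk_nhds tendsto_snd))
      simpa using h4
  refine hlim.congr' ?_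
  filter_upwards [hu] with p hp
  exact (pow_smul_sphereIntegral hm hg.measurable (fun v => hR v p.2) hp.1 hp.2).symm

end Directions

/-! ### The exact density of norms and heights of a perturbed point. -/

section Identity

variable {m : ℕ}

/-- The height of the cap cut out of the unit sphere by a ball of radius `r` whose center has
norm `ρ`. -/
def capHeight (r ρ : ℝ) : ℝ := (r ^ 2 - (1 - ρ) ^ 2) / (2 * ρ)

theorem measurable_capHeight (r : ℝ) : Measurable (capHeight r) := by
  unfold capHeight
  fun_prop

theorem integral_ballUniform {k : ℕ} {r : ℝ} (hr : 0 < r) (f : E k → ℂ) :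
    ∫ z, f z ∂ballUniform k r
      = (kappa k * r ^ k)⁻¹ • ∫ z, (Metric.closedBall (0 : E k) r).indicator f z := by
  rw [ballUniform, ProbabilityTheory.cond, integral_smul_measure,
    integral_indicator measurableSet_closedBall, Measure.addHaar_closedBall _ _ hr.le,
    finrank_euclideanSpace_fin, ENNReal.toReal_inv, ENNReal.toReal_mul,
    ENNReal.toReal_ofReal (by positivity), mul_comm, kappa, measureReal_def]

theorem integrable_ball_kernel {r : ℝ} {F : E (m + 1) → ℂ} (hF : Measurable F)
    {M : ℝ} (hM : ∀ z, ‖F z‖ ≤ M) :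
    Integrable (fun p : Sph m × E (m + 1) =>
      {p : Sph m × E (m + 1) | ‖p.2 - p.1‖ ≤ r}.indicator (fun p => F p.2) p)
      ((sphereUniform m).prod volume) := by
  have hs : MeasurableSet {p : Sph m × E (m + 1) | ‖p.2 - p.1‖ ≤ r} :=
    measurableSet_le (by fun_prop) measurable_const
  have hb : Integrable (fun p : Sph m × E (m + 1) =>
      (Metric.closedBall (0 : E (m + 1)) (1 + r)).indicator (fun _ => M) p.2)
      ((sphereUniform m).prod volume) :=
    (integrable_indicator_closedBall (1 + r) M).comp_snd (sphereUniform m)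
  refine hb.mono' ((hF.comp measurable_snd).indicator hs).aestronglyMeasurable
    (.of_forall fun p => ?_)
  have hM0 : 0 ≤ M := (norm_nonneg _).trans (hM 0)
  by_cases hp : p ∈ {p : Sph m × E (m + 1) | ‖p.2 - p.1‖ ≤ r}
  · have hp' : ‖p.2 - p.1‖ ≤ r := hp
    have hmem : p.2 ∈ Metric.closedBall (0 : E (m + 1)) (1 + r) := by
      rw [mem_closedBall_zero_iff]
      calc ‖p.2‖ = ‖(p.1 : E (m + 1)) + (p.2 - p.1)‖ := by simp
        _ ≤ ‖(p.1 : E (m + 1))‖ + ‖p.2 - p.1‖ := norm_add_le _ _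
        _ ≤ 1 + r := by rw [norm_eq_of_mem_sphere p.1]; linarith
    rw [Set.indicator_of_mem hp, Set.indicator_of_mem hmem]
    exact hM _
  · rw [Set.indicator_of_notMem hp, norm_zero]
    exact Set.indicator_nonneg (fun _ _ => hM0) _

/-- Fubini with the landing point fixed: the original points that can reach it lie in a ball of
radius `r`, which cuts a cap out of the sphere. Its area depends on the norm of the landing point
only. -/
theorem integral_perturbed {r : ℝ} (hr : 0 < r) {F : E (m + 1) → ℂ} (hF : Measurable F)
    {M : ℝ} (hM : ∀ z, ‖F z‖ ≤ M) :
    ∫ x : Sph m, ∫ z, F ((x : E (m + 1)) + z) ∂ballUniform (m + 1) r ∂sphereUniform m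
      = (kappa (m + 1) * r ^ (m + 1))⁻¹ • ∫ ρ in Set.Ioi (0 : ℝ), ρ ^ m •
        (capArea m (capHeight r ρ) • ∫ y : Sph m, F (ρ • (y : E (m + 1))) ∂surface m) := by
  have hint := integrable_ball_kernel (m := m) (r := r) hF hM
  have h1 : ∀ x : Sph m, ∫ z, F ((x : E (m + 1)) + z) ∂ballUniform (m + 1) r
      = (kappa (m + 1) * r ^ (m + 1))⁻¹ • ∫ y,
        {p : Sph m × E (m + 1) | ‖p.2 - p.1‖ ≤ r}.indicator (fun p => F p.2) (x, y) := by
    intro x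
    rw [integral_ballUniform hr, ← integral_add_left_eq_self (fun y =>
      {p : Sph m × E (m + 1) | ‖p.2 - p.1‖ ≤ r}.indicator (fun p => F p.2) (x, y)) (x : E (m + 1))]
    congr 1
    refine integral_congr_ae (.of_forall fun z => ?_)
    simp [Set.indicator]
  simp_rw [h1]
  rw [integral_smul, integral_integral_swap hint]
  congr 1
  have h2 : ∀ᵐ y : E (m + 1), ∫ x : Sph m, {p : Sph m × E (m + 1) | ‖p.2 - p.1‖ ≤ r}.indicator
      (fun p => F p.2) (x, y) ∂sphereUniform m = capArea m (capHeight r ‖y‖) • F y := by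
    have hne : ∀ᵐ y : E (m + 1), y ≠ 0 := by
      simp [ae_iff, measure_singleton]
    filter_upwards [hne] with y hy
    rw [capHeight, ← sphereUniform_real_ball hy hr.le]
    have hs : MeasurableSet {x : Sph m | ‖y - x‖ ≤ r} :=
      measurableSet_le (by fun_prop) measurable_const
    rw [← integral_indicator_const _ hs]
    rfl
  rw [integral_congr_ae h2, integral_polar (hint.integral_prod_right.congr h2)]
  refine setIntegral_congr_fun measurableSet_Ioi fun ρ hρ => ?_
  have h3 : ∀ y : Sph m, ‖ρ • (y : E (m + 1))‖ = ρ := fun y => by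
    rw [norm_smul, norm_eq_of_mem_sphere y, mul_one, Real.norm_of_nonneg (le_of_lt hρ)]
  simp only [h3]
  rw [integral_smul]

theorem transformMean_eq {lam α : ℝ} (hlam : 0 < lam) {g : E m × ℝ≥0 → ℂ} (hg : Measurable g)
    {M : ℝ} (hM : ∀ p, ‖g p‖ ≤ M) :
    transformMean m lam α g = (kappa (m + 1) * (lam ^ α) ^ (m + 1))⁻¹ •
      ∫ ρ in Set.Ioi (0 : ℝ), ρ ^ m • (capArea m (capHeight (lam ^ α) ρ) •
        sphereIntegral m g (scalingFactor (m + 1) lam α)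
          (Real.toNNReal (scalingFactor (m + 1) lam α ^ 2 * (1 - ρ / (1 + lam ^ α))))) := by
  rw [transformMean, integral_perturbed (F := fun z => g (scalingTransform m lam α z))
    (Real.rpow_pos_of_pos hlam α) (hg.comp (measurable_scalingTransform lam α)) fun _ => hM _]
  congr 1
  refine setIntegral_congr_fun measurableSet_Ioi fun ρ hρ => ?_
  simp only [sphereIntegral, scalingTransform]
  congr 2
  refine integral_congr_ae (.of_forall fun y => ?_)
  have hρ' : (0 : ℝ) < ρ := hρ
  have h3 : ‖ρ • (y : E (m + 1))‖ = ρ := by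
    rw [norm_smul, norm_eq_of_mem_sphere y, mul_one, Real.norm_of_nonneg hρ'.le]
  simp only
  rw [h3, smul_smul ρ⁻¹ ρ, inv_mul_cancel₀ hρ'.ne', one_smul]

theorem measurable_sphereIntegral {g : E m × ℝ≥0 → ℂ} (hg : Measurable g) (u : ℝ) :
    Measurable (sphereIntegral m g u) := by
  have h : Measurable fun p : ℝ≥0 × Sph m => g (u • sphereLog (p.2 : E (m + 1)), p.1) :=
    hg.comp (((measurable_sphereLog.comp (measurable_subtype_coe.comp measurable_snd)).const_smul
      u).prodMk measurable_fst)
  exact h.stronglyMeasurable.integral_prod_right.measurable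

theorem capHeight_substitution {r s : ℝ} (hr : 0 < r) (hs : s < 1) :
    capHeight r ((1 + r) * (1 - s)) = s * (2 * r - (1 + r) * s) / (2 * (1 - s)) := by
  have h1 : 1 - s ≠ 0 := by linarith
  have h2 : 1 + r ≠ 0 := by linarith
  rw [capHeight]
  field_simp
  ring

/-- The density of the heights of the rescaled perturbed points at `h`, up to a factor that tends
to `1`. -/
def heightDensity (m : ℕ) (lam r u h : ℝ) : ℝ :=
  lam * (kappa (m + 1) * r ^ (m + 1))⁻¹ * (1 + r) ^ (m + 1) * (u ^ (m + 2))⁻¹ *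
    capArea m (h / u ^ 2 * (2 * r - (1 + r) * (h / u ^ 2)) / (2 * (1 - h / u ^ 2)))

theorem heightDensity_nonneg {lam r u : ℝ} (hlam : 0 ≤ lam) (hr : 0 ≤ r) (hu : 0 ≤ u) (h : ℝ) :
    0 ≤ heightDensity m lam r u h := by
  have := kappa_pos (m + 1)
  have := capArea_nonneg (m := m)
    (h / u ^ 2 * (2 * r - (1 + r) * (h / u ^ 2)) / (2 * (1 - h / u ^ 2)))
  unfold heightDensity
  positivity

theorem measurable_heightDensity (lam r u : ℝ) : Measurable (heightDensity m lam r u) := by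
  unfold heightDensity
  refine (monotone_capArea.measurable.comp ?_).const_mul _
  fun_prop

/-- Substitution `ρ = (1 + r)(1 - h/u²)`. The Jacobian gives `u^{-2}`, and multiplying the spherical
integral by `u^m` to normalise it costs `u^{-m}`; this is the `u^{-(m+2)}` of `heightDensity`. The
factor `(1 - h/u²)^m` comes from `ρ^m`. -/
theorem mul_transformMean_eq (hm : 1 ≤ m) {lam α : ℝ} (hlam : 0 < lam)
    (hu : 0 < scalingFactor (m + 1) lam α)
    {g : E m × ℝ≥0 → ℂ} (hg : Measurable g) {M : ℝ} (hM : ∀ p, ‖g p‖ ≤ M) :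
    lam * transformMean m lam α g = ∫ h in Set.Ioi (0 : ℝ),
      (Set.Iio (scalingFactor (m + 1) lam α ^ 2)).indicator (fun h =>
        ((1 - h / scalingFactor (m + 1) lam α ^ 2) ^ m *
          heightDensity m lam (lam ^ α) (scalingFactor (m + 1) lam α) h) •
        (scalingFactor (m + 1) lam α ^ m •
          sphereIntegral m g (scalingFactor (m + 1) lam α) (Real.toNNReal h))) h := by
  rw [transformMean_eq hlam hg hM]
  set u := scalingFactor (m + 1) lam α
  have hr : 0 < lam ^ α := Real.rpow_pos_of_pos hlam α
  set r := lam ^ α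
  have hκ := kappa_pos (m + 1)
  let Φ : ℝ → ℂ := fun ρ => ρ ^ m • (capArea m (capHeight r ρ) •
    sphereIntegral m g u (Real.toNNReal (u ^ 2 * (1 - ρ / (1 + r)))))
  -- Beyond radius `1 + r` the cap height is nonpositive and the cap is null.
  have h1 : ∫ ρ in Set.Ioi (0 : ℝ), Φ ρ = ∫ ρ, (Set.Ioo 0 (1 + r)).indicator Φ ρ := by
    rw [integral_indicator measurableSet_Ioo, ← integral_Ioc_eq_integral_Ioo]
    refine setIntegral_eq_of_subset_of_forall_sdiff_eq_zero measurableSet_Ioi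
      (show Set.Ioc 0 (1 + r) ⊆ Set.Ioi 0 from fun x hx => hx.1) fun ρ hρ => ?_
    have hρ1 : 0 < ρ := hρ.1
    have hρ2 : 1 + r < ρ := by
      by_contra hlt
      exact hρ.2 ⟨hρ1, not_lt.1 hlt⟩
    have h0 : capHeight r ρ ≤ 0 := div_nonpos_of_nonpos_of_nonneg (by nlinarith) (by linarith)
    simp only [Φ]
    rw [capArea_of_nonpos hm h0, zero_smul, smul_zero]
  have h2 : ∫ ρ, (Set.Ioo 0 (1 + r)).indicator Φ ρ = ((1 + r) / u ^ 2) •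
      ∫ h, (Set.Ioo 0 (1 + r)).indicator Φ ((1 + r) - (1 + r) / u ^ 2 * h) := by
    have h3 := Measure.integral_comp_mul_left
      (fun x => (Set.Ioo 0 (1 + r)).indicator Φ ((1 + r) - x)) ((1 + r) / u ^ 2)
    rw [h3, integral_sub_left_eq_self (fun x => (Set.Ioo 0 (1 + r)).indicator Φ x),
      abs_of_pos (by positivity), smul_smul, mul_inv_cancel₀ (by positivity), one_smul]
  have h4 : ∀ h, (Set.Ioo 0 (1 + r)).indicator Φ ((1 + r) - (1 + r) / u ^ 2 * h)
      = (Set.Ioo 0 (u ^ 2)).indicator (fun h => Φ ((1 + r) * (1 - h / u ^ 2))) h := by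
    intro h
    have he : (1 + r) - (1 + r) / u ^ 2 * h = (1 + r) * (1 - h / u ^ 2) := by ring
    have hiff : (1 + r) * (1 - h / u ^ 2) ∈ Set.Ioo 0 (1 + r) ↔ h ∈ Set.Ioo 0 (u ^ 2) := by
      have hr1 : 0 < 1 + r := by linarith
      have hu2 : 0 < u ^ 2 := by positivity
      rw [Set.mem_Ioo, Set.mem_Ioo, mul_pos_iff_of_pos_left hr1, mul_lt_iff_lt_one_right hr1,
        sub_pos, sub_lt_self_iff, div_lt_one hu2, div_pos_iff_of_pos_right hu2]
      tauto
    rw [he]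
    by_cases hh : h ∈ Set.Ioo 0 (u ^ 2)
    · rw [Set.indicator_of_mem hh, Set.indicator_of_mem (hiff.2 hh)]
    · rw [Set.indicator_of_notMem hh, Set.indicator_of_notMem fun h' => hh (hiff.1 h')]
  change (lam : ℂ) * ((kappa (m + 1) * r ^ (m + 1))⁻¹ • ∫ ρ in Set.Ioi (0 : ℝ), Φ ρ) = _
  rw [h1, h2]
  simp_rw [h4]
  rw [← Complex.real_smul, smul_smul, smul_smul, ← integral_smul,
    ← integral_indicator measurableSet_Ioi]
  refine integral_congr_ae (.of_forall fun h => ?_)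
  have hset : Set.Ioo 0 (u ^ 2) = Set.Ioi 0 ∩ Set.Iio (u ^ 2) := rfl
  simp only [hset]
  rw [← Set.indicator_indicator]
  by_cases hh : h ∈ Set.Ioi (0 : ℝ)
  · rw [Set.indicator_of_mem hh, Set.indicator_of_mem hh]
    by_cases hh2 : h ∈ Set.Iio (u ^ 2)
    · rw [Set.indicator_of_mem hh2, Set.indicator_of_mem hh2]
      have hs : h / u ^ 2 < 1 := (div_lt_one (by positivity)).2 hh2
      have hr1 : 1 + r ≠ 0 := by positivity
      have he : u ^ 2 * (1 - (1 + r) * (1 - h / u ^ 2) / (1 + r)) = h := by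
        field_simp
        ring
      simp only [Φ, he]
      rw [capHeight_substitution hr hs]
      simp only [heightDensity, smul_smul]
      congr 1
      rw [mul_pow (1 + r) (1 - h / u ^ 2) m]
      generalize capArea m _ = c
      generalize 1 - h / u ^ 2 = t
      field_simp
      ring
    · rw [Set.indicator_of_notMem hh2, Set.indicator_of_notMem hh2, smul_zero]
  · rw [Set.indicator_of_notMem hh, Set.indicator_of_notMem hh, smul_zero]

end Identity

/-! ### From pointwise limits of height densities to intensities. -/

section Density

variable {m : ℕ}

theorem exists_support_bounds {g : E m × ℝ≥0 → ℂ} (hg : Continuous g)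
    (hgc : HasCompactSupport g) : ∃ R H M : ℝ, 0 ≤ M ∧ (∀ v h, R < ‖v‖ → g (v, h) = 0) ∧
      (∀ v (h : ℝ≥0), H < h → g (v, h) = 0) ∧ ∀ p, ‖g p‖ ≤ M := by
  obtain ⟨M, hM⟩ := hgc.exists_bound_of_continuous hg
  obtain ⟨R, hR⟩ := (hgc.isCompact.image continuous_fst).isBounded.exists_norm_le
  obtain ⟨H, hH⟩ := (hgc.isCompact.image continuous_snd).bddAbove
  refine ⟨R, H, M, (norm_nonneg _).trans (hM 0), fun v h hv => ?_, fun v h hh => ?_, hM⟩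
  · by_contra hne
    exact absurd (hR v ⟨(v, h), subset_tsupport g hne, rfl⟩) (not_le.2 hv)
  · by_contra hne
    exact absurd (hH ⟨(v, h), subset_tsupport g hne, rfl⟩)
      (not_le.2 (NNReal.coe_lt_coe.1 hh))

/-- Dominated convergence in the height: `g` vanishes above `H`, the densities are bounded by `C` on
`(0, H]`, and the normalised spherical integrals are bounded by `K`. -/
theorem tendsto_mul_transformMean_of_heightDensity (hm : 1 ≤ m) {α : ℝ} {g : E m × ℝ≥0 → ℂ}
    (hg : Continuous g) (hgc : HasCompactSupport g) {ρ : ℝ → ℝ}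
    (hu : Tendsto (fun lam => scalingFactor (m + 1) lam α) atTop atTop)
    (hρ : ∀ᵐ h ∂volume.restrict (Set.Ioi (0 : ℝ)), Tendsto
      (fun lam => heightDensity m lam (lam ^ α) (scalingFactor (m + 1) lam α) h) atTop (𝓝 (ρ h)))
    (hb : ∀ H, ∃ C, ∀ᶠ lam in atTop, ∀ h, 0 < h → h ≤ H →
      heightDensity m lam (lam ^ α) (scalingFactor (m + 1) lam α) h ≤ C) :
    Tendsto (fun lam : ℝ => lam * transformMean m lam α g) atTop
      (𝓝 (∫ h in Set.Ioi (0 : ℝ), ρ h • ∫ v, g (v, Real.toNNReal h))) := by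
  obtain ⟨R, H, M, hM0, hR, hH, hM⟩ := exists_support_bounds hg hgc
  obtain ⟨C, hC⟩ := hb H
  set u : ℝ → ℝ := fun lam => scalingFactor (m + 1) lam α
  set K := ∫ w, (Metric.closedBall (0 : E m) (2 * R)).indicator (fun _ => M) w
  have hK : 0 ≤ K := integral_nonneg fun w => Set.indicator_nonneg (fun _ _ => hM0) w
  have hlim : Tendsto (fun lam => ∫ h in Set.Ioi (0 : ℝ), (Set.Iio (u lam ^ 2)).indicator (fun h =>
      ((1 - h / u lam ^ 2) ^ m * heightDensity m lam (lam ^ α) (u lam) h) •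
        (u lam ^ m • sphereIntegral m g (u lam) (Real.toNNReal h))) h) atTop
      (𝓝 (∫ h in Set.Ioi (0 : ℝ), ρ h • ∫ v, g (v, Real.toNNReal h))) := by
    refine tendsto_integral_filter_of_dominated_convergence
      ((Set.Iic H).indicator fun _ => C * K) (.of_forall fun lam => ?_) ?_ ?_ ?_
    · have h1 := measurable_heightDensity (m := m) lam (lam ^ α) (u lam)
      have h2 := (measurable_sphereIntegral hg.measurable (u lam)).comp measurable_real_toNNReal
      have h3 : Measurable fun h : ℝ => (1 - h / u lam ^ 2) ^ m := by fun_prop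
      exact (((h3.mul h1).smul (h2.const_smul (u lam ^ m))).indicator
        measurableSet_Iio).aestronglyMeasurable
    · filter_upwards [hC, eventually_gt_atTop 0, hu.eventually_gt_atTop 0,
        hu.eventually_gt_atTop R] with lam hC hlam hu0 huR
      refine (ae_restrict_iff' measurableSet_Ioi).2 (.of_forall fun h hh => ?_)
      have hh0 : 0 < h := hh
      by_cases hhH : h ≤ H
      · have hCK : 0 ≤ C * K := mul_nonneg ((heightDensity_nonneg hlam.le
          (Real.rpow_nonneg hlam.le α) hu0.le h).trans (hC h hh0 hhH)) hK
        rw [Set.indicator_of_mem (show h ∈ Set.Iic H from hhH)]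
        by_cases hhu : h ∈ Set.Iio (u lam ^ 2)
        · rw [Set.indicator_of_mem hhu, norm_smul, norm_mul]
          have hs : h / u lam ^ 2 < 1 := (div_lt_one (by positivity)).2 hhu
          have hs0 : 0 < h / u lam ^ 2 := by positivity
          have hp : ‖(1 - h / u lam ^ 2) ^ m‖ ≤ 1 := by
            rw [norm_pow, Real.norm_of_nonneg (by linarith)]
            exact pow_le_one₀ (by linarith) (by linarith)
          have hd := heightDensity_nonneg (m := m) hlam.le
            (Real.rpow_nonneg hlam.le α) hu0.le h
          refine mul_le_mul ?_ (norm_pow_smul_sphereIntegral_le hm hg.measurable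
            (fun v => hR v _) hM hu0 huR) (norm_nonneg _) (hd.trans (hC h hh0 hhH))
          rw [Real.norm_of_nonneg hd]
          exact (mul_le_of_le_one_left hd hp).trans (hC h hh0 hhH)
        · rw [Set.indicator_of_notMem hhu, norm_zero]
          exact hCK
      · rw [Set.indicator_of_notMem (show h ∉ Set.Iic H from hhH)]
        have hz : sphereIntegral m g (u lam) (Real.toNNReal h) = 0 := by
          rw [sphereIntegral]
          refine integral_eq_zero_of_ae (.of_forall fun y => hH _ _ ?_)
          rw [Real.coe_toNNReal _ hh0.le]
          exact not_le.1 hhH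
        simp [hz]
    · have hfin : volume.restrict (Set.Ioi (0 : ℝ)) (Set.Iic H) ≠ ∞ := by
        rw [Measure.restrict_apply measurableSet_Iic]
        exact (measure_mono (show Set.Iic H ∩ Set.Ioi 0 ⊆ Set.Icc 0 H from
          fun x hx => ⟨le_of_lt hx.2, hx.1⟩)).trans_lt isCompact_Icc.measure_lt_top |>.ne
      exact (integrableOn_const hfin).integrable_indicator measurableSet_Iic
    · filter_upwards [hρ] with h hρ
      have hu2 : Tendsto (fun lam => u lam ^ 2) atTop atTop :=
        (tendsto_pow_atTop two_ne_zero).comp hu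
      have h1 : Tendsto (fun lam => (1 - h / u lam ^ 2) ^ m) atTop (𝓝 1) := by
        simpa using ((hu2.const_div_atTop h).const_sub 1).pow m
      have h2 : Tendsto (fun lam => u lam ^ m • sphereIntegral m g (u lam) (Real.toNNReal h)) atTop
          (𝓝 (∫ v, g (v, Real.toNNReal h))) :=
        (tendsto_pow_smul_sphereIntegral hm hg hR hM (Real.toNNReal h)).comp
          (hu.prodMk tendsto_const_nhds)
      have h3 := (h1.mul hρ).smul h2
      rw [one_mul] at h3
      refine h3.congr' ?_
      filter_upwards [hu2.eventually_gt_atTop h] with lam hlam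
      rw [Set.indicator_of_mem (show h ∈ Set.Iio (u lam ^ 2) from hlam)]
  refine hlim.congr' ?_
  filter_upwards [eventually_gt_atTop 0, hu.eventually_gt_atTop 0] with lam hlam hu0
  exact (mul_transformMean_eq hm hlam hu0 hg.measurable hM).symm

/-- The measure on `[0, ∞)` with density `ρ`. -/
def densityHalfLine (ρ : ℝ → ℝ) : Measure ℝ≥0 :=
  lebesgueHalfLine.withDensity fun h : ℝ≥0 => ENNReal.ofReal (ρ h)

theorem measurableEmbedding_nnreal_coe : MeasurableEmbedding ((↑) : ℝ≥0 → ℝ) :=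
  MeasurableEmbedding.subtype_coe (s := Set.Ici (0 : ℝ)) measurableSet_Ici

theorem isFiniteMeasureOnCompacts_densityHalfLine {ρ : ℝ → ℝ}
    (hb : ∀ H, ∃ C, ∀ h, 0 ≤ h → h ≤ H → ρ h ≤ C) :
    IsFiniteMeasureOnCompacts (densityHalfLine ρ) := by
  refine ⟨fun K hK => ?_⟩
  obtain ⟨H, hH⟩ := hK.bddAbove
  obtain ⟨C, hC⟩ := hb H
  have hvol : lebesgueHalfLine (Set.Iic H) < ∞ := by
    rw [lebesgueHalfLine, measurableEmbedding_nnreal_coe.comap_apply]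
    refine (measure_mono (show ((↑) : ℝ≥0 → ℝ) '' Set.Iic H ⊆ Set.Icc 0 H from ?_)).trans_lt
      isCompact_Icc.measure_lt_top
    rintro _ ⟨x, hx, rfl⟩
    exact ⟨x.2, hx⟩
  refine (measure_mono (show K ⊆ Set.Iic H from fun x hx => hH hx)).trans_lt ?_
  rw [densityHalfLine, withDensity_apply _ measurableSet_Iic]
  refine (setLIntegral_mono measurable_const
    (g := fun _ => ENNReal.ofReal C) fun h hh => ?_).trans_lt ?_
  · exact ENNReal.ofReal_le_ofReal (hC h h.2 hh)
  · rw [setLIntegral_const]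
    exact ENNReal.mul_lt_top ENNReal.ofReal_lt_top hvol

theorem integral_densityHalfLine {ρ : ℝ → ℝ} (hρ : Measurable ρ) (hρ0 : ∀ h, 0 < h → 0 ≤ ρ h)
    (f : ℝ≥0 → ℂ) :
    ∫ h, f h ∂densityHalfLine ρ = ∫ h in Set.Ioi (0 : ℝ), ρ h • f (Real.toNNReal h) := by
  have hmap : Measure.map ((↑) : ℝ≥0 → ℝ) lebesgueHalfLine = volume.restrict (Set.Ici 0) :=
    map_comap_subtype_coe measurableSet_Ici volume
  rw [densityHalfLine, integral_withDensity_eq_integral_toReal_smul (by fun_prop) (by simp),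
    ← integral_Ici_eq_integral_Ioi]
  have h1 := measurableEmbedding_nnreal_coe.integral_map (μ := lebesgueHalfLine)
    fun x => max (ρ x) 0 • f (Real.toNNReal x)
  rw [hmap] at h1
  simp only [Real.toNNReal_coe] at h1
  simp only [ENNReal.toReal_ofReal']
  rw [← h1, integral_Ici_eq_integral_Ioi, integral_Ici_eq_integral_Ioi]
  refine setIntegral_congr_fun measurableSet_Ioi fun x hx => ?_
  simp only [max_eq_left (hρ0 x hx)]

theorem isFiniteMeasureOnCompacts_volume_prod (ν : Measure ℝ≥0) [IsFiniteMeasureOnCompacts ν] :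
    IsFiniteMeasureOnCompacts ((volume : Measure (E m)).prod ν) := by
  infer_instance

theorem integral_volume_prod (ν : Measure ℝ≥0) [IsFiniteMeasureOnCompacts ν]
    {g : E m × ℝ≥0 → ℂ} (hg : Continuous g) (hgc : HasCompactSupport g) :
    ∫ p, g p ∂(volume : Measure (E m)).prod ν = ∫ h, (∫ v, g (v, h)) ∂ν := by
  have := isFiniteMeasureOnCompacts_volume_prod (m := m) ν
  exact integral_prod_symm _ (hg.integrable_of_hasCompactSupport hgc)

theorem tendsto_mul_transformMean_of_density (hm : 1 ≤ m) {α : ℝ} {g : E m × ℝ≥0 → ℂ}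
    (hg : Continuous g) (hgc : HasCompactSupport g) {ρ : ℝ → ℝ} (hρm : Measurable ρ)
    (hρ0 : ∀ h, 0 < h → 0 ≤ ρ h) (hρb : ∀ H, ∃ C, ∀ h, 0 ≤ h → h ≤ H → ρ h ≤ C)
    (hα : heightMeasure m α = densityHalfLine ρ)
    (hu : Tendsto (fun lam => scalingFactor (m + 1) lam α) atTop atTop)
    (hρ : ∀ᵐ h ∂volume.restrict (Set.Ioi (0 : ℝ)), Tendsto
      (fun lam => heightDensity m lam (lam ^ α) (scalingFactor (m + 1) lam α) h) atTop (𝓝 (ρ h)))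
    (hb : ∀ H, ∃ C, ∀ᶠ lam in atTop, ∀ h, 0 < h → h ≤ H →
      heightDensity m lam (lam ^ α) (scalingFactor (m + 1) lam α) h ≤ C) :
    Tendsto (fun lam : ℝ => lam * transformMean m lam α g) atTop
      (𝓝 (∫ p, g p ∂limitIntensity m α)) := by
  have := isFiniteMeasureOnCompacts_densityHalfLine hρb
  rw [limitIntensity, hα, integral_volume_prod _ hg hgc, integral_densityHalfLine hρm hρ0]
  exact tendsto_mul_transformMean_of_heightDensity hm hg hgc hu hρ hb

end Density

/-! ### The regime in which the heights collapse to zero. -/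

section Degenerate

variable {m : ℕ}

theorem surface_real_univ (m : ℕ) :
    (surface m).real Set.univ = ((m + 1 : ℕ) : ℝ) * kappa (m + 1) := by
  have := Measure.toSphere_real_apply_univ (volume : Measure (E (m + 1)))
  rwa [finrank_euclideanSpace_fin] at this

/-- The density of the norm of the perturbed points with respect to Lebesgue measure. -/
def normDensity (m : ℕ) (r ρ : ℝ) : ℝ :=
  ((m + 1 : ℕ) : ℝ) * kappa (m + 1) *
    ((kappa (m + 1) * r ^ (m + 1))⁻¹ * (ρ ^ m * capArea m (capHeight r ρ)))

theorem normDensity_nonneg {r ρ : ℝ} (hr : 0 ≤ r) (hρ : 0 ≤ ρ) : 0 ≤ normDensity m r ρ := by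
  have := kappa_pos (m + 1)
  have := capArea_nonneg (m := m) (capHeight r ρ)
  unfold normDensity
  positivity

theorem measurable_normDensity (r : ℝ) : Measurable (normDensity m r) := by
  have h1 : Measurable fun ρ => capArea m (capHeight r ρ) :=
    monotone_capArea.measurable.comp (measurable_capHeight r)
  unfold normDensity
  fun_prop

theorem abs_sub_one_lt_of_normDensity_ne_zero (hm : 1 ≤ m) {r ρ : ℝ} (hr : 0 < r) (hρ : 0 < ρ)
    (h : normDensity m r ρ ≠ 0) : |ρ - 1| < r := by
  by_contra hle
  rw [not_lt] at hle
  refine h ?_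
  have h0 : capHeight r ρ ≤ 0 := by
    refine div_nonpos_of_nonpos_of_nonneg ?_ (by linarith)
    have := pow_le_pow_left₀ hr.le hle 2
    rw [sq_abs] at this
    nlinarith
  rw [normDensity, capArea_of_nonpos hm h0]
  simp

theorem mul_transformMean_eq_integral_normDensity {lam α u : ℝ} (hlam : 0 < lam)
    (hu : u = scalingFactor (m + 1) lam α)
    {g : E m × ℝ≥0 → ℂ} (hg : Measurable g) {M : ℝ} (hM : ∀ p, ‖g p‖ ≤ M) :
    ((m + 1 : ℕ) : ℝ) * kappa (m + 1) * transformMean m lam α g =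
      ∫ ρ in Set.Ioi (0 : ℝ), normDensity m (lam ^ α) ρ •
        sphereIntegral m g u (Real.toNNReal (u ^ 2 * (1 - ρ / (1 + lam ^ α)))) := by
  subst hu
  rw [transformMean_eq hlam hg hM, ← Complex.ofReal_mul, ← Complex.real_smul, smul_smul,
    ← integral_smul]
  simp only [normDensity, smul_smul, mul_assoc]

/-- The total mass comes from the disintegration formula applied to the constant test function `1`,
with no computation of cap areas. -/
theorem integral_normDensity {lam : ℝ} (hlam : 0 < lam) (α : ℝ) :
    ∫ ρ in Set.Ioi (0 : ℝ), normDensity m (lam ^ α) ρ = 1 := by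
  have hκ := kappa_pos (m + 1)
  have := isProbabilityMeasure_ballUniform (m + 1) (Real.rpow_pos_of_pos hlam α)
  have h := mul_transformMean_eq_integral_normDensity (m := m) (α := α) hlam rfl
    (g := fun _ => 1) measurable_const (M := 1) (by simp)
  have h1 : transformMean m lam α (fun _ => 1) = 1 := by simp [transformMean]
  have h2 : ∀ u t, sphereIntegral m (fun _ => 1) u t
      = ((((m + 1 : ℕ) : ℝ) * kappa (m + 1) : ℝ) : ℂ) := fun u t => by
    rw [sphereIntegral, integral_const, surface_real_univ, Complex.real_smul, mul_one]
  simp only [h1, h2, Complex.real_smul, mul_one] at h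
  rw [integral_mul_const, integral_complex_ofReal, ← Complex.ofReal_mul, ← Complex.ofReal_mul,
    Complex.ofReal_inj] at h
  exact (mul_eq_right₀ (by positivity)).1 h.symm

theorem integrableOn_normDensity {lam : ℝ} (hlam : 0 < lam) (α : ℝ) :
    IntegrableOn (normDensity m (lam ^ α)) (Set.Ioi 0) := by
  by_contra h
  have := integral_normDensity (m := m) hlam α
  -- The integral of a non-integrable function is `0` by convention, which contradicts total mass
  -- `1`.
  rw [integral_undef h] at this
  exact zero_ne_one this

/-- The normalisation `λ = d κ_d u^m` makes the mean an average of normalised spherical integrals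
against the probability density of the norm. This density lives on `|ρ - 1| < r`, where the rescaled
heights are at most `2u²r → 0`, so the averaged quantity is uniformly close to its value at height
`0`. -/
theorem tendsto_mul_transformMean_of_degenerate (hm : 1 ≤ m) {α : ℝ} {g : E m × ℝ≥0 → ℂ}
    (hg : Continuous g) (hgc : HasCompactSupport g)
    (hu : Tendsto (fun lam => scalingFactor (m + 1) lam α) atTop atTop)
    (hlam : ∀ᶠ lam in atTop, lam =
      ((m + 1 : ℕ) : ℝ) * kappa (m + 1) * scalingFactor (m + 1) lam α ^ m)
    (hr : Tendsto (fun lam => scalingFactor (m + 1) lam α ^ 2 * lam ^ α) atTop (𝓝 0)) :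
    Tendsto (fun lam : ℝ => lam * transformMean m lam α g) atTop (𝓝 (∫ v, g (v, 0))) := by
  obtain ⟨R, H, M, hM0, hR, hH, hM⟩ := exists_support_bounds hg hgc
  rw [Metric.tendsto_nhds]
  intro ε hε
  have hG := Metric.tendsto_nhds.1 (tendsto_pow_smul_sphereIntegral hm hg hR hM 0) (ε / 2)
    (half_pos hε)
  obtain ⟨pa, hpa, pb, hpb, hab⟩ := eventually_prod_iff.1 hG
  obtain ⟨δ, hδ, hpb⟩ := Metric.eventually_nhds_iff.1 hpb
  filter_upwards [hlam, eventually_gt_atTop 0, hu.eventually hpa, hu.eventually_gt_atTop 0,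
    hr.eventually_lt_const (half_pos hδ)] with lam hlam hlam0 hpa hu0 hrδ
  set u := scalingFactor (m + 1) lam α with hudef
  have hr0 : 0 < lam ^ α := Real.rpow_pos_of_pos hlam0 α
  set L := ∫ v, g (v, 0)
  let G : ℝ → ℂ := fun ρ =>
    u ^ m • sphereIntegral m g u (Real.toNNReal (u ^ 2 * (1 - ρ / (1 + lam ^ α))))
  have hval : lam * transformMean m lam α g
      = ∫ ρ in Set.Ioi (0 : ℝ), normDensity m (lam ^ α) ρ • G ρ := by
    have h := mul_transformMean_eq_integral_normDensity hlam0 hudef hg.measurable hM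
    have h' : (lam : ℂ) * transformMean m lam α g = u ^ m •
        (((m + 1 : ℕ) : ℝ) * kappa (m + 1) * transformMean m lam α g) := by
      rw [Complex.real_smul]
      nth_rw 1 [hlam]
      push_cast
      ring
    rw [h', h, ← integral_smul]
    simp only [G]
    congr 1
    ext ρ
    rw [smul_comm]
  have hclose : ∀ ρ ∈ Set.Ioi (0 : ℝ), normDensity m (lam ^ α) ρ ≠ 0 → ‖G ρ - L‖ ≤ ε / 2 := by
    intro ρ hρ hne
    have habs := abs_lt.1 (abs_sub_one_lt_of_normDensity_ne_zero hm hr0 hρ hne)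
    have h1 : 1 - ρ / (1 + lam ^ α) ≤ 2 * lam ^ α := by
      have h2 : 1 - ρ / (1 + lam ^ α) = (1 + lam ^ α - ρ) / (1 + lam ^ α) := by
        field_simp
      rw [h2, div_le_iff₀ (by linarith)]
      nlinarith
    have h3 : u ^ 2 * (1 - ρ / (1 + lam ^ α)) < δ :=
      calc u ^ 2 * (1 - ρ / (1 + lam ^ α)) ≤ u ^ 2 * (2 * lam ^ α) := by gcongr
        _ < δ := by linarith
    have h4 : dist (Real.toNNReal (u ^ 2 * (1 - ρ / (1 + lam ^ α)))) 0 < δ := by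
      rw [NNReal.dist_eq, NNReal.coe_zero, sub_zero, abs_of_nonneg (NNReal.coe_nonneg _),
        Real.coe_toNNReal']
      exact max_lt h3 hδ
    rw [← dist_eq_norm]
    exact (hab hpa (hpb h4)).le
  have hint := integrableOn_normDensity (m := m) hlam0 α
  have hGm : Measurable G := by
    have h1 : Measurable fun ρ => Real.toNNReal (u ^ 2 * (1 - ρ / (1 + lam ^ α))) := by fun_prop
    exact ((measurable_sphereIntegral hg.measurable u).comp h1).const_smul (u ^ m)
  have hbound : ∀ ρ ∈ Set.Ioi (0 : ℝ), ‖normDensity m (lam ^ α) ρ • (G ρ - L)‖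
      ≤ normDensity m (lam ^ α) ρ * (ε / 2) := by
    intro ρ hρ
    have hn := normDensity_nonneg (m := m) hr0.le (le_of_lt hρ)
    rw [norm_smul, Real.norm_of_nonneg hn]
    rcases eq_or_ne (normDensity m (lam ^ α) ρ) 0 with h0 | h0
    · simp [h0]
    · exact mul_le_mul_of_nonneg_left (hclose ρ hρ h0) hn
  have hint2 : IntegrableOn (fun ρ => normDensity m (lam ^ α) ρ • (G ρ - L)) (Set.Ioi 0) :=
    (hint.mul_const (ε / 2)).mono' (((measurable_normDensity _).smul
      (hGm.sub_const L)).aestronglyMeasurable)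
      ((ae_restrict_iff' measurableSet_Ioi).2 (.of_forall hbound))
  have hdiff : lam * transformMean m lam α g - L
      = ∫ ρ in Set.Ioi (0 : ℝ), normDensity m (lam ^ α) ρ • (G ρ - L) := by
    have h1 : ∀ ρ, normDensity m (lam ^ α) ρ • G ρ
        = normDensity m (lam ^ α) ρ • (G ρ - L) + normDensity m (lam ^ α) ρ • L := fun ρ => by
      rw [← smul_add, sub_add_cancel]
    rw [hval]
    simp_rw [h1]
    rw [integral_add hint2 (hint.smul_const L), integral_smul_const, integral_normDensity hlam0,
      one_smul, add_sub_cancel_right]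
  rw [dist_eq_norm, hdiff]
  refine (norm_integral_le_of_norm_le (hint.mul_const (ε / 2))
    ((ae_restrict_iff' measurableSet_Ioi).2 (.of_forall hbound))).trans_lt ?_
  rw [integral_mul_const, integral_normDensity hlam0]
  linarith

end Degenerate

/-! ### Asymptotics of the height density for small and for large caps. -/

section Caps

variable {m : ℕ}

/-- For `w₀ > 0` this is the asymptotic law of cap areas; for `w₀ ≤ 0` only the upper bound
`exists_capArea_le` is available, and it suffices. Nonpositive `w₀` occurs in the section regime, at
heights beyond the section. -/
theorem tendsto_capArea_mul_div (hm : 1 ≤ m) {ι : Type*} {l : Filter ι} {t w : ι → ℝ} {w₀ : ℝ}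
    (ht : ∀ᶠ i in l, 0 < t i) (ht0 : Tendsto t l (𝓝 0)) (hw : Tendsto w l (𝓝 w₀)) :
    Tendsto (fun i => capArea m (t i * w i) / t i ^ ((m : ℝ) / 2)) l
      (𝓝 (capConst m * max 0 w₀ ^ ((m : ℝ) / 2))) := by
  have hm2 : (0 : ℝ) < (m : ℝ) / 2 := by
    have : (1 : ℝ) ≤ m := by exact_mod_cast hm
    positivity
  rcases le_or_gt w₀ 0 with hw₀ | hw₀
  · rw [max_eq_left hw₀, Real.zero_rpow hm2.ne', mul_zero]
    obtain ⟨C, hC0, hC⟩ := exists_capArea_le hm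
    have hlim : Tendsto (fun i => C * max 0 (w i) ^ ((m : ℝ) / 2)) l (𝓝 0) := by
      have h := (((tendsto_const_nhds (x := (0 : ℝ))).max hw).rpow_const
        (p := (m : ℝ) / 2) (Or.inr hm2.le)).const_mul C
      rwa [max_eq_left hw₀, Real.zero_rpow hm2.ne', mul_zero] at h
    refine tendsto_of_tendsto_of_tendsto_of_le_of_le' tendsto_const_nhds hlim ?_ ?_
    · filter_upwards [ht] with i hi
      exact div_nonneg (capArea_nonneg _) (by positivity)
    · filter_upwards [ht] with i hi
      rw [div_le_iff₀ (by positivity), mul_assoc, ← Real.mul_rpow (le_max_left _ _) hi.le]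
      refine hC _ _ ?_ (by positivity)
      rw [mul_comm]
      exact mul_le_mul_of_nonneg_right (le_max_right _ _) hi.le
  · rw [max_eq_right hw₀.le]
    have hwpos : ∀ᶠ i in l, 0 < w i := hw.eventually_const_lt hw₀
    have htw : Tendsto (fun i => t i * w i) l (𝓝[>] 0) := by
      refine tendsto_nhdsWithin_iff.2 ⟨by simpa using ht0.mul hw, ?_⟩
      filter_upwards [ht, hwpos] with i h1 h2
      exact mul_pos h1 h2
    refine (((tendsto_capArea_div m).comp htw).mul
      (hw.rpow_const (p := (m : ℝ) / 2) (Or.inr hm2.le))).congr' ?_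
    filter_upwards [ht, hwpos] with i h1 h2
    simp only [Function.comp]
    rw [Real.mul_rpow h1.le h2.le]
    have h3 : w i ^ ((m : ℝ) / 2) ≠ 0 := by positivity
    have h4 : t i ^ ((m : ℝ) / 2) ≠ 0 := by positivity
    field_simp

/-- The height of the cap that governs `heightDensity`, divided by `r / u ^ 2`. -/
def reducedHeight (r u h : ℝ) : ℝ :=
  h * (1 - ((u ^ 2 * r)⁻¹ + (u ^ 2)⁻¹) * h / 2) / (1 - h / u ^ 2)

theorem heightDensity_eq_capArea_reducedHeight {lam r u : ℝ} (hr : 0 < r) (hu : 0 < u) (h : ℝ) :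
    heightDensity m lam r u h = lam * (kappa (m + 1))⁻¹ * (u ^ (m + 2))⁻¹ *
      ((1 + r) / r) ^ (m + 1) * capArea m (r / u ^ 2 * reducedHeight r u h) := by
  have he : h / u ^ 2 * (2 * r - (1 + r) * (h / u ^ 2)) / (2 * (1 - h / u ^ 2))
      = r / u ^ 2 * reducedHeight r u h := by
    unfold reducedHeight
    rw [← mul_div_assoc, mul_comm (2 : ℝ), ← div_div, div_right_comm]
    field_simp
  rw [heightDensity, he, div_pow, mul_inv]
  ring

theorem tendsto_reducedHeight {ι : Type*} {l : Filter ι} {r u : ι → ℝ} {β : ℝ}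
    (hu : Tendsto u l atTop) (hβ : Tendsto (fun i => (u i ^ 2 * r i)⁻¹) l (𝓝 β)) (h : ℝ) :
    Tendsto (fun i => reducedHeight (r i) (u i) h) l (𝓝 (h * (1 - β * h / 2))) := by
  have hu2 : Tendsto (fun i => u i ^ 2) l atTop := (tendsto_pow_atTop two_ne_zero).comp hu
  have h1 : Tendsto (fun i => 1 - h / u i ^ 2) l (𝓝 1) := by
    simpa using (hu2.const_div_atTop h).const_sub 1
  have h2 := ((((hβ.add hu2.inv_tendsto_atTop).mul_const h).div_const 2).const_sub 1).const_mul h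
  rw [add_zero] at h2
  have h3 := h2.div h1 one_ne_zero
  rw [div_one] at h3
  exact h3

theorem reducedHeight_le {r u h H : ℝ} (hr : 0 < r) (hu : 0 < u) (h0 : 0 < h) (hH : h ≤ H)
    (hu2 : 2 * H ≤ u ^ 2) : reducedHeight r u h ≤ 2 * H := by
  have hs : h / u ^ 2 ≤ 1 / 2 := by
    rw [div_le_iff₀ (by positivity)]
    linarith
  have h1 : 0 ≤ ((u ^ 2 * r)⁻¹ + (u ^ 2)⁻¹) * h / 2 := by positivity
  rw [reducedHeight, div_le_iff₀ (by linarith)]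
  nlinarith

/-- The parameter `β` records the curvature of the perturbation ball at the scale of the heights: it
vanishes in the middle range and is positive when `u²r` stays bounded. `B` collects the prefactor
with the power of `r/u²` extracted from the cap area. -/
theorem tendsto_heightDensity_of_small_cap (hm : 1 ≤ m) {r u : ℝ → ℝ} {β B : ℝ}
    (hu : Tendsto u atTop atTop) (hr : ∀ᶠ lam in atTop, 0 < r lam)
    (ht : Tendsto (fun lam => r lam / u lam ^ 2) atTop (𝓝 0))
    (hβ : Tendsto (fun lam => (u lam ^ 2 * r lam)⁻¹) atTop (𝓝 β))
    (hB : Tendsto (fun lam => lam * (kappa (m + 1))⁻¹ * (u lam ^ (m + 2))⁻¹ *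
      ((1 + r lam) / r lam) ^ (m + 1) * (r lam / u lam ^ 2) ^ ((m : ℝ) / 2)) atTop (𝓝 B)) :
    (∀ h, Tendsto (fun lam => heightDensity m lam (r lam) (u lam) h) atTop
      (𝓝 (B * (capConst m * max 0 (h * (1 - β * h / 2)) ^ ((m : ℝ) / 2))))) ∧
    ∀ H, ∃ C, ∀ᶠ lam in atTop, ∀ h, 0 < h → h ≤ H →
      heightDensity m lam (r lam) (u lam) h ≤ C := by
  have htpos : ∀ᶠ lam in atTop, 0 < r lam / u lam ^ 2 := by
    filter_upwards [hr, hu.eventually_gt_atTop 0] with lam h1 h2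
    positivity
  constructor
  · intro h
    refine (hB.mul (tendsto_capArea_mul_div hm htpos ht
      (tendsto_reducedHeight hu hβ h))).congr' ?_
    filter_upwards [hr, hu.eventually_gt_atTop 0] with lam h1 h2
    rw [heightDensity_eq_capArea_reducedHeight h1 h2]
    have h3 : (r lam / u lam ^ 2) ^ ((m : ℝ) / 2) ≠ 0 := by positivity
    field_simp
  · intro H
    obtain ⟨C, hC0, hC⟩ := exists_capArea_le hm
    rcases le_or_gt H 0 with hH | hH
    · exact ⟨0, .of_forall fun lam h h1 h2 => by linarith⟩
    refine ⟨(B + 1) * (C * (2 * H) ^ ((m : ℝ) / 2)), ?_⟩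
    have hu2 : Tendsto (fun lam => u lam ^ 2) atTop atTop :=
      (tendsto_pow_atTop two_ne_zero).comp hu
    filter_upwards [hr, hu.eventually_gt_atTop 0, hu2.eventually_ge_atTop (2 * H),
      hB.eventually_lt_const (lt_add_one B), eventually_gt_atTop 0] with lam h1 h2 h3 h4 h5 h h6 h7
    rw [heightDensity_eq_capArea_reducedHeight h1 h2]
    have hκ := kappa_pos (m + 1)
    have hcap : capArea m (r lam / u lam ^ 2 * reducedHeight (r lam) (u lam) h)
        ≤ C * (r lam / u lam ^ 2 * (2 * H)) ^ ((m : ℝ) / 2) :=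
      hC _ _ (mul_le_mul_of_nonneg_left (reducedHeight_le h1 h2 h6 h7 h3) (by positivity))
        (by positivity)
    rw [Real.mul_rpow (by positivity) (by positivity)] at hcap
    calc _ ≤ lam * (kappa (m + 1))⁻¹ * (u lam ^ (m + 2))⁻¹ * ((1 + r lam) / r lam) ^ (m + 1) *
          (C * ((r lam / u lam ^ 2) ^ ((m : ℝ) / 2) * (2 * H) ^ ((m : ℝ) / 2))) :=
          mul_le_mul_of_nonneg_left hcap (by positivity)
      _ = lam * (kappa (m + 1))⁻¹ * (u lam ^ (m + 2))⁻¹ * ((1 + r lam) / r lam) ^ (m + 1) *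
          (r lam / u lam ^ 2) ^ ((m : ℝ) / 2) * (C * (2 * H) ^ ((m : ℝ) / 2)) := by ring
      _ ≤ _ := mul_le_mul_of_nonneg_right h4.le (by positivity)

theorem tendsto_one_add_div {r : ℝ → ℝ} (hr : Tendsto r atTop atTop) :
    Tendsto (fun lam => (1 + r lam) / r lam) atTop (𝓝 1) := by
  have h := hr.inv_tendsto_atTop.add_const 1
  rw [zero_add] at h
  refine h.congr' ?_
  filter_upwards [hr.eventually_gt_atTop 0] with lam h
  simp only [Pi.inv_apply]
  field_simp

/-- When `r → ∞` the ratio `(1 + r)/r` tends to `1` and `u` is chosen so that the rest of the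
prefactor is exactly `1`; only the cap area survives. -/
theorem tendsto_heightDensity_of_large_cap {r u : ℝ → ℝ} {h q : ℝ}
    (hu : Tendsto u atTop atTop) (hr : Tendsto r atTop atTop)
    (hlam : ∀ᶠ lam in atTop, lam * (kappa (m + 1))⁻¹ * (u lam ^ (m + 2))⁻¹ = 1)
    (hq : Tendsto (fun lam => capArea m (r lam / u lam ^ 2 * reducedHeight (r lam) (u lam) h))
      atTop (𝓝 q)) :
    Tendsto (fun lam => heightDensity m lam (r lam) (u lam) h) atTop (𝓝 q) := by
  have h1 := ((tendsto_one_add_div hr).pow (m + 1)).mul hq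
  rw [one_pow, one_mul] at h1
  refine h1.congr' ?_
  filter_upwards [hlam, hr.eventually_gt_atTop 0, hu.eventually_gt_atTop 0] with lam h1 h2 h3
  rw [heightDensity_eq_capArea_reducedHeight h2 h3, h1, one_mul]

theorem exists_heightDensity_le_of_large_cap {r u : ℝ → ℝ}
    (hu : Tendsto u atTop atTop) (hr : Tendsto r atTop atTop)
    (hlam : ∀ᶠ lam in atTop, lam * (kappa (m + 1))⁻¹ * (u lam ^ (m + 2))⁻¹ = 1) (H : ℝ) :
    ∃ C, ∀ᶠ lam in atTop, ∀ h, 0 < h → h ≤ H → heightDensity m lam (r lam) (u lam) h ≤ C := by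
  refine ⟨2 ^ (m + 1), ?_⟩
  filter_upwards [hlam, hr.eventually_ge_atTop 1, hu.eventually_gt_atTop 0] with lam h1 h2 h3 h _ _
  have hr0 : 0 < r lam := by linarith
  rw [heightDensity_eq_capArea_reducedHeight hr0 h3, h1, one_mul]
  have h4 : (1 + r lam) / r lam ≤ 2 := by
    rw [div_le_iff₀ hr0]
    linarith
  calc _ ≤ ((1 + r lam) / r lam) ^ (m + 1) * 1 :=
        mul_le_mul_of_nonneg_left (capArea_le_one _) (by positivity)
    _ ≤ 2 ^ (m + 1) := by
        rw [mul_one]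
        exact pow_le_pow_left₀ (by positivity) h4 _

theorem tendsto_inv_sq_mul {r u : ℝ → ℝ} (hu : Tendsto u atTop atTop)
    (hr : Tendsto r atTop atTop) : Tendsto (fun lam => (u lam ^ 2 * r lam)⁻¹) atTop (𝓝 0) :=
  ((((tendsto_pow_atTop two_ne_zero).comp hu).atTop_mul_atTop₀ hr)).inv_tendsto_atTop

end Caps

/-! ### Powers of `λ` and the constants of the scaling factor. -/

section Regimes

variable {m : ℕ}

theorem tendsto_const_mul_rpow_atTop {c e : ℝ} (hc : 0 < c) (he : 0 < e) :
    Tendsto (fun lam : ℝ => c * lam ^ e) atTop atTop :=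
  (tendsto_rpow_atTop he).const_mul_atTop hc

theorem tendsto_const_mul_rpow_zero (c : ℝ) {e : ℝ} (he : e < 0) :
    Tendsto (fun lam : ℝ => c * lam ^ e) atTop (𝓝 0) := by
  have h := (tendsto_rpow_neg_atTop (neg_pos.2 he)).const_mul c
  rwa [mul_zero, neg_neg] at h

theorem const_mul_rpow_pow {lam : ℝ} (hlam : 0 ≤ lam) (c e : ℝ) (k : ℕ) :
    (c * lam ^ e) ^ k = c ^ k * lam ^ (e * k) := by
  rw [mul_pow, ← Real.rpow_mul_natCast hlam]

theorem rpow_div_sq_const_mul_rpow {lam : ℝ} (hlam : 0 < lam) (α c e : ℝ) :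
    lam ^ α / (c * lam ^ e) ^ 2 = (c ^ 2)⁻¹ * lam ^ (α - 2 * e) := by
  rw [const_mul_rpow_pow hlam.le, Real.rpow_sub hlam, mul_comm e, div_mul_eq_div_div_swap]
  push_cast
  rw [div_eq_mul_inv, mul_comm]

theorem inv_sq_const_mul_rpow_mul_rpow {lam : ℝ} (hlam : 0 < lam) (α c e : ℝ) :
    ((c * lam ^ e) ^ 2 * lam ^ α)⁻¹ = (c ^ 2)⁻¹ * lam ^ (-(α + 2 * e)) := by
  rw [const_mul_rpow_pow hlam.le, Real.rpow_neg hlam.le, Real.rpow_add hlam, mul_comm e]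
  push_cast
  rw [mul_assoc, mul_inv, mul_comm (lam ^ α)]

/-- All powers of `λ` are collected except `((1 + r)/r)^{m+1}`, whose behaviour depends on the sign
of `α`. -/
theorem small_cap_factor_eq {lam c : ℝ} (hlam : 0 < lam) (hc : 0 < c) (α e : ℝ) :
    lam * (kappa (m + 1))⁻¹ * ((c * lam ^ e) ^ (m + 2))⁻¹ *
      ((1 + lam ^ α) / lam ^ α) ^ (m + 1) * (lam ^ α / (c * lam ^ e) ^ 2) ^ ((m : ℝ) / 2)
    = (kappa (m + 1))⁻¹ * (c ^ (2 * (m + 1)))⁻¹ *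
      (lam ^ (1 - e * (2 * ((m : ℝ) + 1)) + α * ((m : ℝ) / 2)) *
        ((1 + lam ^ α) / lam ^ α) ^ (m + 1)) := by
  have h1 : (lam ^ α / (c * lam ^ e) ^ 2) ^ ((m : ℝ) / 2)
      = lam ^ (α * ((m : ℝ) / 2)) * ((c * lam ^ e) ^ m)⁻¹ := by
    rw [Real.div_rpow (by positivity) (by positivity), ← Real.rpow_mul hlam.le,
      ← Real.rpow_natCast_mul (by positivity), div_eq_mul_inv, ← Real.rpow_natCast]
    congr 3
    push_cast
    ring
  have h2 : lam ^ (1 - e * (2 * ((m : ℝ) + 1)) + α * ((m : ℝ) / 2))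
      = lam * (lam ^ (e * (2 * (m + 1) : ℕ)))⁻¹ * lam ^ (α * ((m : ℝ) / 2)) := by
    rw [Real.rpow_add hlam, Real.rpow_sub hlam, Real.rpow_one, div_eq_mul_inv]
    push_cast
    rfl
  have h3 : ((c * lam ^ e) ^ (m + 2))⁻¹ * ((c * lam ^ e) ^ m)⁻¹
      = (c ^ (2 * (m + 1)))⁻¹ * (lam ^ (e * (2 * (m + 1) : ℕ)))⁻¹ := by
    rw [← mul_inv, ← pow_add, ← mul_inv, ← const_mul_rpow_pow hlam.le]
    congr 2
    ring
  rw [h1, h2]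
  linear_combination (lam * (kappa (m + 1))⁻¹ * ((1 + lam ^ α) / lam ^ α) ^ (m + 1) *
    lam ^ (α * ((m : ℝ) / 2))) * h3

theorem heightDensity_limits_of_small_cap (hm : 1 ≤ m) {α c e β B : ℝ} (hc : 0 < c) (he : 0 < e)
    (h1 : α < 2 * e)
    (hβ : Tendsto (fun lam : ℝ => (c ^ 2)⁻¹ * lam ^ (-(α + 2 * e))) atTop (𝓝 β))
    (hB : Tendsto (fun lam : ℝ => (kappa (m + 1))⁻¹ * (c ^ (2 * (m + 1)))⁻¹ *
      (lam ^ (1 - e * (2 * ((m : ℝ) + 1)) + α * ((m : ℝ) / 2)) *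
        ((1 + lam ^ α) / lam ^ α) ^ (m + 1))) atTop (𝓝 B)) :
    (∀ h, Tendsto (fun lam => heightDensity m lam (lam ^ α) (c * lam ^ e) h) atTop
      (𝓝 (B * (capConst m * max 0 (h * (1 - β * h / 2)) ^ ((m : ℝ) / 2))))) ∧
    ∀ H, ∃ C, ∀ᶠ lam in atTop, ∀ h, 0 < h → h ≤ H →
      heightDensity m lam (lam ^ α) (c * lam ^ e) h ≤ C := by
  have hpos := eventually_gt_atTop (0 : ℝ)
  refine tendsto_heightDensity_of_small_cap hm (tendsto_const_mul_rpow_atTop hc he)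
    (hpos.mono fun lam hlam => Real.rpow_pos_of_pos hlam α) ?_ ?_ ?_
  · refine (tendsto_const_mul_rpow_zero (c ^ 2)⁻¹ (sub_neg.2 h1)).congr' ?_
    filter_upwards [hpos] with lam hlam
    rw [rpow_div_sq_const_mul_rpow hlam]
  · refine hβ.congr' ?_
    filter_upwards [hpos] with lam hlam
    rw [inv_sq_const_mul_rpow_mul_rpow hlam]
  · refine hB.congr' ?_
    filter_upwards [hpos] with lam hlam
    rw [small_cap_factor_eq hlam hc]

/-- This explains the constant: with it the prefactor tends to the inverse of `capConst`, and the
limiting density is `h^{m/2}` with no constant. -/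
theorem scalingConst_eq (m : ℕ) : scalingConst (m + 1) = capConst m / kappa (m + 1) := by
  have := kappa_pos (m + 1)
  unfold scalingConst capConst
  rw [Nat.add_sub_cancel, Nat.cast_add_one, add_sub_cancel_right]
  field_simp

theorem scalingConst_pos (m : ℕ) : 0 < scalingConst (m + 1) := by
  rw [scalingConst_eq]
  exact div_pos (capConst_pos m) (kappa_pos _)

theorem rpow_inv_two_mul_pow {C : ℝ} (hC : 0 ≤ C) :
    (C ^ (1 / (2 * ((m + 1 : ℕ) : ℝ)))) ^ (2 * (m + 1)) = C := by
  rw [← Real.rpow_mul_natCast hC]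
  push_cast
  rw [one_div_mul_cancel (by positivity), Real.rpow_one]

theorem heightMeasure_of_middle {α : ℝ} (h1 : α < 2 / ((m : ℝ) + 2))
    (h2 : -2 / (m : ℝ) < α) :
    heightMeasure m α = densityHalfLine fun h => h ^ ((m : ℝ) / 2) := by
  have h3 : ((m + 1 : ℕ) : ℝ) + 1 = (m : ℝ) + 2 := by push_cast; ring
  have h4 : ((m + 1 : ℕ) : ℝ) - 1 = (m : ℝ) := by push_cast; ring
  simp only [heightMeasure, h3, h4]
  rw [if_neg h1.not_gt, if_neg h1.ne, if_pos h2, densityHalfLine]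

theorem tendsto_mul_transformMean_of_middle (hm : 1 ≤ m) {α c e : ℝ} {g : E m × ℝ≥0 → ℂ}
    (hg : Continuous g) (hgc : HasCompactSupport g) (hc : 0 < c) (he : 0 < e)
    (hα1 : α < 2 / ((m : ℝ) + 2)) (hα2 : -2 / (m : ℝ) < α)
    (hu : ∀ lam, scalingFactor (m + 1) lam α = c * lam ^ e)
    (h1 : α < 2 * e) (h2 : 0 < α + 2 * e)
    (hB : Tendsto (fun lam : ℝ => (kappa (m + 1))⁻¹ * (c ^ (2 * (m + 1)))⁻¹ *
      (lam ^ (1 - e * (2 * ((m : ℝ) + 1)) + α * ((m : ℝ) / 2)) *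
        ((1 + lam ^ α) / lam ^ α) ^ (m + 1))) atTop (𝓝 (capConst m)⁻¹)) :
    Tendsto (fun lam : ℝ => lam * transformMean m lam α g) atTop
      (𝓝 (∫ p, g p ∂limitIntensity m α)) := by
  obtain ⟨hlim, hb⟩ := heightDensity_limits_of_small_cap hm hc he h1
    (tendsto_const_mul_rpow_zero (c ^ 2)⁻¹ (neg_neg_of_pos h2)) hB
  have hcc := capConst_pos m
  refine tendsto_mul_transformMean_of_density hm hg hgc (ρ := fun h => h ^ ((m : ℝ) / 2))
    (by fun_prop) (fun h hh => by positivity) (fun H => ⟨H ^ ((m : ℝ) / 2), fun h h0 hH =>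
      Real.rpow_le_rpow h0 hH (by positivity)⟩) (heightMeasure_of_middle hα1 hα2) ?_ ?_ ?_
  · simp only [hu]
    exact tendsto_const_mul_rpow_atTop hc he
  · refine (ae_restrict_iff' measurableSet_Ioi).2 (.of_forall fun h hh => ?_)
    have hh0 : 0 < h := hh
    have := hlim h
    simp only [zero_mul, zero_div, sub_zero, mul_one, max_eq_right hh0.le] at this
    rw [inv_mul_cancel_left₀ hcc.ne'] at this
    simpa only [hu] using this
  · simpa only [hu] using hb

end Regimes

/-! ### Small caps: the middle range and the section regime. -/

section Cases

variable {m : ℕ} {α : ℝ} {g : E m × ℝ≥0 → ℂ}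

theorem cast_succ_add_one (m : ℕ) : ((m + 1 : ℕ) : ℝ) + 1 = (m : ℝ) + 2 := by
  push_cast
  ring

theorem cast_succ_sub_one (m : ℕ) : ((m + 1 : ℕ) : ℝ) - 1 = (m : ℝ) := by
  push_cast
  ring

theorem tendsto_mul_transformMean_of_pos (hm : 1 ≤ m) (hg : Continuous g)
    (hgc : HasCompactSupport g) (hα0 : 0 < α) (hα : α < 2 / ((m : ℝ) + 2)) :
    Tendsto (fun lam : ℝ => lam * transformMean m lam α g) atTop
      (𝓝 (∫ p, g p ∂limitIntensity m α)) := by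
  have hC := scalingConst_pos m
  have hm0 : (0 : ℝ) < m := by exact_mod_cast hm
  have hneg : -2 / (m : ℝ) < 0 := div_neg_of_neg_of_pos (by norm_num) hm0
  have hα' : α * ((m : ℝ) + 2) < 2 := (lt_div_iff₀ (by positivity)).1 hα
  refine tendsto_mul_transformMean_of_middle hm hg hgc
    (c := scalingConst (m + 1) ^ (1 / (2 * ((m + 1 : ℕ) : ℝ))))
    (e := (2 + α * (((m + 1 : ℕ) : ℝ) - 1)) / (4 * ((m + 1 : ℕ) : ℝ)))
    (by positivity) ?_ hα (hneg.trans hα0) (fun lam => ?_) ?_ ?_ ?_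
  · rw [cast_succ_sub_one]
    positivity
  · rw [scalingFactor, cast_succ_add_one, if_neg hα.not_ge, if_pos hα0]
  · rw [cast_succ_sub_one, Nat.cast_add_one, ← mul_div_assoc, lt_div_iff₀ (by positivity)]
    nlinarith
  · rw [cast_succ_sub_one]
    positivity
  · have h1 : 1 - (2 + α * (((m + 1 : ℕ) : ℝ) - 1)) / (4 * ((m + 1 : ℕ) : ℝ)) *
        (2 * ((m : ℝ) + 1)) + α * ((m : ℝ) / 2) = 0 := by
      push_cast
      field_simp
      ring
    have h2 := ((tendsto_one_add_div (tendsto_rpow_atTop hα0)).pow (m + 1)).const_mul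
      ((kappa (m + 1))⁻¹ * (scalingConst (m + 1))⁻¹)
    have h3 : (kappa (m + 1))⁻¹ * (scalingConst (m + 1))⁻¹ * 1 ^ (m + 1) = (capConst m)⁻¹ := by
      have := kappa_pos (m + 1)
      have := capConst_pos m
      rw [scalingConst_eq, one_pow]
      field_simp
    rw [h3] at h2
    simpa only [h1, Real.rpow_zero, one_mul, rpow_inv_two_mul_pow hC.le] using h2

theorem tendsto_mul_transformMean_of_zero (hm : 1 ≤ m) (hg : Continuous g)
    (hgc : HasCompactSupport g) :
    Tendsto (fun lam : ℝ => lam * transformMean m lam 0 g) atTop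
      (𝓝 (∫ p, g p ∂limitIntensity m 0)) := by
  have hC := scalingConst_pos m
  have hm0 : (0 : ℝ) < m := by exact_mod_cast hm
  refine tendsto_mul_transformMean_of_middle hm hg hgc
    (c := √2 * scalingConst (m + 1) ^ (1 / (2 * ((m + 1 : ℕ) : ℝ))))
    (e := 1 / (2 * ((m + 1 : ℕ) : ℝ)))
    (by positivity) (by positivity) (by positivity)
    (div_neg_of_neg_of_pos (by norm_num) hm0) (fun lam => ?_) (by positivity) (by positivity) ?_
  · rw [scalingFactor, cast_succ_add_one, if_neg (not_le.2 (by positivity)), if_neg (lt_irrefl _),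
      if_pos rfl]
  · have h1 : 1 - 1 / (2 * ((m + 1 : ℕ) : ℝ)) * (2 * ((m : ℝ) + 1)) + 0 * ((m : ℝ) / 2) = 0 := by
      push_cast
      field_simp
      ring
    -- For `r = 1` the ratio `(1 + r)/r` is `2`, and the extra `√2` in the scaling factor
    -- compensates `2^{m+1}`.
    have h2 : (kappa (m + 1))⁻¹ *
        ((√2 * scalingConst (m + 1) ^ (1 / (2 * ((m + 1 : ℕ) : ℝ)))) ^ (2 * (m + 1)))⁻¹ *
        2 ^ (m + 1) = (capConst m)⁻¹ := by
      have := kappa_pos (m + 1)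
      have := capConst_pos m
      rw [mul_pow, rpow_inv_two_mul_pow hC.le, scalingConst_eq, pow_mul √2,
        Real.sq_sqrt zero_le_two]
      field_simp
    simp only [h1, Real.rpow_zero, one_mul, div_one, one_add_one_eq_two]
    rw [h2]
    exact tendsto_const_nhds

theorem tendsto_mul_transformMean_of_neg (hm : 1 ≤ m) (hg : Continuous g)
    (hgc : HasCompactSupport g) (hα0 : α < 0) (hα : -2 / (m : ℝ) < α) :
    Tendsto (fun lam : ℝ => lam * transformMean m lam α g) atTop
      (𝓝 (∫ p, g p ∂limitIntensity m α)) := by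
  have hC := scalingConst_pos m
  have hm0 : (0 : ℝ) < m := by exact_mod_cast hm
  have hα1 : α < 2 / ((m : ℝ) + 2) := hα0.trans (by positivity)
  have hα2 : -2 < α * (m : ℝ) := (div_lt_iff₀ hm0).1 hα
  have he : 0 < 2 - α * ((m : ℝ) + 2) := by nlinarith
  refine tendsto_mul_transformMean_of_middle hm hg hgc
    (c := scalingConst (m + 1) ^ (1 / (2 * ((m + 1 : ℕ) : ℝ))))
    (e := (2 - α * (((m + 1 : ℕ) : ℝ) + 1)) / (4 * ((m + 1 : ℕ) : ℝ)))
    (by positivity) ?_ hα1 hα (fun lam => ?_) ?_ ?_ ?_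
  · rw [cast_succ_add_one]
    positivity
  · rw [scalingFactor, cast_succ_add_one, cast_succ_sub_one, if_neg hα1.not_ge,
      if_neg hα0.not_gt, if_neg hα0.ne, if_pos hα]
  · rw [cast_succ_add_one]
    exact hα0.trans (by positivity)
  · rw [cast_succ_add_one, Nat.cast_add_one]
    -- The sign of this exponent decides whether `u²r → ∞`; it is positive exactly for `α > -2/m`.
    have h : α + 2 * ((2 - α * ((m : ℝ) + 2)) / (4 * ((m : ℝ) + 1)))
        = (2 + α * m) / (2 * ((m : ℝ) + 1)) := by
      field_simp
      ring
    rw [h]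
    exact div_pos (by linarith) (by positivity)
  · have h1 : 1 - (2 - α * (((m + 1 : ℕ) : ℝ) + 1)) / (4 * ((m + 1 : ℕ) : ℝ)) *
        (2 * ((m : ℝ) + 1)) + α * ((m : ℝ) / 2) = α * ((m + 1 : ℕ) : ℝ) := by
      push_cast
      field_simp
      ring
    have hr : Tendsto (fun lam : ℝ => lam ^ α) atTop (𝓝 0) := by
      simpa using tendsto_const_mul_rpow_zero 1 hα0
    have h2 := ((hr.const_add 1).pow (m + 1)).const_mul
      ((kappa (m + 1))⁻¹ * (scalingConst (m + 1))⁻¹)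
    have h3 : (kappa (m + 1))⁻¹ * (scalingConst (m + 1))⁻¹ * (1 + 0) ^ (m + 1)
        = (capConst m)⁻¹ := by
      have := kappa_pos (m + 1)
      have := capConst_pos m
      rw [scalingConst_eq, add_zero, one_pow]
      field_simp
    rw [h3] at h2
    simp only [h1, rpow_inv_two_mul_pow hC.le]
    refine h2.congr' ?_
    filter_upwards [eventually_gt_atTop 0] with lam hlam
    have hr0 : 0 < lam ^ α := Real.rpow_pos_of_pos hlam α
    rw [Real.rpow_mul_natCast hlam.le, ← mul_pow, mul_div_cancel₀ _ hr0.ne']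

/-- The positive part absorbs the case distinction at `h = 2`, matching the form in which small-cap
limits arise. -/
theorem sectionArea_eq_capConst (hm : 1 ≤ m) {h : ℝ} (hh : 0 ≤ h) :
    sectionArea (m + 1) h = capConst m * max 0 (h * (1 - h / 2)) ^ ((m : ℝ) / 2) := by
  have hm0 : (0 : ℝ) < m := by exact_mod_cast hm
  rw [sectionArea, capConst, Nat.add_sub_cancel, cast_succ_sub_one]
  split_ifs with h2
  · have h3 : 0 ≤ h * (1 - h / 2) := mul_nonneg hh (by linarith)
    rw [max_eq_right h3, mul_assoc, ← Real.mul_rpow zero_le_two h3]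
    congr 2
    ring
  · have h3 : h * (1 - h / 2) ≤ 0 := mul_nonpos_of_nonneg_of_nonpos hh (by linarith)
    rw [max_eq_left h3, Real.zero_rpow (by positivity), mul_zero]

theorem measurable_sectionArea (d : ℕ) : Measurable (sectionArea d) := by
  unfold sectionArea
  exact Measurable.ite measurableSet_Iic (by fun_prop) measurable_const

theorem sectionArea_le (hm : 1 ≤ m) {h : ℝ} (hh : 0 ≤ h) :
    sectionArea (m + 1) h ≤ capConst m := by
  rw [sectionArea_eq_capConst hm hh]
  refine mul_le_of_le_one_right (capConst_pos m).le ?_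
  refine Real.rpow_le_one (le_max_left _ _) (max_le zero_le_one ?_) (by positivity)
  nlinarith [sq_nonneg (h - 1)]

theorem kappa_rpow_pos (m : ℕ) (e : ℝ) : 0 < kappa (m + 1) ^ e :=
  Real.rpow_pos_of_pos (kappa_pos _) e

theorem heightMeasure_of_section (hm : 1 ≤ m) (hα : α = -2 / (m : ℝ)) :
    heightMeasure m α = densityHalfLine fun h =>
      sectionArea (m + 1) (kappa (m + 1) ^ (2 / ((m : ℝ) + 2)) * h) := by
  have hm0 : (0 : ℝ) < m := by exact_mod_cast hm
  have h1 : α < 2 / ((m : ℝ) + 2) := by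
    rw [hα]
    exact (div_neg_of_neg_of_pos (by norm_num) hm0).trans (by positivity)
  simp only [heightMeasure, cast_succ_add_one, cast_succ_sub_one]
  rw [if_neg h1.not_gt, if_neg h1.ne, if_neg hα.le.not_gt, if_pos hα, densityHalfLine]

theorem tendsto_mul_transformMean_of_section (hm : 1 ≤ m) (hg : Continuous g)
    (hgc : HasCompactSupport g) (hα : α = -2 / (m : ℝ)) :
    Tendsto (fun lam : ℝ => lam * transformMean m lam α g) atTop
      (𝓝 (∫ p, g p ∂limitIntensity m α)) := by
  have hm0 : (0 : ℝ) < m := by exact_mod_cast hm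
  have hα0 : α < 0 := by
    rw [hα]
    exact div_neg_of_neg_of_pos (by norm_num) hm0
  have hα1 : α < 2 / ((m : ℝ) + 2) := hα0.trans (by positivity)
  have hκ := kappa_pos (m + 1)
  set β := kappa (m + 1) ^ (2 / ((m : ℝ) + 2)) with hβ
  have hβ0 : 0 < β := kappa_rpow_pos _ _
  set c := kappa (m + 1) ^ (-1 / ((m : ℝ) + 2)) with hcdef
  have hc0 : 0 < c := kappa_rpow_pos _ _
  have hu : ∀ lam, scalingFactor (m + 1) lam α = c * lam ^ (1 / (m : ℝ)) := fun lam => by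
    rw [scalingFactor, cast_succ_add_one, cast_succ_sub_one, if_neg hα1.not_ge,
      if_neg hα0.not_gt, if_neg hα0.ne, if_neg hα.le.not_gt, if_pos hα]
  have hc2 : (c ^ 2)⁻¹ = β := by
    rw [hcdef, ← Real.rpow_mul_natCast hκ.le, ← Real.rpow_neg hκ.le, hβ]
    congr 1
    push_cast
    ring
  -- At this `α` the product `u²r` is constant, so the curvature parameter is `c^{-2} = β` instead
  -- of `0`.
  have he : -(α + 2 * (1 / (m : ℝ))) = 0 := by
    rw [hα]
    field_simp
    ring
  have hβlim : Tendsto (fun lam : ℝ => (c ^ 2)⁻¹ * lam ^ (-(α + 2 * (1 / (m : ℝ))))) atTop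
      (𝓝 β) := by
    simp only [he, hc2, Real.rpow_zero, mul_one]
    exact tendsto_const_nhds
  have h1 : 1 - 1 / (m : ℝ) * (2 * ((m : ℝ) + 1)) + α * ((m : ℝ) / 2)
      = α * ((m + 1 : ℕ) : ℝ) := by
    rw [hα]
    push_cast
    field_simp
    ring
  have hr : Tendsto (fun lam : ℝ => lam ^ α) atTop (𝓝 0) := by
    simpa using tendsto_const_mul_rpow_zero 1 hα0
  have h3 : (kappa (m + 1))⁻¹ * (c ^ (2 * (m + 1)))⁻¹ * (1 + 0) ^ (m + 1)
      = β ^ ((m : ℝ) / 2) := by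
    rw [add_zero, one_pow, mul_one, pow_mul, ← inv_pow, hc2, hβ, ← Real.rpow_mul_natCast hκ.le,
      ← Real.rpow_mul hκ.le, ← Real.rpow_neg_one, ← Real.rpow_add hκ]
    congr 1
    push_cast
    field_simp
    ring
  have h2 := ((hr.const_add 1).pow (m + 1)).const_mul
    ((kappa (m + 1))⁻¹ * (c ^ (2 * (m + 1)))⁻¹)
  rw [h3] at h2
  obtain ⟨hlim, hb⟩ := heightDensity_limits_of_small_cap (B := β ^ ((m : ℝ) / 2)) hm hc0
    (e := 1 / (m : ℝ)) (by positivity) (hα0.trans (by positivity)) hβlim (by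
      simp only [h1]
      refine h2.congr' ?_
      filter_upwards [eventually_gt_atTop 0] with lam hlam
      have hr0 : 0 < lam ^ α := Real.rpow_pos_of_pos hlam α
      rw [Real.rpow_mul_natCast hlam.le, ← mul_pow, mul_div_cancel₀ _ hr0.ne'])
  refine tendsto_mul_transformMean_of_density hm hg hgc
    (ρ := fun h => sectionArea (m + 1) (β * h))
    ((measurable_sectionArea _).comp (measurable_const_mul β)) (fun h hh => ?_)
    (fun H => ⟨capConst m, fun h h0 _ => sectionArea_le hm (by positivity)⟩)
    (heightMeasure_of_section hm hα) ?_ ?_ ?_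
  · rw [sectionArea_eq_capConst hm (by positivity)]
    have := capConst_pos m
    positivity
  · simp only [hu]
    exact tendsto_const_mul_rpow_atTop hc0 (by positivity)
  · refine (ae_restrict_iff' measurableSet_Ioi).2 (.of_forall fun h hh => ?_)
    have hh0 : 0 < h := hh
    have h4 : sectionArea (m + 1) (β * h) = β ^ ((m : ℝ) / 2) *
        (capConst m * max 0 (h * (1 - β * h / 2)) ^ ((m : ℝ) / 2)) := by
      rw [sectionArea_eq_capConst hm (by positivity), mul_left_comm,
        ← Real.mul_rpow hβ0.le (le_max_left _ _), mul_max_of_nonneg _ _ hβ0.le, mul_zero,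
        mul_assoc]
    rw [h4]
    simpa only [hu] using hlim h
  · simpa only [hu] using hb

end Cases

/-! ### Large caps: perturbations at or above the critical size. -/

section LargePerturbations

variable {m : ℕ} {α : ℝ} {g : E m × ℝ≥0 → ℂ}

theorem scalingFactor_of_large (h : 2 / ((m : ℝ) + 2) ≤ α) (lam : ℝ) :
    scalingFactor (m + 1) lam α
      = kappa (m + 1) ^ (-1 / ((m : ℝ) + 2)) * lam ^ (1 / ((m : ℝ) + 2)) := by
  rw [scalingFactor, cast_succ_add_one, if_pos h]

theorem tendsto_scalingFactor_of_large (h : 2 / ((m : ℝ) + 2) ≤ α) :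
    Tendsto (fun lam => scalingFactor (m + 1) lam α) atTop atTop := by
  simp only [scalingFactor_of_large h]
  exact tendsto_const_mul_rpow_atTop (kappa_rpow_pos _ _) (by positivity)

theorem large_cap_factor_eq_one (h : 2 / ((m : ℝ) + 2) ≤ α) {lam : ℝ} (hlam : 0 < lam) :
    lam * (kappa (m + 1))⁻¹ * (scalingFactor (m + 1) lam α ^ (m + 2))⁻¹ = 1 := by
  have hκ := kappa_pos (m + 1)
  have h1 : -1 / ((m : ℝ) + 2) * ((m + 2 : ℕ) : ℝ) = -1 := by
    push_cast
    field_simp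
  have h2 : 1 / ((m : ℝ) + 2) * ((m + 2 : ℕ) : ℝ) = 1 := by
    push_cast
    field_simp
  rw [scalingFactor_of_large h, const_mul_rpow_pow hlam.le, ← Real.rpow_mul_natCast hκ.le, h1, h2,
    Real.rpow_neg_one, Real.rpow_one]
  field_simp

theorem rpow_div_sq_scalingFactor_of_large (h : 2 / ((m : ℝ) + 2) ≤ α) {lam : ℝ}
    (hlam : 0 < lam) : lam ^ α / scalingFactor (m + 1) lam α ^ 2
      = kappa (m + 1) ^ (2 / ((m : ℝ) + 2)) * lam ^ (α - 2 / ((m : ℝ) + 2)) := by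
  have hκ := kappa_pos (m + 1)
  rw [scalingFactor_of_large h, rpow_div_sq_const_mul_rpow hlam, ← Real.rpow_mul_natCast hκ.le,
    ← Real.rpow_neg hκ.le]
  congr 2
  · push_cast
    ring
  · ring

theorem tendsto_rpow_of_large (h : 2 / ((m : ℝ) + 2) ≤ α) :
    Tendsto (fun lam : ℝ => lam ^ α) atTop atTop :=
  tendsto_rpow_atTop ((by positivity : (0 : ℝ) < 2 / ((m : ℝ) + 2)).trans_le h)

theorem tendsto_reducedHeight_of_large (h : 2 / ((m : ℝ) + 2) ≤ α) (t : ℝ) :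
    Tendsto (fun lam => reducedHeight (lam ^ α) (scalingFactor (m + 1) lam α) t) atTop (𝓝 t) := by
  have hu := tendsto_scalingFactor_of_large h
  simpa using tendsto_reducedHeight hu (tendsto_inv_sq_mul hu (tendsto_rpow_of_large h)) t

theorem heightMeasure_of_large (h : 2 / ((m : ℝ) + 2) < α) :
    heightMeasure m α = densityHalfLine fun _ => 1 := by
  simp only [heightMeasure, cast_succ_add_one]
  rw [if_pos h, densityHalfLine]
  simp only [ENNReal.ofReal_one]
  exact withDensity_one.symm

theorem tendsto_mul_transformMean_of_large (hm : 1 ≤ m) (hg : Continuous g)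
    (hgc : HasCompactSupport g) (hα : 2 / ((m : ℝ) + 2) < α) :
    Tendsto (fun lam : ℝ => lam * transformMean m lam α g) atTop
      (𝓝 (∫ p, g p ∂limitIntensity m α)) := by
  have hu := tendsto_scalingFactor_of_large hα.le
  have hlam := (eventually_gt_atTop (0 : ℝ)).mono fun lam => large_cap_factor_eq_one hα.le
  refine tendsto_mul_transformMean_of_density hm hg hgc (ρ := fun _ => 1) measurable_const
    (fun _ _ => zero_le_one) (fun _ => ⟨1, fun _ _ _ => le_rfl⟩) (heightMeasure_of_large hα) hu
    ((ae_restrict_iff' measurableSet_Ioi).2 (.of_forall fun h hh => ?_))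
    (exists_heightDensity_le_of_large_cap hu (tendsto_rpow_of_large hα.le) hlam)
  refine tendsto_heightDensity_of_large_cap hu (tendsto_rpow_of_large hα.le) hlam ?_
  -- Since `r/u² → ∞`, the cap height eventually exceeds the diameter `2` and the cap is the whole
  -- sphere.
  have hhc : Tendsto (fun lam => lam ^ α / scalingFactor (m + 1) lam α ^ 2 *
      reducedHeight (lam ^ α) (scalingFactor (m + 1) lam α) h) atTop atTop := by
    refine Tendsto.atTop_mul_pos (Set.mem_Ioi.1 hh) ?_ (tendsto_reducedHeight_of_large hα.le h)
    refine (tendsto_const_mul_rpow_atTop (kappa_rpow_pos m (2 / ((m : ℝ) + 2)))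
      (sub_pos.2 hα)).congr' ?_
    filter_upwards [eventually_gt_atTop 0] with lam hlam
    rw [rpow_div_sq_scalingFactor_of_large hα.le hlam]
  refine tendsto_const_nhds.congr' ?_
  filter_upwards [hhc.eventually_ge_atTop 2] with lam hlam
  exact (capArea_of_two_le hlam).symm

theorem heightMeasure_of_critical (hα : α = 2 / ((m : ℝ) + 2)) :
    heightMeasure m α = densityHalfLine fun h =>
      capArea m (kappa (m + 1) ^ (2 / ((m : ℝ) + 2)) * h) := by
  simp only [heightMeasure, cast_succ_add_one]
  rw [if_neg hα.le.not_gt, if_pos hα, densityHalfLine]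

theorem tendsto_mul_transformMean_of_critical (hm : 1 ≤ m) (hg : Continuous g)
    (hgc : HasCompactSupport g) (hα : α = 2 / ((m : ℝ) + 2)) :
    Tendsto (fun lam : ℝ => lam * transformMean m lam α g) atTop
      (𝓝 (∫ p, g p ∂limitIntensity m α)) := by
  have hu := tendsto_scalingFactor_of_large hα.ge
  have hlam := (eventually_gt_atTop (0 : ℝ)).mono fun lam => large_cap_factor_eq_one hα.ge
  set β := kappa (m + 1) ^ (2 / ((m : ℝ) + 2))
  have hβ : 0 < β := kappa_rpow_pos _ _
  have hmono : Monotone fun h => capArea m (β * h) := fun a b hab =>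
    monotone_capArea (mul_le_mul_of_nonneg_left hab hβ.le)
  refine tendsto_mul_transformMean_of_density hm hg hgc (ρ := fun h => capArea m (β * h))
    hmono.measurable (fun _ _ => capArea_nonneg _) (fun _ => ⟨1, fun _ _ _ => capArea_le_one _⟩)
    (heightMeasure_of_critical hα) hu ?_
    (exists_heightDensity_le_of_large_cap hu (tendsto_rpow_of_large hα.ge) hlam)
  -- Continuity of the cap area need not be proved: a monotone function is continuous off a
  -- countable set, which is null.
  have hcont := hmono.countable_not_continuousAt.ae_notMem (volume.restrict (Set.Ioi (0 : ℝ)))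
  filter_upwards [hcont] with h hh
  have hh : ContinuousAt (fun h => capArea m (β * h)) h := not_not.1 hh
  refine tendsto_heightDensity_of_large_cap hu (tendsto_rpow_of_large hα.ge) hlam ?_
  refine (hh.tendsto.comp (tendsto_reducedHeight_of_large hα.ge h)).congr' ?_
  filter_upwards [eventually_gt_atTop 0] with lam hlam
  simp only [Function.comp]
  rw [rpow_div_sq_scalingFactor_of_large hα.ge hlam, sub_eq_zero.2 hα, Real.rpow_zero, mul_one]

end LargePerturbations

/-! ### Assembling the regimes. -/

section Convergence

variable {m : ℕ} {α : ℝ} {g : E m × ℝ≥0 → ℂ}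

theorem heightMeasure_of_degenerate (hm : 1 ≤ m) (hα : α < -2 / (m : ℝ)) :
    heightMeasure m α = Measure.dirac 0 := by
  have hm0 : (0 : ℝ) < m := by exact_mod_cast hm
  have h1 : α < 2 / ((m : ℝ) + 2) :=
    hα.trans ((div_neg_of_neg_of_pos (by norm_num) hm0).trans (by positivity))
  simp only [heightMeasure, cast_succ_add_one, cast_succ_sub_one]
  rw [if_neg h1.not_gt, if_neg h1.ne, if_neg hα.not_gt, if_neg hα.ne]

theorem tendsto_mul_transformMean_of_small (hm : 1 ≤ m) (hg : Continuous g)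
    (hgc : HasCompactSupport g) (hα : α < -2 / (m : ℝ)) :
    Tendsto (fun lam : ℝ => lam * transformMean m lam α g) atTop
      (𝓝 (∫ p, g p ∂limitIntensity m α)) := by
  have hm0 : (0 : ℝ) < m := by exact_mod_cast hm
  have hα0 : α < 0 := hα.trans (div_neg_of_neg_of_pos (by norm_num) hm0)
  have hα1 : α < 2 / ((m : ℝ) + 2) := hα0.trans (by positivity)
  have hκ : 0 < ((m + 1 : ℕ) : ℝ) * kappa (m + 1) :=
    mul_pos (by positivity) (kappa_pos (m + 1))
  set c := (((m + 1 : ℕ) : ℝ) * kappa (m + 1)) ^ (-1 / (m : ℝ)) with hc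
  have hc0 : 0 < c := Real.rpow_pos_of_pos hκ _
  have hu : ∀ lam, scalingFactor (m + 1) lam α = c * lam ^ (1 / (m : ℝ)) := fun lam => by
    rw [scalingFactor, cast_succ_add_one, cast_succ_sub_one, if_neg hα1.not_ge,
      if_neg hα0.not_gt, if_neg hα0.ne, if_neg hα.not_gt, if_neg hα.ne]
  rw [limitIntensity, heightMeasure_of_degenerate hm hα, integral_volume_prod _ hg hgc,
    integral_dirac]
  refine tendsto_mul_transformMean_of_degenerate hm hg hgc ?_ ?_ ?_
  · simp only [hu]
    exact tendsto_const_mul_rpow_atTop hc0 (by positivity)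
  · filter_upwards [eventually_gt_atTop 0] with lam hlam
    rw [hu, const_mul_rpow_pow hlam.le, hc, ← Real.rpow_mul_natCast hκ.le,
      div_mul_cancel₀ _ hm0.ne', div_mul_cancel₀ _ hm0.ne', Real.rpow_neg_one, Real.rpow_one,
      mul_inv_cancel_left₀ hκ.ne']
  -- This is the exponent of `u²r`, negative exactly because `α < -2/m`.
  · have he : 1 / (m : ℝ) * (2 : ℕ) + α < 0 := by
      have h := (lt_div_iff₀ hm0).1 hα
      push_cast
      have h2 : 1 / (m : ℝ) * 2 + α = (2 + α * m) / m := by field_simp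
      rw [h2]
      exact div_neg_of_neg_of_pos (by linarith) hm0
    refine (tendsto_const_mul_rpow_zero (c ^ 2) he).congr' ?_
    filter_upwards [eventually_gt_atTop 0] with lam hlam
    rw [hu, const_mul_rpow_pow hlam.le, Real.rpow_add hlam, mul_assoc]

theorem tendsto_mul_transformMean {m : ℕ} (hm : 1 ≤ m) (α : ℝ) {g : E m × ℝ≥0 → ℂ}
    (hg : Continuous g) (hgc : HasCompactSupport g) :
    Tendsto (fun lam : ℝ => lam * transformMean m lam α g) atTop
      (𝓝 (∫ p, g p ∂limitIntensity m α)) := by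
  rcases lt_trichotomy α (2 / ((m : ℝ) + 2)) with h | h | h
  · rcases lt_trichotomy α (-2 / (m : ℝ)) with h' | h' | h'
    · exact tendsto_mul_transformMean_of_small hm hg hgc h'
    · exact tendsto_mul_transformMean_of_section hm hg hgc h'
    · rcases lt_trichotomy α 0 with h0 | rfl | h0
      · exact tendsto_mul_transformMean_of_neg hm hg hgc h0 h'
      · exact tendsto_mul_transformMean_of_zero hm hg hgc
      · exact tendsto_mul_transformMean_of_pos hm hg hgc h0 h
  · exact tendsto_mul_transformMean_of_critical hm hg hgc h
  · exact tendsto_mul_transformMean_of_large hm hg hgc h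

theorem isFiniteMeasureOnCompacts_limitIntensity (hm : 1 ≤ m) (α : ℝ) :
    IsFiniteMeasureOnCompacts (limitIntensity m α) := by
  have : IsFiniteMeasureOnCompacts (heightMeasure m α) := by
    rcases lt_trichotomy α (2 / ((m : ℝ) + 2)) with h | h | h
    · rcases lt_trichotomy α (-2 / (m : ℝ)) with h' | h' | h'
      · rw [heightMeasure_of_degenerate hm h']
        infer_instance
      · rw [heightMeasure_of_section hm h']
        refine isFiniteMeasureOnCompacts_densityHalfLine fun H =>
          ⟨capConst m, fun h h0 _ => sectionArea_le hm (mul_nonneg (kappa_rpow_pos _ _).le h0)⟩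
      · rw [heightMeasure_of_middle h h']
        exact isFiniteMeasureOnCompacts_densityHalfLine fun H => ⟨H ^ ((m : ℝ) / 2),
          fun h h0 hH => Real.rpow_le_rpow h0 hH (by positivity)⟩
    · rw [heightMeasure_of_critical h]
      exact isFiniteMeasureOnCompacts_densityHalfLine fun _ => ⟨1, fun _ _ _ => capArea_le_one _⟩
    · rw [heightMeasure_of_large h]
      exact isFiniteMeasureOnCompacts_densityHalfLine fun _ => ⟨1, fun _ _ _ => le_rfl⟩
  exact isFiniteMeasureOnCompacts_volume_prod _

end Convergence

end PerturbedHull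

end

/-- The ambient dimension is `d = m + 1 ≥ 2`. For every real `α`, both the rescaled perturbed
binomial process, as `n → ∞`, and the rescaled perturbed Poisson process, as the intensity `lam`
runs to infinity through the positive reals, converge in distribution to the Poisson point process
`η` with intensity measure `limitIntensity m α`. -/
theorem proposition1p1 (m : ℕ) (hm : 1 ≤ m) (α : ℝ)
    {Ωη : Type*} [MeasurableSpace Ωη] (Pη : Measure Ωη) [IsProbabilityMeasure Pη]
    (η : Ωη → PerturbedHull.PointConfig (PerturbedHull.E m × ℝ≥0))
    (hη : PerturbedHull.IsPoissonProcess Pη η (PerturbedHull.limitIntensity m α)) :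
    (∀ (Ω : ℕ → Type*) [∀ n, MeasurableSpace (Ω n)]
        (P : ∀ n, Measure (Ω n)) [∀ n, IsProbabilityMeasure (P n)]
        (X : ∀ n, Fin n → Ω n → PerturbedHull.Sph m)
        (e : ∀ n, Fin n → Ω n → PerturbedHull.E (m + 1)),
        (∀ n, PerturbedHull.IsBinomialInput n α (P n) (X n) (e n)) →
        TendstoInDistribution
          (fun n => PerturbedHull.rescaledBinomial n α (X n) (e n)) atTop η P Pη) ∧
    (∀ (Ω : Set.Ioi (0 : ℝ) → Type*) [∀ lam, MeasurableSpace (Ω lam)]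
        (P : ∀ lam, Measure (Ω lam)) [∀ lam, IsProbabilityMeasure (P lam)]
        (N : ∀ lam, Ω lam → ℕ)
        (x : ∀ lam, ℕ → Ω lam → PerturbedHull.Sph m)
        (e : ∀ lam, ℕ → Ω lam → PerturbedHull.E (m + 1)),
        (∀ lam : Set.Ioi (0 : ℝ), PerturbedHull.IsPoissonInput (lam : ℝ) α (P lam) (N lam) (x lam) (e lam)) →
        TendstoInDistribution
          (fun lam : Set.Ioi (0 : ℝ) => PerturbedHull.rescaledPoisson (lam : ℝ) α (N lam) (x lam) (e lam))
          atTop η P Pη) := by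
  have := PerturbedHull.isFiniteMeasureOnCompacts_limitIntensity hm α
  have hlim := fun f : C_c(PerturbedHull.E m × ℝ≥0, ℝ) =>
    PerturbedHull.tendsto_mul_transformMean hm α (PerturbedHull.continuous_exp_sub_one f)
      (PerturbedHull.hasCompactSupport_exp_sub_one f)
  refine ⟨fun Ω _ P _ X e h => ?_, fun Ω _ P _ N x e h => ?_⟩
  · refine PerturbedHull.PointConfig.tendstoInDistribution_of_charFunctional
      (fun n f => PerturbedHull.aemeasurable_integral_rescaledBinomial (h n) f)
      hη.aemeasurable_integral fun f => ?_
    rw [hη.integral_exp_integral f]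
    refine (Complex.tendsto_one_add_pow_exp_of_tendsto
      ((hlim f).comp tendsto_natCast_atTop_atTop)).congr' ?_
    -- The value `n = 0` is dropped, since the noise radius `n^α` must be positive.
    filter_upwards [eventually_gt_atTop 0] with n hn
    exact (PerturbedHull.integral_exp_rescaledBinomial hn (h n) f).symm
  · refine PerturbedHull.PointConfig.tendstoInDistribution_of_charFunctional
      (fun lam f => PerturbedHull.aemeasurable_integral_rescaledPoisson (h lam) f)
      hη.aemeasurable_integral fun f => ?_
    rw [hη.integral_exp_integral f]
    have hval : Tendsto (fun lam : Set.Ioi (0 : ℝ) => (lam : ℝ)) atTop atTop :=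
      tendsto_comp_val_Ioi_atTop.2 tendsto_id
    refine ((Complex.continuous_exp.tendsto _).comp ((hlim f).comp hval)).congr fun lam => ?_
    exact (PerturbedHull.integral_exp_rescaledPoisson lam.2 (h lam) f).symm
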